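/- **Setting.** All graphs are simple, $\mu(G)$ is the maximum size of a matching of $G$, and a dynamic graph on $n$ vertices starts empty and undergoes edge insertions and deletions. A matching $M$ of an $n$-vertex graph $G$ is $\beta$-approximate if $\beta|M|\ge\mu(G)$, and $(\alpha,\delta)$-approximate if $\alpha|M|+\delta n\ge\mu(G)$. For a partition of $V(G)$ into $d$ (possibly empty) parts, the concatenation of $G$ is the simple graph on the $d$ parts in which two different parts are adjacent iff an edge of $G$ joins them. A set of partitions of $V$ is $(k,\eta)$-matching preserving for $G$ if for each matching of size $k$ of $G$ one of the concatenations $G'$ of $G$ along these partitions has $\mu(G')\ge(1-\eta)k$. A dynamic matching algorithm is a word RAM program (for preprocessing, update, and query) that does not depend on $n$ or on the accuracy. It receives $n$ and the accuracy $\delta$ as the integer $\lceil 1/\delta\rceil$; at all times it stores the size of its current matching and reports the partner of any vertex in constant time. The time of the preprocessing is not counted. The update time is at most $\tau$ in the *worst case* if every update takes at most $\tau$ steps; it is *amortized* if, for some $k>0$, any $k$ consecutive updates take at most $k\tau$ steps, or, in the cumulative sense, if for all $t$ the first $t$ updates take at most $t\tau$ steps. A randomized algorithm *fails* within $H$ updates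 if in one of them it does not keep its approximation, its time bound or its word size. An *oblivious* adversary fixes the updates beforehand; an *adaptive* adversary may let each update depend on all random bits used so far. **Assumptions.** Let $\alpha\ge1$ and $a>0$ be constants. * $Alg_M$ is a dynamic matching algorithm that, for all $n\ge2$ and all $\delta=1/D$ with $D\ge1$ an integer, maintains an $(\alpha,\delta)$-approximate matching with update time $T(n,\delta)$ and words of $O(\log(n/\delta))$ bits, and fails within $H$ updates with probability at most $p_M(n,\delta,H)$. Here $T\ge1$ is non-decreasing in $n$ and non-increasing in $\delta$. * $Alg_S$ is a (possibly randomized) procedure that, given $n$, $1\le k\le n/2$ and $0<\eta<1$, outputs, except with probability at most $p_S(n,\eta)$, a set of at most $L(n,\eta)$ partitions of an $n$-element set $V$ into at most $a\,k\,C(n,\eta)$ parts that is $(k,\eta)$-matching preserving for every graph on $V$, where $L,C\ge1$. **Claim.** There are a dynamic matching algorithm $Alg$, which uses $Alg_S$ as a black box, and a constant $c\ge1$, both depending only on $\alpha$, $a$, $Alg_M$ and the constants in its word size and query time, such that for all $n\ge2$ and $0<\varepsilon<1$, with $L=L(n,\varepsilon/c)$ and $C=C(n,\varepsilon/c)$,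 $Alg$ maintains an $(\alpha+\varepsilon)$-approximate matching of $n$-vertex dynamic graphs with update time at most $$c\cdot T\!\left(n,\frac{\varepsilon}{c\,C}\right)\cdot\frac{L^2\log^2 n}{\varepsilon^4},$$ queries in time $c$, and words of $O(\log(nLC/\varepsilon))$ bits. It fails within $H$ updates with probability at most $c\,\frac{\log n}{\varepsilon}\,\bigl(L\,p'+p_S(n,\varepsilon/c)\bigr)$, whenever $p'$ bounds all $p_M(n',1/D,H)$ with $2\le n'\le n$ and $1\le D\le cC/\varepsilon$. Moreover: * If $Alg_M$ is deterministic, then $Alg$ uses no coins except those of $Alg_S$; in particular, if both $Alg_M$ and $Alg_S$ are deterministic, so is $Alg$. * If $Alg_M$ works against adaptive (oblivious) adversaries, so does $Alg$. * If the update time of $Alg_M$ is worst-case (amortized, in either of the two senses), so is that of $Alg$. * $Alg$ calls $Alg_S$ in the preprocessing only, with accuracy $\varepsilon/c$, and at most once for each matching size $k$. -/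

import Mathlib

namespace DynMatching

/-! ### Matchings, contraction along a partition, matching-preserving sets of partitions -/

/-- `M` is a matching of `G`: a set of pairwise vertex-disjoint edges of `G`. -/
def IsMatching {V : Type} (G : SimpleGraph V) (M : Finset (Sym2 V)) : Prop :=
  (∀ e ∈ M, e ∈ G.edgeSet) ∧ ∀ e ∈ M, ∀ f ∈ M, ∀ v : V, v ∈ e → v ∈ f → e = f

/-- `μ(G)`: the largest size of a matching of `G` (used for finite `V`, where the set below is
non-empty and bounded). -/
noncomputable def matchNum {V : Type} (G : SimpleGraph V) : ℕ :=
  sSup {k | ∃ M : Finset (Sym2 V), IsMatching G M ∧ M.card = k}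

/-- The concatenation of `G` along the partition of its vertices into the fibres of `f`: two
different parts are adjacent iff some edge of `G` joins them. -/
def concat {V P : Type} (G : SimpleGraph V) (f : V → P) : SimpleGraph P where
  Adj i j := i ≠ j ∧ ∃ u w, f u = i ∧ f w = j ∧ G.Adj u w
  symm := ⟨fun _ _ h => by
    obtain ⟨hne, u, w, hu, hw, ha⟩ := h
    exact ⟨hne.symm, w, u, hw, hu, ha.symm⟩⟩
  loopless := ⟨fun _ h => h.1 rfl⟩

/-- A set of `num` partitions of the vertex set `Fin n`, each into `parts` (possibly empty) parts;
`part i v` is the part of `v` in the `i`-th partition. -/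
structure Family (n : ℕ) where
  num : ℕ
  parts : ℕ
  part : Fin num → Fin n → Fin parts

/-- `(k, η)`-matching preserving for the graph `G`. -/
def Family.MatchingPreserving {n : ℕ} (F : Family n) (G : SimpleGraph (Fin n)) (k : ℕ) (η : ℝ) :
    Prop :=
  ∀ M : Finset (Sym2 (Fin n)), IsMatching G M → M.card = k →
    ∃ i : Fin F.num, (1 - η) * k ≤ matchNum (concat G (F.part i))

/-- `F` consists of at most `ℓ` partitions into at most `P` parts and is `(k, η)`-matching
preserving whatever the graph on the vertex set `Fin n` is. -/
def Family.Good {n : ℕ} (F : Family n) (k : ℕ) (η ℓ P : ℝ) : Prop :=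
  (F.num : ℝ) ≤ ℓ ∧ (F.parts : ℝ) ≤ P ∧ ∀ G : SimpleGraph (Fin n), F.MatchingPreserving G k η

/-! ### Finite uniform probability -/

/-- The probability of `E` under the uniform distribution on the finite type `Ω`. -/
noncomputable def prob (Ω : Type) (E : Ω → Prop) : ℝ :=
  (Nat.card {ω : Ω // E ω} : ℝ) / (Nat.card Ω : ℝ)

/-- A (possibly randomized) generator of sets of partitions: given the number `n` of vertices, the
matching size `k` and the accuracy `η` it tosses `bits n k η` fair coins and outputs a family.
Without coins it is deterministic. -/
structure Generator where
  bits : ℕ → ℕ → ℝ → ℕ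
  out : (n k : ℕ) → (η : ℝ) → (Fin (bits n k η) → Bool) → Family n

/-! ### The word RAM -/

abbrev Mem := ℕ → ℕ

inductive BinOp
  | add | sub | mul | div | mod | land | lor | xor | shl | shr | lt | eq

def BinOp.eval : BinOp → ℕ → ℕ → ℕ
  | .add, x, y => x + y
  | .sub, x, y => x - y
  | .mul, x, y => x * y
  | .div, x, y => x / y
  | .mod, x, y => x % y
  | .land, x, y => x &&& y
  | .lor, x, y => x ||| y
  | .xor, x, y => x ^^^ y
  | .shl, x, y => x <<< y
  | .shr, x, y => x >>> y
  | .lt, x, y => if x < y then 1 else 0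
  | .eq, x, y => if x = y then 1 else 0

/-- Programs of the word RAM. Cells are addressed directly by constants, or indirectly. -/
inductive Com
  /-- `M[d] := c` -/
  | const (d c : ℕ)
  /-- `M[d] := M[a] o M[b]` -/
  | bin (o : BinOp) (d a b : ℕ)
  /-- `M[d] := M[M[a]]` -/
  | load (d a : ℕ)
  /-- `M[M[a]] := M[b]` -/
  | store (a b : ℕ)
  /-- `M[d] :=` the `M[a]`-th random bit supplied to the current operation -/
  | rand (d a : ℕ)
  /-- call the generator for the matching size `M[a]`; its output is written from address `M[b]` -/
  | gen (a b : ℕ)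
  | seq (c₁ c₂ : Com)
  /-- if `M[a] ≠ 0` then `c₁` else `c₂` -/
  | ite (a : ℕ) (c₁ c₂ : Com)
  /-- while `M[a] ≠ 0` do `c` -/
  | loop (a : ℕ) (c : Com)

/-- The program contains no coin toss. -/
def Com.RandFree : Com → Prop
  | .rand _ _ => False
  | .seq c₁ c₂ => c₁.RandFree ∧ c₂.RandFree
  | .ite _ c₁ c₂ => c₁.RandFree ∧ c₂.RandFree
  | .loop _ c => c.RandFree
  | _ => True

/-- The program contains no call of the generator. -/
def Com.CallFree : Com → Prop
  | .gen _ _ => False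
  | .seq c₁ c₂ => c₁.CallFree ∧ c₂.CallFree
  | .ite _ c₁ c₂ => c₁.CallFree ∧ c₂.CallFree
  | .loop _ c => c.CallFree
  | _ => True

/-- The memory after the family `F` has been written from address `b` on: the number of partitions,
the number of parts, and then the table of all `part i v`, row by row. -/
def Family.write {n : ℕ} (F : Family n) (b : ℕ) (m : Mem) : Mem := fun x =>
  if x = b then F.num
  else if x = b + 1 then F.parts
  else if h : b + 2 ≤ x ∧ (x - (b + 2)) / n < F.num ∧ (x - (b + 2)) % n < n then
    (F.part ⟨(x - (b + 2)) / n, h.2.1⟩ ⟨(x - (b + 2)) % n, h.2.2⟩ : ℕ)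
  else m x

/-- The answers to the generator calls of one execution, as a function of the matching size. -/
abbrev Oracle (n : ℕ) := ℕ → Family n

/-- `Exec W g r c m m' t l`: on a machine whose words hold the numbers `0, …, W`, with generator
answers `g` and random bits `r`, the program `c` started in memory `m` halts in memory `m'` after
`t` steps, and `l` lists the matching sizes for which it called the generator. An instruction whose
result does not fit into a word does not execute, so that an overflowing program has no execution. -/
inductive Exec {n : ℕ} (W : ℕ) (g : Oracle n) (r : ℕ → Bool) :
    Com → Mem → Mem → ℕ → List ℕ → Prop
  | const (d c : ℕ) (m : Mem) (h : c ≤ W) :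
      Exec W g r (.const d c) m (Function.update m d c) 1 []
  | bin (o : BinOp) (d a b : ℕ) (m : Mem) (h : o.eval (m a) (m b) ≤ W) :
      Exec W g r (.bin o d a b) m (Function.update m d (o.eval (m a) (m b))) 1 []
  | load (d a : ℕ) (m : Mem) :
      Exec W g r (.load d a) m (Function.update m d (m (m a))) 1 []
  | store (a b : ℕ) (m : Mem) :
      Exec W g r (.store a b) m (Function.update m (m a) (m b)) 1 []
  | rand (d a : ℕ) (m : Mem) :
      Exec W g r (.rand d a) m (Function.update m d (r (m a)).toNat) 1 []
  | gen (a b : ℕ) (m : Mem) (hn : (g (m a)).num ≤ W) (hp : (g (m a)).parts ≤ W)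
      (hb : m b + 2 + (g (m a)).num * n ≤ W) :
      Exec W g r (.gen a b) m ((g (m a)).write (m b) m) 1 [m a]
  | seq {c₁ c₂ : Com} {m m₁ m₂ : Mem} {t₁ t₂ : ℕ} {l₁ l₂ : List ℕ}
      (h₁ : Exec W g r c₁ m m₁ t₁ l₁) (h₂ : Exec W g r c₂ m₁ m₂ t₂ l₂) :
      Exec W g r (.seq c₁ c₂) m m₂ (t₁ + t₂) (l₁ ++ l₂)
  | iteTrue {a : ℕ} {c₁ c₂ : Com} {m m' : Mem} {t : ℕ} {l : List ℕ} (ha : m a ≠ 0)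
      (h : Exec W g r c₁ m m' t l) : Exec W g r (.ite a c₁ c₂) m m' (t + 1) l
  | iteFalse {a : ℕ} {c₁ c₂ : Com} {m m' : Mem} {t : ℕ} {l : List ℕ} (ha : m a = 0)
      (h : Exec W g r c₂ m m' t l) : Exec W g r (.ite a c₁ c₂) m m' (t + 1) l
  | loopTrue {a : ℕ} {c : Com} {m m₁ m₂ : Mem} {t₁ t₂ : ℕ} {l₁ l₂ : List ℕ} (ha : m a ≠ 0)
      (h₁ : Exec W g r c m m₁ t₁ l₁) (h₂ : Exec W g r (.loop a c) m₁ m₂ t₂ l₂) :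
      Exec W g r (.loop a c) m m₂ (t₁ + t₂ + 1) (l₁ ++ l₂)
  | loopFalse {a : ℕ} {c : Com} {m : Mem} (ha : m a = 0) :
      Exec W g r (.loop a c) m m 1 []

/-! ### Dynamic matching algorithms -/

/-- A dynamic matching algorithm is a fixed triple of programs, the same for all numbers of
vertices and all accuracies, working on a common memory; cells `0, 1, 2` serve for input and output.
* `start`: preprocessing for the empty graph; the number of vertices is in cell `0`, the accuracy
  parameter in cell `1`, all other cells are `0`.
* `update`: cell `0` holds `1` for the insertion and `0` for the deletion of the edge between the
  vertices in cells `1` and `2`.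
* `mate`: the partner of the vertex in cell `0` in the maintained matching is returned in cell `0`
  (`0` if there is none, and `w + 1` if it is `w`). The query leaves no trace in the memory.
After the preprocessing and after each update, cell `0` holds the size of the maintained matching. -/
structure Algo where
  start : Com
  update : Com
  mate : Com

/-- The algorithm tosses no coins. -/
def Algo.Deterministic (A : Algo) : Prop :=
  A.start.RandFree ∧ A.update.RandFree ∧ A.mate.RandFree

/-- No generator is called after the preprocessing. -/
def Algo.CallsOnlyAtStart (A : Algo) : Prop :=
  A.update.CallFree ∧ A.mate.CallFree

/-- No generator is ever called. -/
def Algo.CallFree (A : Algo) : Prop := A.start.CallFree ∧ A.CallsOnlyAtStart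

/-- The memory at the beginning of the preprocessing. -/
def startMem (n x : ℕ) : Mem := fun i => if i = 0 then n else if i = 1 then x else 0

/-- Every execution of the preprocessing calls the generator at most once for each size. -/
def Algo.SingleCalls (A : Algo) : Prop :=
  ∀ (n x W : ℕ) (g : Oracle n) (r : ℕ → Bool) (m : Mem) (t : ℕ) (l : List ℕ),
    Exec W g r A.start (startMem n x) m t l → l.Nodup

/-- A vertex pair; an update of the graph is the insertion of an absent pair or the deletion of a
present one, so it is given by the pair. -/
abbrev Pair (n : ℕ) := {p : Fin n × Fin n // p.1 ≠ p.2}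

/-- The graph after the first `s` rounds, starting from the empty graph; in a round in which the
adversary idles (`none`) nothing happens. -/
def graphAt {n : ℕ} (moves : ℕ → Option (Pair n)) : ℕ → SimpleGraph (Fin n)
  | 0 => ⊥
  | s + 1 =>
    match moves s with
    | none => graphAt moves s
    | some p => symmDiff (graphAt moves s) (SimpleGraph.edge p.1.1 p.1.2)

open Classical in
/-- The memory at the beginning of an update of the current graph `G` at the pair `p`. -/
noncomputable def updateMem {n : ℕ} (G : SimpleGraph (Fin n)) (p : Pair n) (m : Mem) : Mem :=
  Function.update (Function.update (Function.update m
    0 (if G.Adj p.1.1 p.1.2 then 0 else 1)) 1 (p.1.1 : ℕ)) 2 (p.1.2 : ℕ)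

/-- In memory `m` the algorithm holds a matching `M` of `G` with `μ(G) ≤ β |M| + γ`: cell `0`
holds the size of `M`, and the partner of any vertex in `M` is reported in at most `q` steps. -/
def Holds {n : ℕ} (A : Algo) (W : ℕ) (g : Oracle n) (q : ℕ) (β γ : ℝ)
    (G : SimpleGraph (Fin n)) (m : Mem) : Prop :=
  ∃ M : Finset (Sym2 (Fin n)), IsMatching G M ∧ (matchNum G : ℝ) ≤ β * M.card + γ ∧
    m 0 = M.card ∧
    ∀ v : Fin n, ∃ m' t l, Exec W g (fun _ => false) A.mate (Function.update m 0 v) m' t l ∧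
      t ≤ q ∧ ((m' 0 = 0 ∧ ∀ w, s(v, w) ∉ M) ∨ ∃ w : Fin n, s(v, w) ∈ M ∧ m' 0 = w + 1)

/-- How update times are measured. -/
inductive TimeMode
  /-- each update -/
  | worstCase
  /-- any `k` consecutive updates, for some `k > 0` fixed in advance -/
  | amortized
  /-- all updates since the beginning -/
  | total

/-- The number of updates in the rounds `a, …, b - 1`. -/
def numUpdates {n : ℕ} (moves : ℕ → Option (Pair n)) (a b : ℕ) : ℕ :=
  ((Finset.Ico a b).filter fun s => (moves s).isSome).card

/-- The update time during the first `H` rounds is at most `τ`; `cost s` is the time spent in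
round `s`, and `k` is used for the amortization over `k` consecutive updates only. -/
def TimeBound {n : ℕ} (k : ℕ) (τ : ℝ) (moves : ℕ → Option (Pair n)) (cost : ℕ → ℕ) (H : ℕ) :
    TimeMode → Prop
  | .worstCase => ∀ s < H, (cost s : ℝ) ≤ τ
  | .amortized => ∀ a b : ℕ, a ≤ b → b ≤ H → numUpdates moves a b ≤ k →
      ((∑ s ∈ Finset.Ico a b, cost s : ℕ) : ℝ) ≤ k * τ
  | .total => ∀ b ≤ H, ((∑ s ∈ Finset.Ico 0 b, cost s : ℕ) : ℝ) ≤ numUpdates moves 0 b * τ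

/-- The run of `A` on `n` vertices with accuracy parameter `x` against the given moves succeeds for
`H` rounds: it never gets stuck, a matching with `μ(G) ≤ β |M| + γ` is held at all times, and the
update time is at most `τ`. The preprocessing uses the random bits `r 0` and round `s` uses
`r (s + 1)`. -/
def RunSucceeds {n : ℕ} (A : Algo) (x W q : ℕ) (β γ τ : ℝ) (tm : TimeMode) (k : ℕ)
    (g : Oracle n) (moves : ℕ → Option (Pair n)) (r : ℕ → ℕ → Bool) (H : ℕ) : Prop :=
  ∃ (mem : ℕ → Mem) (cost : ℕ → ℕ),
    (∃ t l, Exec W g (r 0) A.start (startMem n x) (mem 0) t l) ∧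
    (∀ s < H,
      match moves s with
      | none => mem (s + 1) = mem s ∧ cost s = 0
      | some p => ∃ l, Exec W g (r (s + 1)) A.update (updateMem (graphAt moves s) p (mem s))
          (mem (s + 1)) (cost s) l) ∧
    (∀ s ≤ H, Holds A W g q β γ (graphAt moves s) (mem s)) ∧
    TimeBound k τ moves cost H tm

/-- The random bits of the preprocessing and of `H` rounds, `R` bits for each. -/
abbrev Seeds (H R : ℕ) := Fin (H + 1) → Fin R → Bool

/-- The seeds as infinite bit sequences, padded by `false`. -/
def Seeds.bit {H R : ℕ} (ω : Seeds H R) (s i : ℕ) : Bool :=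
  if h : s < H + 1 ∧ i < R then ω ⟨s, h.1⟩ ⟨i, h.2⟩ else false

inductive AdvMode
  /-- the moves are fixed beforehand -/
  | oblivious
  /-- each move may depend on all random bits used so far -/
  | adaptive

/-- `adv σ ω s` is the move in round `s`, when `σ` are the random bits of the generator and `ω`
those of the algorithm. -/
def Allowed {n H R : ℕ} {Coin : Type} (adv : Coin → Seeds H R → ℕ → Option (Pair n)) :
    AdvMode → Prop
  | .oblivious => ∀ σ σ' ω ω' s, adv σ ω s = adv σ' ω' s
  | .adaptive => ∀ σ ω ω' s, (∀ i : Fin (H + 1), (i : ℕ) ≤ s → ω i = ω' i) →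
      adv σ ω s = adv σ ω' s

/-- On `n` vertices and with accuracy parameter `x`, the algorithm `A` maintains a matching with
`μ(G) ≤ β |M| + γ` in update time `τ` on a machine with words `0, …, W`; against every adversary of
the given kind it fails within `H` rounds with probability at most `p H`, where each operation may
use any sufficiently large number `R` of random bits. The generator's answers are `g σ` for a
uniform `σ`. -/
def Maintains (A : Algo) (n x W q : ℕ) (β γ τ : ℝ) (p : ℕ → ℝ) (am : AdvMode) (tm : TimeMode)
    {Coin : Type} (g : Coin → Oracle n) : Prop :=
  ∃ k : ℕ, 0 < k ∧ ∀ H : ℕ, ∃ R₀ : ℕ, ∀ R ≥ R₀,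
    ∀ adv : Coin → Seeds H R → ℕ → Option (Pair n), Allowed adv am →
      prob (Coin × Seeds H R) (fun z =>
        ¬ RunSucceeds A x W q β γ τ tm k (g z.1) (adv z.1 z.2) z.2.bit H) ≤ p H

/-- Answers for algorithms that do not call a generator. -/
def noOracle (n : ℕ) : Unit → Oracle n := fun _ _ => ⟨0, n, fun _ v => v⟩

/-- Independent random bits of the generator for all matching sizes `k ≤ n`. -/
abbrev Generator.Coins (S : Generator) (n : ℕ) (η : ℝ) :=
  (k : Fin (n + 1)) → Fin (S.bits n k η) → Bool

/-- The answers of the generator at accuracy `η`. -/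
def Generator.oracle (S : Generator) (n : ℕ) (η : ℝ) (σ : S.Coins n η) : Oracle n := fun k =>
  if h : k < n + 1 then S.out n k η (σ ⟨k, h⟩) else S.out n k η (fun _ => false)

/-- For all `1 ≤ k ≤ n / 2` and `0 < η < 1`, the generator outputs, up to the failure probability
`p n η`, a set of at most `L n η` partitions into at most `a k C(n, η)` parts which is
`(k, η)`-matching preserving. -/
def Generator.Generates (S : Generator) (a : ℝ) (L C p : ℕ → ℝ → ℝ) : Prop :=
  ∀ n k : ℕ, 1 ≤ k → 2 * k ≤ n → ∀ η : ℝ, 0 < η → η < 1 →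
    prob (Fin (S.bits n k η) → Bool)
      (fun σ => ¬ (S.out n k η σ).Good k η (L n η) (a * (k * C n η))) ≤ p n η

/-- For all `n ≥ 2` and `D ≥ 1`, the algorithm `A` maintains an `(α, 1 / D)`-approximate matching of
graphs on `n` vertices in update time `T n (1 / D)`, with words of `O(log (n D))` bits and queries
in constant time; `p n D H` bounds the probability of a failure within `H` rounds. -/
def Algo.ApproxMaintains (A : Algo) (α : ℝ) (T : ℕ → ℝ → ℝ) (b q : ℕ) (p : ℕ → ℕ → ℕ → ℝ)
    (am : AdvMode) (tm : TimeMode) : Prop :=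
  ∀ n D : ℕ, 2 ≤ n → 1 ≤ D →
    Maintains A n D ((n * D + 2) ^ b) q α (n / D) (T n (1 / D)) (p n D) am tm (noOracle n)

end DynMatching

/-! The boosted algorithm solves the problem at all matching sizes at once. Let c = c₁⌈1/ε⌉ and let
the scales k be integers starting at 1 and growing by a factor of about 1 + 1/c, as long as 2k ≤ n.
For each scale the generator is called once, and every partition that it returns gets its own copy
of `AlgM`, which maintains a matching of the concatenation. With p parts the copy runs at accuracy D
= ⌊pc/k⌋ + 1, so its additive error p/D is at most k/c: since p = O(kC), this needs only D = O(C/ε),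
uniformly in k. There are O(log n / ε) scales and hence O(L log n / ε) copies.

Approximation (`matchNum_le_of_insts`). If μ(G) > 0, let k be the scale with k ≤ μ(G) ≤ k + k/c. A
matching of size k exists, so some concatenation for k has a matching of size (1 - η)k, and its copy
holds a matching of size b' with αb' + k/c ≥ (1 - η)k. The additive error is relative to k, so it
becomes multiplicative. With δ = ε/c₁ ≥ 1/c, η the largest matching held by any copy, of size b,
satisfies (1 - 2δ)k ≤ αb, while μ(G) ≤ (1 + δ)k; c₁ ≥ 5α makes the quotient at most α + ε.

Lifting (`IsMatching.image_rep`, `holds_of_worldOK`). An edge of a concatenation is represented by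
one edge of G between the two parts, and representatives of disjoint part pairs are disjoint. So for
each copy and each pair of parts the edges of G between them are kept in an unordered list with
positions, under constant-time insertion and deletion; the head of the list is the representative.
One update of G changes a concatenation by at most one edge, namely when a list becomes empty or
nonempty (`concat_toggle`, `EdgeLists.stepMove_insert`, `EdgeLists.stepMove_erase`). A query asks
the best copy for the partner of the part and decodes the head of the list.

Machine model. A small program logic (`WP`) is proved sound for `Exec`. Memories of the copies and
the lists are arrays laid out in one heap by a pairing function, and `sim` runs a program on such an
array with a constant factor overhead (`sim_wp`). Every register, address and word is bounded by a
power of a number Z that is polynomial in nLC/ε.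

Time (`timeBound_of_insts`). Every update costs a constant per copy plus the simulated time. The
copies may idle, and their amortization windows are brought to a common multiple. Monotonicity of T
bounds all copies by T(n, ε/(cC)).

Probability (`prob_instance_le`, `boost_maintains`). Each copy reads its own positions of the random
bits, so that all other bits can be frozen and regarded as part of an adversary against this copy;
this adversary is oblivious, or adaptive, if the original one is. A union bound over the copies,
after one over the scales for the generator, gives the failure probability. -/

namespace DynMatching

/-! ### A program logic for the word RAM

Programs are written with registers (cells `0, …, 31`), temporary cells (`32, …, 63`) in which
expressions are evaluated, and the heap (all cells from `64` on). -/

/-- Expressions over registers and the heap. -/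
inductive Exp
  | lit (k : ℕ)
  | reg (i : ℕ)
  | op (o : BinOp) (e f : Exp)
  -- A square evaluates its argument only once; the pairing function, used in all addresses, needs
  -- one.
  | sq (e : Exp)
  | ld (e : Exp)

/-- An abstract machine state: registers, heap, elapsed time and generator calls so far. -/
structure State where
  reg : ℕ → ℕ
  heap : ℕ → ℕ
  time : ℕ
  calls : List ℕ

namespace State

def setReg (s : State) (i v : ℕ) : State := { s with reg := Function.update s.reg i v }

def setHeap (s : State) (a v : ℕ) : State := { s with heap := Function.update s.heap a v }

def tick (s : State) (t : ℕ) : State := { s with time := s.time + t }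

variable (s : State) (i v a t j : ℕ)

@[simp] theorem setReg_reg : (s.setReg i v).reg j = if j = i then v else s.reg j := by
  simp [setReg, Function.update_apply]
@[simp] theorem setReg_heap : (s.setReg i v).heap = s.heap := rfl
@[simp] theorem setReg_time : (s.setReg i v).time = s.time := rfl
@[simp] theorem setReg_calls : (s.setReg i v).calls = s.calls := rfl
@[simp] theorem setHeap_reg : (s.setHeap a v).reg = s.reg := rfl
theorem setHeap_heap : (s.setHeap a v).heap j = if j = a then v else s.heap j := by
  simp [setHeap, Function.update_apply]
@[simp] theorem setHeap_time : (s.setHeap a v).time = s.time := rfl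
@[simp] theorem setHeap_calls : (s.setHeap a v).calls = s.calls := rfl
@[simp] theorem tick_reg : (s.tick t).reg = s.reg := rfl
@[simp] theorem tick_heap : (s.tick t).heap = s.heap := rfl
@[simp] theorem tick_time : (s.tick t).time = s.time + t := rfl
@[simp] theorem tick_calls : (s.tick t).calls = s.calls := rfl

end State

namespace Exp

def eval (s : State) : Exp → ℕ
  | lit k => k
  | reg i => s.reg i
  | op o e f => o.eval (e.eval s) (f.eval s)
  | sq e => e.eval s * e.eval s
  | ld e => s.heap (e.eval s)

/-- All values that occur in the evaluation fit into a word, and only registers and the heap are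
read. -/
def Fits (W : ℕ) (s : State) : Exp → Prop
  | lit k => k ≤ W
  | reg i => i < 32 ∧ s.reg i ≤ W
  | op o e f => e.Fits W s ∧ f.Fits W s ∧ o.eval (e.eval s) (f.eval s) ≤ W
  | sq e => e.Fits W s ∧ e.eval s * e.eval s ≤ W
  | ld e => e.Fits W s ∧ 64 ≤ e.eval s

/-- The number of temporary cells that `code` occupies: the right operand is evaluated one cell
further, while the value of the left one is kept. -/
def depth : Exp → ℕ
  | lit _ => 1
  | reg _ => 1
  | op _ e f => max e.depth (f.depth + 1)
  | sq e => e.depth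
  | ld e => e.depth

def cost : Exp → ℕ
  | lit _ => 1
  | reg _ => 1
  | op _ e f => e.cost + (f.cost + 1)
  | sq e => e.cost + 1
  | ld e => e.cost + 1

/-- Code that evaluates an expression into the cell `d`, using cells from `d` on. -/
def code : Exp → ℕ → Com
  | lit k, d => .const d k
  | reg i, d => .bin .lor d i i
  | op o e f, d => .seq (e.code d) (.seq (f.code (d + 1)) (.bin o d d (d + 1)))
  | sq e, d => .seq (e.code d) (.bin .mul d d d)
  | ld e, d => .seq (e.code d) (.load d d)

theorem code_callFree (e : Exp) (d : ℕ) : (e.code d).CallFree := by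
  induction e generalizing d <;> simp_all [code, Com.CallFree]

theorem code_randFree (e : Exp) (d : ℕ) : (e.code d).RandFree := by
  induction e generalizing d <;> simp_all [code, Com.RandFree]

theorem one_le_depth (e : Exp) : 1 ≤ e.depth := by
  induction e <;> simp_all [depth]

end Exp

/-- The memory `m` realizes the abstract state `s`. -/
def Rel (m : Mem) (s : State) : Prop :=
  (∀ y < 32, m y = s.reg y) ∧ ∀ y, 64 ≤ y → m y = s.heap y

theorem Rel.tick {m : Mem} {s : State} (h : Rel m s) (t : ℕ) : Rel m (s.tick t) := h

section Logic

variable {n : ℕ} (W : ℕ) (g : Oracle n) (r : ℕ → Bool)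

/-- Started in a memory that realizes `s`, the program `c` halts in a memory that realizes a state
satisfying `Q`. -/
def WP (c : Com) (Q : State → Prop) (s : State) : Prop :=
  ∀ m, Rel m s → ∃ m' t l s', Exec W g r c m m' t l ∧ Rel m' s' ∧ s'.time = s.time + t ∧
    s'.calls = s.calls ++ l ∧ Q s'

variable {W g r}

/-- Only temporary cells from `d` on are written, so registers and heap still realize `s`; the same
frame clause keeps the left operand alive while the right one is evaluated. -/
theorem Exp.code_exec {s : State} {m : Mem} (e : Exp) (d : ℕ) (hf : e.Fits W s) (hm : Rel m s)
    (hd : 32 ≤ d) (hd' : d + e.depth ≤ 64) :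
    ∃ m', Exec W g r (e.code d) m m' e.cost [] ∧ Rel m' s ∧ m' d = e.eval s ∧
      ∀ y, y < d ∨ 64 ≤ y → m' y = m y := by
  have rel_of : ∀ (m₁ : Mem), (∀ y, y < d ∨ 64 ≤ y → m₁ y = m y) → Rel m₁ s := fun m₁ h =>
    ⟨fun y hy => by rw [h y (Or.inl (by omega)), hm.1 y hy],
      fun y hy => by rw [h y (Or.inr hy), hm.2 y hy]⟩
  suffices H : ∃ m', Exec W g r (e.code d) m m' e.cost [] ∧ m' d = e.eval s ∧
      ∀ y, y < d ∨ 64 ≤ y → m' y = m y by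
    obtain ⟨m', h₁, h₂, h₃⟩ := H
    exact ⟨m', h₁, rel_of m' h₃, h₂, h₃⟩
  clear rel_of
  have upd : ∀ (m₁ : Mem) (v : ℕ), d < 64 → (∀ y, y < d ∨ 64 ≤ y → m₁ y = m y) →
      ∀ y, y < d ∨ 64 ≤ y → Function.update m₁ d v y = m y := fun m₁ v hlt h y hy => by
    rw [Function.update_of_ne (by omega), h y hy]
  have hlt : d < 64 := by have := e.one_le_depth; omega
  induction e generalizing d m with
  | lit k => exact ⟨_, .const d k m hf, by simp [Exp.eval], upd m _ hlt fun _ _ => rfl⟩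
  | reg i =>
    have hi : m i = s.reg i := hm.1 i hf.1
    have he : BinOp.lor.eval (m i) (m i) = s.reg i := by simp [BinOp.eval, hi]
    exact ⟨_, .bin .lor d i i m (by rw [he]; exact hf.2), by simp [he, Exp.eval],
      upd m _ hlt fun _ _ => rfl⟩
  | op o e f ihe ihf =>
    simp only [Exp.depth] at hd'
    obtain ⟨m₁, x₁, v₁, u₁⟩ := ihe d hf.1 hm hd (by omega) upd hlt
    have hm₁ : Rel m₁ s := ⟨fun y hy => by rw [u₁ y (by omega), hm.1 y hy],
      fun y hy => by rw [u₁ y (by omega), hm.2 y hy]⟩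
    have := f.one_le_depth
    obtain ⟨m₂, x₂, v₂, u₂⟩ := ihf (m := m₁) (d + 1) hf.2.1 hm₁ (by omega) (by omega)
      (fun m₃ v hlt h y hy => by rw [Function.update_of_ne (by omega), h y hy]) (by omega)
    have hv : m₂ d = e.eval s := by rw [u₂ d (by omega), v₁]
    refine ⟨_, .seq x₁ (.seq x₂ (.bin o d d (d + 1) m₂ ?_)), ?_, upd m₂ _ hlt fun y hy => ?_⟩
    · rw [hv, v₂]; exact hf.2.2
    · simp [hv, v₂, Exp.eval]
    · rw [u₂ y (by omega), u₁ y hy]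
  | sq e ihe =>
    obtain ⟨m₁, x₁, v₁, u₁⟩ := ihe d hf.1 hm hd hd' upd hlt
    refine ⟨_, .seq x₁ (.bin .mul d d d m₁ ?_), ?_, upd m₁ _ hlt u₁⟩
    · rw [v₁]; exact hf.2
    · simp [v₁, Exp.eval, BinOp.eval]
  | ld e ihe =>
    obtain ⟨m₁, x₁, v₁, u₁⟩ := ihe d hf.1 hm hd hd' upd hlt
    refine ⟨_, .seq x₁ (.load d d m₁), ?_, upd m₁ _ hlt u₁⟩
    simp only [v₁, Exp.eval, Function.update_self]
    rw [u₁ _ (Or.inr hf.2), hm.2 _ hf.2]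

/-- `register i := e` -/
def asg (i : ℕ) (e : Exp) : Com := .seq (e.code 32) (.bin .lor i 32 32)

/-- `heap[e] := f` -/
def wr (e f : Exp) : Com := .seq (e.code 32) (.seq (f.code 33) (.store 32 33))

/-- `heap[e] :=` the random bit with index `f` -/
def wrRand (e f : Exp) : Com :=
  .seq (e.code 32) (.seq (f.code 33) (.seq (.rand 33 33) (.store 32 33)))

/-- if `e ≠ 0` then `c₁` else `c₂` -/
def cond (e : Exp) (c₁ c₂ : Com) : Com := .seq (e.code 32) (.ite 32 c₁ c₂)

/-- while `e ≠ 0` do `c` -/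
def whl (e : Exp) (c : Com) : Com := .seq (e.code 32) (.loop 32 (.seq c (e.code 32)))

/-- call the generator for the size `e`, output at `f` -/
def call (e f : Exp) : Com := .seq (e.code 32) (.seq (f.code 33) (.gen 32 33))

/-- Do nothing. -/
def skip : Com := .const 32 0

theorem WP.mono {c : Com} {Q Q' : State → Prop} {s : State} (h : WP W g r c Q s)
    (hQ : ∀ s', Q s' → Q' s') : WP W g r c Q' s := fun m hm => by
  obtain ⟨m', t, l, s', h₁, h₂, h₃, h₄, h₅⟩ := h m hm
  exact ⟨m', t, l, s', h₁, h₂, h₃, h₄, hQ _ h₅⟩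

theorem WP.seq {c₁ c₂ : Com} {Q : State → Prop} {s : State}
    (h : WP W g r c₁ (fun s' => WP W g r c₂ Q s') s) : WP W g r (.seq c₁ c₂) Q s := fun m hm => by
  obtain ⟨m₁, t₁, l₁, s₁, x₁, r₁, e₁, k₁, h₁⟩ := h m hm
  obtain ⟨m₂, t₂, l₂, s₂, x₂, r₂, e₂, k₂, h₂⟩ := h₁ m₁ r₁
  exact ⟨m₂, _, _, s₂, .seq x₁ x₂, r₂, by omega, by simp [k₁, k₂], h₂⟩

theorem WP.skip {Q : State → Prop} {s : State} (h : Q (s.tick 1)) : WP W g r skip Q s :=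
  fun m hm => ⟨_, _, _, s.tick 1, .const 32 0 m (Nat.zero_le _),
    ⟨fun y hy => by rw [Function.update_of_ne (by omega)]; exact hm.1 y hy,
      fun y hy => by rw [Function.update_of_ne (by omega)]; exact hm.2 y hy⟩, rfl, by simp, h⟩

/-- In all these rules, depth at most 30 leaves enough of the cells 32 to 63 even if the evaluation
starts in cell 33; for a concrete expression it is checked by computation. -/
theorem WP.asg {i : ℕ} {e : Exp} {Q : State → Prop} {s : State} (v : ℕ) (hv : e.eval s = v)
    (hW : v ≤ W) (hf : e.Fits W s) (h : Q ((s.setReg i v).tick (e.cost + 1)))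
    (hi : i < 32 := by omega)
    (hd : e.depth ≤ 30 := by exact Nat.le_of_ble_eq_true rfl) : WP W g r (asg i e) Q s :=
  fun m hm => by
    subst hv
    obtain ⟨m₁, x₁, r₁, v₁, u₁⟩ := e.code_exec (g := g) (r := r) 32 hf hm le_rfl (by omega)
    have he : BinOp.lor.eval (m₁ 32) (m₁ 32) = e.eval s := by simp [BinOp.eval, v₁]
    refine ⟨_, _, _, _, .seq x₁ (.bin .lor i 32 32 m₁ (by rwa [he])), ?_, ?_, ?_, h⟩
    · constructor
      · intro y hy
        simp only [he, Function.update_apply, State.tick_reg, State.setReg_reg]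
        split
        · rfl
        · exact r₁.1 y hy
      · intro y hy
        rw [Function.update_of_ne (by omega)]
        exact r₁.2 y hy
    · simp
    · simp

theorem WP.wr {e f : Exp} {Q : State → Prop} {s : State} (a v : ℕ) (ha : e.eval s = a)
    (hv : f.eval s = v) (ha' : 64 ≤ a) (he : e.Fits W s) (hf : f.Fits W s)
    (h : Q ((s.setHeap a v).tick (e.cost + f.cost + 1)))
    (hd : e.depth ≤ 30 := by exact Nat.le_of_ble_eq_true rfl)
    (hd' : f.depth ≤ 30 := by exact Nat.le_of_ble_eq_true rfl) : WP W g r (wr e f) Q s :=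
  fun m hm => by
    subst ha hv
    obtain ⟨m₁, x₁, r₁, v₁, u₁⟩ := e.code_exec (g := g) (r := r) 32 he hm le_rfl (by omega)
    obtain ⟨m₂, x₂, r₂, v₂, u₂⟩ := f.code_exec (g := g) (r := r) 33 hf r₁ (by omega) (by omega)
    have hv : m₂ 32 = e.eval s := by rw [u₂ 32 (by omega), v₁]
    refine ⟨_, _, _, _, .seq x₁ (.seq x₂ (.store 32 33 m₂)), ?_, ?_, ?_, h⟩
    · rw [hv, v₂]
      constructor
      · intro y hy
        rw [Function.update_of_ne (by omega)]
        exact r₂.1 y hy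
      · intro y hy
        simp only [Function.update_apply, State.tick_heap, State.setHeap_heap]
        split
        · rfl
        · exact r₂.2 y hy
    · simp; omega
    · simp

theorem WP.wrRand {e f : Exp} {Q : State → Prop} {s : State} (a v : ℕ) (ha : e.eval s = a)
    (hv : f.eval s = v) (ha' : 64 ≤ a) (he : e.Fits W s) (hf : f.Fits W s)
    (h : Q ((s.setHeap a (r v).toNat).tick (e.cost + f.cost + 2)))
    (hd : e.depth ≤ 30 := by exact Nat.le_of_ble_eq_true rfl)
    (hd' : f.depth ≤ 30 := by exact Nat.le_of_ble_eq_true rfl) : WP W g r (wrRand e f) Q s :=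
  fun m hm => by
    subst ha hv
    obtain ⟨m₁, x₁, r₁, v₁, u₁⟩ := e.code_exec (g := g) (r := r) 32 he hm le_rfl (by omega)
    obtain ⟨m₂, x₂, r₂, v₂, u₂⟩ := f.code_exec (g := g) (r := r) 33 hf r₁ (by omega) (by omega)
    have hv : m₂ 32 = e.eval s := by rw [u₂ 32 (by omega), v₁]
    refine ⟨_, _, _, _, .seq x₁ (.seq x₂ (.seq (.rand 33 33 m₂) (.store 32 33 _))), ?_, ?_, ?_, h⟩
    · rw [Function.update_self, Function.update_of_ne (by omega), hv, v₂]
      constructor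
      · intro y hy
        rw [Function.update_of_ne (by omega), Function.update_of_ne (by omega)]
        exact r₂.1 y hy
      · intro y hy
        simp only [Function.update_apply, State.tick_heap, State.setHeap_heap]
        split
        · rfl
        · rw [if_neg (by omega)]
          exact r₂.2 y hy
    · simp; omega
    · simp

theorem WP.cond {e : Exp} {c₁ c₂ : Com} {Q : State → Prop} {s : State} (hf : e.Fits W s)
    (h₁ : e.eval s ≠ 0 → WP W g r c₁ Q (s.tick (e.cost + 1)))
    (h₂ : e.eval s = 0 → WP W g r c₂ Q (s.tick (e.cost + 1)))
    (hd : e.depth ≤ 30 := by exact Nat.le_of_ble_eq_true rfl) :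
    WP W g r (cond e c₁ c₂) Q s := fun m hm => by
  obtain ⟨m₁, x₁, r₁, v₁, u₁⟩ := e.code_exec (g := g) (r := r) 32 hf hm le_rfl (by omega)
  by_cases hz : e.eval s = 0
  · obtain ⟨m₂, t₂, l₂, s₂, x₂, r₂, e₂, k₂, hQ⟩ := h₂ hz m₁ (r₁.tick _)
    exact ⟨m₂, _, _, s₂, .seq x₁ (.iteFalse (v₁.trans hz) x₂), r₂,
      by simp only [State.tick_time] at e₂; omega, by simpa using k₂, hQ⟩
  · obtain ⟨m₂, t₂, l₂, s₂, x₂, r₂, e₂, k₂, hQ⟩ := h₁ hz m₁ (r₁.tick _)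
    exact ⟨m₂, _, _, s₂, .seq x₁ (.iteTrue (by rwa [v₁]) x₂), r₂,
      by simp only [State.tick_time] at e₂; omega, by simpa using k₂, hQ⟩

theorem Exp.eval_tick (e : Exp) (s : State) (t : ℕ) : e.eval (s.tick t) = e.eval s := by
  induction e <;> simp_all [Exp.eval]

theorem Exp.fits_tick (e : Exp) (s : State) (t : ℕ) : e.Fits W (s.tick t) ↔ e.Fits W s := by
  induction e <;> simp_all [Exp.Fits, Exp.eval_tick]

/-- The rule for a loop that runs through its body `N` times; `I j` describes the state when
the condition has been evaluated for the `j`-th time. -/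
theorem WP.whl {e : Exp} {c : Com} {Q : State → Prop} {s : State} (N : ℕ) (I : ℕ → State → Prop)
    (hI : ∀ j ≤ N, ∀ s, I j s → e.Fits W s ∧ (e.eval s ≠ 0 ↔ j < N))
    (h0 : I 0 (s.tick e.cost))
    (hs : ∀ j < N, ∀ s, I j s → WP W g r c (fun s' => I (j + 1) (s'.tick (e.cost + 1))) s)
    (hQ : ∀ s, I N s → Q (s.tick 1))
    (hd : e.depth ≤ 30 := by exact Nat.le_of_ble_eq_true rfl) :
    WP W g r (whl e c) Q s := by
  -- Induction on the number `k` of remaining rounds. The machine loop tests cell 32, which the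
  -- abstract state does not see, so its content is carried along.
  have key : ∀ k j, j + k = N → ∀ s m, I j s → Rel m s → m 32 = e.eval s →
      ∃ m' t l s', Exec W g r (.loop 32 (.seq c (e.code 32))) m m' t l ∧ Rel m' s' ∧
        s'.time = s.time + t ∧ s'.calls = s.calls ++ l ∧ Q s' := by
    intro k
    induction k with
    | zero =>
      intro j hj s m hIj hm hv
      obtain rfl : j = N := by omega
      have hz : m 32 = 0 := by
        rw [hv]
        by_contra hne
        exact lt_irrefl _ ((hI j le_rfl s hIj).2.1 hne)
      exact ⟨m, _, _, s.tick 1, .loopFalse hz, hm.tick 1, rfl, by simp, hQ s hIj⟩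
    | succ k ih =>
      intro j hj s m hIj hm hv
      have hz : m 32 ≠ 0 := by rw [hv]; exact (hI j (by omega) s hIj).2.2 (by omega)
      obtain ⟨m₁, t₁, l₁, s₁, x₁, r₁, e₁, k₁, h₁⟩ := hs j (by omega) s hIj m hm
      have hf : e.Fits W s₁ := (e.fits_tick s₁ _).1 (hI (j + 1) (by omega) _ h₁).1
      obtain ⟨m₂, x₂, r₂, v₂, -⟩ := e.code_exec (g := g) (r := r) 32 hf r₁ le_rfl (by omega)
      obtain ⟨m₃, t₃, l₃, s₃, x₃, r₃, e₃, k₃, h₃⟩ := ih (j + 1) (by omega) _ m₂ h₁ (r₂.tick _)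
        (by rw [v₂, e.eval_tick])
      refine ⟨m₃, _, _, s₃, .loopTrue hz (.seq x₁ x₂) x₃, r₃, ?_, ?_, h₃⟩
      · simp only [State.tick_time] at e₃; omega
      · simp [k₃, k₁]
  intro m hm
  have hf : e.Fits W s := (e.fits_tick s _).1 (hI 0 (Nat.zero_le _) _ h0).1
  obtain ⟨m₂, x₂, r₂, v₂, -⟩ := e.code_exec (g := g) (r := r) 32 hf hm le_rfl (by omega)
  obtain ⟨m₃, t₃, l₃, s₃, x₃, r₃, e₃, k₃, h₃⟩ := key N 0 (by omega) _ m₂ h0 (r₂.tick _)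
    (by rw [v₂, e.eval_tick])
  exact ⟨m₃, _, _, s₃, .seq x₂ x₃, r₃, by simp only [State.tick_time] at e₃; omega,
    by simp [k₃], h₃⟩

/-- The state after a family has been written from address `b` on. -/
def State.setFamily (s : State) (k : ℕ) (F : Family n) (b : ℕ) : State :=
  { s with heap := F.write b s.heap, calls := s.calls ++ [k] }

theorem WP.call {e f : Exp} {Q : State → Prop} {s : State} (k b : ℕ) (hk : e.eval s = k)
    (hb : f.eval s = b) (hb' : 64 ≤ b) (he : e.Fits W s) (hf : f.Fits W s)
    (hn : (g k).num ≤ W) (hp : (g k).parts ≤ W) (hW : b + 2 + (g k).num * n ≤ W)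
    (h : Q ((s.setFamily k (g k) b).tick (e.cost + f.cost + 1)))
    (hd : e.depth ≤ 30 := by exact Nat.le_of_ble_eq_true rfl)
    (hd' : f.depth ≤ 30 := by exact Nat.le_of_ble_eq_true rfl) : WP W g r (call e f) Q s :=
  fun m hm => by
    subst hk hb
    obtain ⟨m₁, x₁, r₁, v₁, u₁⟩ := e.code_exec (g := g) (r := r) 32 he hm le_rfl (by omega)
    obtain ⟨m₂, x₂, r₂, v₂, u₂⟩ := f.code_exec (g := g) (r := r) 33 hf r₁ (by omega) (by omega)
    have hv : m₂ 32 = e.eval s := by rw [u₂ 32 (by omega), v₁]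
    refine ⟨_, _, _, _, .seq x₁ (.seq x₂ (.gen 32 33 m₂ (by rwa [hv]) (by rwa [hv])
      (by rwa [hv, v₂]))), ?_, ?_, ?_, h⟩
    · rw [hv, v₂]
      constructor
      · intro y hy
        simp only [Family.write, State.setFamily, State.tick_reg]
        rw [if_neg (by omega), if_neg (by omega), dif_neg (by omega)]
        exact r₂.1 y hy
      · intro y hy
        simp only [Family.write, State.setFamily, State.tick_heap]
        rw [r₂.2 y hy]
    · simp [State.setFamily]; omega
    · simp [State.setFamily, hv]

end Logic

/-! ### Compiled code without coin tosses and generator calls -/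

section Purity

variable (e f : Exp) (i : ℕ) (c c₁ c₂ : Com)

@[simp] theorem asg_callFree : (asg i e).CallFree := by
  simp [asg, Com.CallFree, Exp.code_callFree]
@[simp] theorem wr_callFree : (wr e f).CallFree := by
  simp [wr, Com.CallFree, Exp.code_callFree]
@[simp] theorem wrRand_callFree : (wrRand e f).CallFree := by
  simp [wrRand, Com.CallFree, Exp.code_callFree]
@[simp] theorem skip_callFree : skip.CallFree := trivial
@[simp] theorem cond_callFree : (cond e c₁ c₂).CallFree ↔ c₁.CallFree ∧ c₂.CallFree := by
  simp [cond, Com.CallFree, Exp.code_callFree]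
@[simp] theorem whl_callFree : (whl e c).CallFree ↔ c.CallFree := by
  simp [whl, Com.CallFree, Exp.code_callFree]
@[simp] theorem asg_randFree : (asg i e).RandFree := by
  simp [asg, Com.RandFree, Exp.code_randFree]
@[simp] theorem wr_randFree : (wr e f).RandFree := by
  simp [wr, Com.RandFree, Exp.code_randFree]
@[simp] theorem skip_randFree : skip.RandFree := trivial
@[simp] theorem call_randFree : (call e f).RandFree := by
  simp [call, Com.RandFree, Exp.code_randFree]
@[simp] theorem cond_randFree : (cond e c₁ c₂).RandFree ↔ c₁.RandFree ∧ c₂.RandFree := by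
  simp [cond, Com.RandFree, Exp.code_randFree]
@[simp] theorem whl_randFree : (whl e c).RandFree ↔ c.RandFree := by
  simp [whl, Com.RandFree, Exp.code_randFree]

end Purity

/-! ### Uniqueness of executions and word bounds -/

section Executions

variable {n W W' : ℕ} {g : Oracle n} {r : ℕ → Bool} {c : Com} {m m₁ m₂ : Mem} {t₁ t₂ : ℕ}
  {l₁ l₂ : List ℕ}

/-- Executions are unique, whatever the word sizes. -/
theorem Exec.unique (h₁ : Exec W g r c m m₁ t₁ l₁) (h₂ : Exec W' g r c m m₂ t₂ l₂) :
    m₁ = m₂ ∧ t₁ = t₂ ∧ l₁ = l₂ := by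
  induction h₁ generalizing m₂ t₂ l₂ with
  | const | bin | load | store | rand | gen => cases h₂; exact ⟨rfl, rfl, rfl⟩
  | seq _ _ ih₁ ih₂ =>
    cases h₂ with
    | seq a b =>
      obtain ⟨rfl, rfl, rfl⟩ := ih₁ a
      obtain ⟨rfl, rfl, rfl⟩ := ih₂ b
      exact ⟨rfl, rfl, rfl⟩
  | iteTrue ha _ ih =>
    cases h₂ with
    | iteTrue _ b => obtain ⟨rfl, rfl, rfl⟩ := ih b; exact ⟨rfl, rfl, rfl⟩
    | iteFalse hb => exact absurd hb ha
  | iteFalse ha _ ih =>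
    cases h₂ with
    | iteFalse _ b => obtain ⟨rfl, rfl, rfl⟩ := ih b; exact ⟨rfl, rfl, rfl⟩
    | iteTrue hb => exact absurd ha hb
  | loopTrue ha _ _ ih₁ ih₂ =>
    cases h₂ with
    | loopTrue _ a b =>
      obtain ⟨rfl, rfl, rfl⟩ := ih₁ a
      obtain ⟨rfl, rfl, rfl⟩ := ih₂ b
      exact ⟨rfl, rfl, rfl⟩
    | loopFalse hb => exact absurd hb ha
  | loopFalse ha =>
    cases h₂ with
    | loopTrue hb => exact absurd ha hb
    | loopFalse => exact ⟨rfl, rfl, rfl⟩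

theorem Exec.calls_eq_nil (h : Exec W g r c m m₁ t₁ l₁) (hc : c.CallFree) : l₁ = [] := by
  induction h with
  | gen => exact hc.elim
  | seq _ _ ih₁ ih₂ => simp [ih₁ hc.1, ih₂ hc.2]
  | iteTrue _ _ ih => exact ih hc.1
  | iteFalse _ _ ih => exact ih hc.2
  | loopTrue _ _ _ ih₁ ih₂ => simp [ih₁ hc, ih₂ hc]
  | _ => rfl

/-- A call-free program keeps all cells within the word size. -/
theorem Exec.le_word (h : Exec W g r c m m₁ t₁ l₁) (hc : c.CallFree) (hW : 1 ≤ W)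
    (hm : ∀ y, m y ≤ W) : ∀ y, m₁ y ≤ W := by
  have upd : ∀ (m : Mem) (d v : ℕ), (∀ y, m y ≤ W) → v ≤ W → ∀ y, Function.update m d v y ≤ W :=
    fun m d v hm hv y => by
      rw [Function.update_apply]
      split
      · exact hv
      · exact hm y
  induction h with
  | const d c m h => exact upd _ _ _ hm h
  | bin o d a b m h => exact upd _ _ _ hm h
  | load d a m => exact upd _ _ _ hm (hm _)
  | store a b m => exact upd _ _ _ hm (hm _)
  | rand d a m => exact upd _ _ _ hm ((Bool.toNat_le _).trans hW)
  | gen => exact hc.elim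
  | seq _ _ ih₁ ih₂ => exact ih₂ hc.2 (ih₁ hc.1 hm)
  | iteTrue _ _ ih => exact ih hc.1 hm
  | iteFalse _ _ ih => exact ih hc.2 hm
  | loopTrue _ _ _ ih₁ ih₂ => exact ih₂ hc (ih₁ hc hm)
  | loopFalse => exact hm

end Executions

/-! ### Arrays in the heap -/

/-- A pairing function. -/
def pr (a b : ℕ) : ℕ := (a + b) * (a + b) + a

/-- For s = a + b the value s² + a lies in [s², (s + 1)²), so it determines s, and then a. -/
theorem pr_inj {a b a' b' : ℕ} : pr a b = pr a' b' ↔ a = a' ∧ b = b' := by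
  refine ⟨fun h => ?_, fun h => by rw [h.1, h.2]⟩
  unfold pr at h
  have hs : a + b = a' + b' := by
    rcases lt_trichotomy (a + b) (a' + b') with hlt | heq | hgt
    · nlinarith
    · exact heq
    · nlinarith
  rw [hs] at h
  omega

theorem pr_mono {a b a' b' : ℕ} (ha : a ≤ a') (hb : b ≤ b') : pr a b ≤ pr a' b' := by
  unfold pr
  gcongr

/-- Makes the random bits read by one copy an increasing subsequence of those of the machine. -/
theorem pr_strictMono_right (a : ℕ) : StrictMono (pr a) := fun b b' h => by
  unfold pr
  have : (a + b) * (a + b) < (a + b') * (a + b') := by nlinarith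
  omega

theorem add_le_pr (a b : ℕ) : a + b ≤ pr a b := by
  unfold pr
  rcases Nat.eq_zero_or_pos (a + b) with h | h
  · omega
  · nlinarith

/-- The cell `x` of the array with number `i`, when the arrays start at address `E`. -/
def phys (E i x : ℕ) : ℕ := E + pr i x

theorem phys_inj {E i x i' x' : ℕ} : phys E i x = phys E i' x' ↔ i = i' ∧ x = x' := by
  rw [phys, phys, Nat.add_left_cancel_iff, pr_inj]

theorem le_phys (E i x : ℕ) : E ≤ phys E i x := Nat.le_add_right _ _

theorem phys_mono {E E' i i' x x' : ℕ} (hE : E ≤ E') (hi : i ≤ i') (hx : x ≤ x') :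
    phys E i x ≤ phys E' i' x' := Nat.add_le_add hE (pr_mono hi hx)

/-- The content of the array cell. -/
def State.arr (s : State) (E i x : ℕ) : ℕ := s.heap (phys E i x)

namespace State

variable (s : State) (E i x i' x' v j t : ℕ)

@[simp] theorem arr_setReg : (s.setReg j v).arr E i x = s.arr E i x := rfl
@[simp] theorem arr_tick : (s.tick t).arr E i x = s.arr E i x := rfl
@[simp] theorem arr_setHeap : (s.setHeap (phys E i x) v).arr E i' x' =
    if i' = i ∧ x' = x then v else s.arr E i' x' := by
  simp only [arr, setHeap_heap, phys_inj]

theorem heap_setHeap_phys {y : ℕ} (h : y < E) : (s.setHeap (phys E i x) v).heap y = s.heap y := by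
  rw [setHeap_heap, if_neg (by have := le_phys E i x; omega)]

end State

namespace BinOp

variable (x y : ℕ)

@[simp] theorem eval_add : add.eval x y = x + y := rfl
@[simp] theorem eval_sub : sub.eval x y = x - y := rfl
@[simp] theorem eval_mul : mul.eval x y = x * y := rfl
@[simp] theorem eval_div : div.eval x y = x / y := rfl
@[simp] theorem eval_mod : mod.eval x y = x % y := rfl
@[simp] theorem eval_lt : lt.eval x y = if x < y then 1 else 0 := rfl
@[simp] theorem eval_eq : eq.eval x y = if x = y then 1 else 0 := rfl

end BinOp

namespace Exp

/-- The expression computing `pr`. -/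
def pair (e f : Exp) : Exp := op .add (sq (op .add e f)) e

/-- The address of an array cell; register `5` holds the start address of the arrays. -/
def addr (e f : Exp) : Exp := op .add (reg 5) (pair e f)

/-- The content of an array cell. -/
def ar (e f : Exp) : Exp := ld (addr e f)

variable {W : ℕ} {s : State} {e f : Exp}

@[simp] theorem eval_lit (k : ℕ) : (lit k).eval s = k := rfl
@[simp] theorem eval_reg (i : ℕ) : (reg i).eval s = s.reg i := rfl
@[simp] theorem eval_op (o : BinOp) : (op o e f).eval s = o.eval (e.eval s) (f.eval s) := rfl
@[simp] theorem eval_ld : (ld e).eval s = s.heap (e.eval s) := rfl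
@[simp] theorem eval_pair : (pair e f).eval s = pr (e.eval s) (f.eval s) := rfl
@[simp] theorem eval_addr : (addr e f).eval s = phys (s.reg 5) (e.eval s) (f.eval s) := rfl
@[simp] theorem eval_ar : (ar e f).eval s = s.arr (s.reg 5) (e.eval s) (f.eval s) := rfl

theorem fits_pair (he : e.Fits W s) (hf : f.Fits W s) (h : pr (e.eval s) (f.eval s) ≤ W) :
    (pair e f).Fits W s :=
  ⟨⟨⟨he, hf, (add_le_pr _ _).trans h⟩, (Nat.le_add_right _ _).trans h⟩, he, h⟩

theorem fits_addr (he : e.Fits W s) (hf : f.Fits W s)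
    (h : phys (s.reg 5) (e.eval s) (f.eval s) ≤ W) : (addr e f).Fits W s :=
  ⟨⟨by omega, (Nat.le_add_right _ _).trans h⟩,
    fits_pair he hf ((Nat.le_add_left _ _).trans h), h⟩

theorem fits_ar (he : e.Fits W s) (hf : f.Fits W s)
    (h : phys (s.reg 5) (e.eval s) (f.eval s) ≤ W) (hE : 64 ≤ s.reg 5) : (ar e f).Fits W s :=
  ⟨fits_addr he hf h, hE.trans (le_phys _ _ _)⟩

end Exp

section Loop

variable {n W : ℕ} {g : Oracle n} {r : ℕ → Bool} {e : Exp} {c : Com} {Q : State → Prop} {s : State}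

/-- This and the next rule unfold a loop once. They serve the simulation, where the rounds follow a
given execution instead of a count known in advance. -/
theorem WP.whl_false (hf : e.Fits W s) (hz : e.eval s = 0) (h : Q (s.tick (e.cost + 1)))
    (hd : e.depth ≤ 30 := by exact Nat.le_of_ble_eq_true rfl) : WP W g r
      (DynMatching.whl e c) Q s :=
  fun m hm => by
    obtain ⟨m₂, x₂, r₂, v₂, -⟩ := e.code_exec (g := g) (r := r) 32 hf hm le_rfl (by omega)
    exact ⟨m₂, _, _, _, .seq x₂ (.loopFalse (v₂.trans hz)), r₂.tick _, rfl, by simp, h⟩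

theorem WP.whl_true (hf : e.Fits W s) (hz : e.eval s ≠ 0)
    (h : WP W g r c (fun s' => WP W g r (DynMatching.whl e c) Q s') (s.tick (e.cost + 1)))
    (hd : e.depth ≤ 30 := by exact Nat.le_of_ble_eq_true rfl) : WP W g r
      (DynMatching.whl e c) Q s :=
  fun m hm => by
    obtain ⟨m₂, x₂, r₂, v₂, -⟩ := e.code_exec (g := g) (r := r) 32 hf hm le_rfl (by omega)
    obtain ⟨m₃, t₃, l₃, s₃, x₃, r₃, e₃, k₃, h₃⟩ := h m₂ (r₂.tick _)
    obtain ⟨m₄, t₄, l₄, s₄, x₄, r₄, e₄, k₄, h₄⟩ := h₃ m₃ r₃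
    -- The rest was run as a fresh loop; its first evaluation of the condition is regrouped as the
    -- end of the current round.
    cases x₄ with
    | seq y₁ y₂ =>
      refine ⟨m₄, _, _, s₄, .seq x₂ (.loopTrue (by rwa [v₂]) (.seq x₃ y₁) y₂), r₄, ?_, ?_, h₄⟩
      · simp only [State.tick_time] at e₃; omega
      · simp [k₄, k₃]

end Loop

/-! ### Simulation of a program on an array -/

/-- The program `c`, working on the array whose number is in register `8`. -/
def sim : Com → Com
  | .const d c => wr (.addr (.reg 8) (.lit d)) (.lit c)
  | .bin o d a b => wr (.addr (.reg 8) (.lit d))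
      (.op o (.ar (.reg 8) (.lit a)) (.ar (.reg 8) (.lit b)))
  | .load d a => wr (.addr (.reg 8) (.lit d)) (.ar (.reg 8) (.ar (.reg 8) (.lit a)))
  | .store a b => wr (.addr (.reg 8) (.ar (.reg 8) (.lit a))) (.ar (.reg 8) (.lit b))
  -- Bit number x of the simulated program is the bit of the machine whose index is the address of
  -- cell x, so different copies read disjoint sets of bits.
  | .rand d a => wrRand (.addr (.reg 8) (.lit d)) (.addr (.reg 8) (.ar (.reg 8) (.lit a)))
  -- A dummy: only call-free programs are simulated.
  | .gen _ _ => skip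
  | .seq c₁ c₂ => .seq (sim c₁) (sim c₂)
  | .ite a c₁ c₂ => cond (.ar (.reg 8) (.lit a)) (sim c₁) (sim c₂)
  | .loop a c => whl (.ar (.reg 8) (.lit a)) (sim c)

theorem sim_callFree (c : Com) : (sim c).CallFree := by
  induction c <;> simp_all [sim, Com.CallFree]

theorem sim_randFree {c : Com} (h : c.RandFree) : (sim c).RandFree := by
  induction c <;> simp_all [sim, Com.RandFree]

/-- A bound for the cells that are addressed directly. -/
def Com.cellBound : Com → ℕ
  | .const d _ => d
  | .bin _ d a b => d + a + b
  | .load d a => d + a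
  | .store a b => a + b
  | .rand d a => d + a
  | .gen a b => a + b
  | .seq c₁ c₂ => c₁.cellBound + c₂.cellBound
  | .ite a c₁ c₂ => a + c₁.cellBound + c₂.cellBound
  | .loop a c => a + c.cellBound

/-- The array `i` of the state `s'` holds `m`, and `s'` differs from `s` in this array only. -/
def Simulated (E i : ℕ) (m : Mem) (τ : ℕ) (s s' : State) : Prop :=
  s'.reg = s.reg ∧ (∀ x, s'.arr E i x = m x) ∧
    (∀ y, (∀ x, y ≠ phys E i x) → s'.heap y = s.heap y) ∧ s'.time ≤ s.time + τ ∧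
    s'.calls = s.calls

theorem Simulated.trans {E i : ℕ} {m m' : Mem} {τ τ' : ℕ} {s s' s'' : State}
    (h : Simulated E i m τ s s') (h' : Simulated E i m' τ' s' s'') :
    Simulated E i m' (τ + τ') s s'' := by
  obtain ⟨a, b, c, d, e⟩ := h
  obtain ⟨a', b', c', d', e'⟩ := h'
  exact ⟨a'.trans a, b', fun y hy => (c' y hy).trans (c y hy), by omega, e'.trans e⟩

theorem Simulated.write {E i : ℕ} {m : Mem} {s : State} (d v t : ℕ)
    (hm : ∀ x, s.arr E i x = m x) :
    Simulated E i (Function.update m d v) t s ((s.setHeap (phys E i d) v).tick t) := by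
  refine ⟨rfl, fun x => ?_, fun y hy => ?_, le_rfl, rfl⟩
  · simp [Function.update_apply, hm]
  · simp [State.setHeap_heap, hy d]

theorem Simulated.mono {E i : ℕ} {m : Mem} {s s' : State} {t t' : ℕ}
    (h : Simulated E i m t s s') (ht : t ≤ t') : Simulated E i m t' s s' :=
  ⟨h.1, h.2.1, h.2.2.1, h.2.2.2.1.trans (by omega), h.2.2.2.2⟩

theorem Simulated.of_tick {E i : ℕ} {m : Mem} {s s' : State} {t k : ℕ}
    (h : Simulated E i m t (s.tick k) s') : Simulated E i m (k + t) s s' :=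
  ⟨h.1, h.2.1, h.2.2.1, h.2.2.2.1.trans (by simp; omega), h.2.2.2.2⟩

/-- Induction on the given execution. Each simulated step is a bounded number of address
computations, which gives the factor 40. Indirect addresses are cell contents, hence at most `W₀`,
and `Exec.le_word` hands this bound on from one part of the program to the next. -/
theorem sim_wp {n n₀ W W₀ V E i : ℕ} {g : Oracle n} {g₀ : Oracle n₀} {r r₀ : ℕ → Bool} {c : Com}
    {m₀ m₁ : Mem} {t : ℕ} {l : List ℕ} (h : Exec W₀ g₀ r₀ c m₀ m₁ t l) (hc : c.CallFree)
    (hb : c.cellBound ≤ V) (hW₀ : 1 ≤ W₀) (hm₀ : ∀ y, m₀ y ≤ W₀) (hWV : W₀ ≤ V)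
    (hV : phys V V V ≤ W) (hE : 64 ≤ E) (hEV : E ≤ V) (hiV : i ≤ V)
    (hr : ∀ y, r (phys E i y) = r₀ y) (s : State) (h5 : s.reg 5 = E) (h8 : s.reg 8 = i)
    (hs : ∀ x, s.arr E i x = m₀ x) :
    WP W g r (sim c) (Simulated E i m₁ (40 * t) s) s := by
  have hVW : V ≤ W := (le_phys _ _ _).trans hV
  have hle : ∀ x ≤ V, phys E i x ≤ W := fun x hx => (phys_mono hEV hiV hx).trans hV
  have f8 : ∀ s : State, s.reg 8 = i → (Exp.reg 8).Fits W s := fun s h8 =>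
    ⟨by omega, by rw [h8]; omega⟩
  have fa : ∀ (s : State) (d : ℕ), s.reg 5 = E → s.reg 8 = i → d ≤ V →
      (Exp.addr (.reg 8) (.lit d)).Fits W s := fun s d h5 h8 hd =>
    Exp.fits_addr (f8 s h8) (hd.trans hVW) (by simpa [h5, h8] using hle d hd)
  have fr : ∀ (s : State) (d : ℕ), s.reg 5 = E → s.reg 8 = i → d ≤ V →
      (Exp.ar (.reg 8) (.lit d)).Fits W s := fun s d h5 h8 hd =>
    Exp.fits_ar (f8 s h8) (hd.trans hVW) (by simpa [h5, h8] using hle d hd) (by omega)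
  induction h generalizing s with
  | const d c m h =>
    refine WP.wr (phys E i d) c (by simp [h5, h8]) rfl (hE.trans (le_phys _ _ _))
      (fa s d h5 h8 hb) (h.trans (hWV.trans hVW)) ?_
    exact Simulated.mono (Simulated.write d c _ hs) (by simp [Exp.cost, Exp.addr, Exp.pair])
  | bin o d a b m h =>
    simp only [Com.cellBound] at hb
    have ha := fr s a h5 h8 (by omega)
    have hb' := fr s b h5 h8 (by omega)
    refine WP.wr (phys E i d) (o.eval (m a) (m b)) (by simp [h5, h8]) ?_ (hE.trans (le_phys _ _ _))
      (fa s d h5 h8 (by omega)) ⟨ha, hb', ?_⟩ ?_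
    · simp [h5, h8, hs]
    · simpa [h5, h8, hs] using h.trans (hWV.trans hVW)
    · exact Simulated.mono (Simulated.write d _ _ hs)
        (by simp [Exp.cost, Exp.ar, Exp.addr, Exp.pair])
  | load d a m =>
    simp only [Com.cellBound] at hb
    refine WP.wr (phys E i d) (m (m a)) (by simp [h5, h8]) ?_ (hE.trans (le_phys _ _ _))
      (fa s d h5 h8 (by omega)) ?_ ?_
    · simp [h5, h8, hs]
    · exact Exp.fits_ar (f8 s h8) (fr s a h5 h8 (by omega))
        (by simpa [h5, h8, hs] using hle _ ((hm₀ _).trans hWV)) (by omega)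
    · exact Simulated.mono (Simulated.write d _ _ hs)
        (by simp [Exp.cost, Exp.ar, Exp.addr, Exp.pair])
  | store a b m =>
    simp only [Com.cellBound] at hb
    refine WP.wr (phys E i (m a)) (m b) (by simp [h5, h8, hs]) (by simp [h5, h8, hs])
      (hE.trans (le_phys _ _ _)) ?_ (fr s b h5 h8 (by omega)) ?_
    · exact Exp.fits_addr (f8 s h8) (fr s a h5 h8 (by omega))
        (by simpa [h5, h8, hs] using hle _ ((hm₀ _).trans hWV))
    · exact Simulated.mono (Simulated.write _ _ _ hs)
        (by simp [Exp.cost, Exp.ar, Exp.addr, Exp.pair])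
  | rand d a m =>
    simp only [Com.cellBound] at hb
    refine WP.wrRand (phys E i d) (phys E i (m a)) (by simp [h5, h8]) (by simp [h5, h8, hs])
      (hE.trans (le_phys _ _ _)) (fa s d h5 h8 (by omega)) ?_ ?_
    · exact Exp.fits_addr (f8 s h8) (fr s a h5 h8 (by omega))
        (by simpa [h5, h8, hs] using hle _ ((hm₀ _).trans hWV))
    · rw [hr]
      exact Simulated.mono (Simulated.write _ _ _ hs)
        (by simp [Exp.cost, Exp.ar, Exp.addr, Exp.pair])
  | gen => exact hc.elim
  | seq x₁ x₂ ih₁ ih₂ =>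
    simp only [Com.cellBound] at hb
    refine WP.seq ((ih₁ hc.1 (by omega) hm₀ s h5 h8 hs).mono fun s₁ h₁ => ?_)
    refine (ih₂ hc.2 (by omega) (x₁.le_word hc.1 hW₀ hm₀) s₁ (by rw [h₁.1, h5]) (by rw [h₁.1, h8])
      h₁.2.1).mono fun s₂ h₂ => (h₁.trans h₂).mono (by omega)
  | @iteTrue a c₁ c₂ m m' t l ha x ih =>
    simp only [Com.cellBound] at hb
    refine WP.cond (fr s a h5 h8 (by omega)) (fun _ => ?_) fun h0 => ?_
    · exact (ih hc.1 (by omega) hm₀ (s.tick _) h5 h8 hs).mono fun s' h' =>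
        h'.of_tick.mono (by simp [Exp.cost, Exp.ar, Exp.addr, Exp.pair]; omega)
    · exact absurd (by simpa [h5, h8, hs] using h0) ha
  | @iteFalse a c₁ c₂ m m' t l ha x ih =>
    simp only [Com.cellBound] at hb
    refine WP.cond (fr s a h5 h8 (by omega)) (fun h0 => ?_) fun _ => ?_
    · exact absurd ha (by simpa [h5, h8, hs] using h0)
    · exact (ih hc.2 (by omega) hm₀ (s.tick _) h5 h8 hs).mono fun s' h' =>
        h'.of_tick.mono (by simp [Exp.cost, Exp.ar, Exp.addr, Exp.pair]; omega)
  | @loopTrue a c m m₁ m₂ t₁ t₂ l₁ l₂ ha x₁ x₂ ih₁ ih₂ =>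
    simp only [Com.cellBound] at hb
    refine WP.whl_true (fr s a h5 h8 (by omega)) (by simpa [h5, h8, hs] using ha) ?_
    refine (ih₁ hc (by omega) hm₀ (s.tick _) h5 h8 hs).mono fun s' h' => ?_
    have h5' : s'.reg 5 = E := by rw [h'.1]; exact h5
    have h8' : s'.reg 8 = i := by rw [h'.1]; exact h8
    refine (ih₂ hc (by simp only [Com.cellBound]; omega) (x₁.le_word hc hW₀ hm₀) s' h5' h8'
      h'.2.1).mono fun s'' h'' => (h'.trans h'').of_tick.mono ?_
    simp [Exp.cost, Exp.ar, Exp.addr, Exp.pair]; omega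
  | @loopFalse a c m ha =>
    simp only [Com.cellBound] at hb
    refine WP.whl_false (fr s a h5 h8 (by omega)) (by simpa [h5, h8, hs] using ha) ?_
    exact ⟨rfl, hs, fun _ _ => rfl, by simp [Exp.cost, Exp.ar, Exp.addr, Exp.pair], rfl⟩

/-! ### Matchings and concatenations -/

section Matching

variable {V P Q : Type}

theorem IsMatching.subset {G : SimpleGraph V} {M N : Finset (Sym2 V)} (h : IsMatching G M)
    (hN : N ⊆ M) : IsMatching G N :=
  ⟨fun e he => h.1 e (hN he), fun e he f hf => h.2 e (hN he) f (hN hf)⟩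

theorem isMatching_empty (G : SimpleGraph V) : IsMatching G ∅ := by simp [IsMatching]

theorem bddAbove_matching [Finite V] (G : SimpleGraph V) :
    BddAbove {k | ∃ M : Finset (Sym2 V), IsMatching G M ∧ M.card = k} := by
  classical
  have := Fintype.ofFinite V
  refine ⟨Fintype.card (Sym2 V), ?_⟩
  rintro k ⟨M, -, rfl⟩
  exact Finset.card_le_univ M

theorem IsMatching.card_le [Finite V] {G : SimpleGraph V} {M : Finset (Sym2 V)}
    (h : IsMatching G M) : M.card ≤ matchNum G :=
  le_csSup (bddAbove_matching G) ⟨M, h, rfl⟩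

theorem exists_isMatching_card_eq_matchNum [Finite V] (G : SimpleGraph V) :
    ∃ M : Finset (Sym2 V), IsMatching G M ∧ M.card = matchNum G :=
  Nat.sSup_mem (s := {k | ∃ M : Finset (Sym2 V), IsMatching G M ∧ M.card = k})
    ⟨0, ∅, isMatching_empty G, rfl⟩ (bddAbove_matching G)

theorem exists_isMatching_card_eq [Finite V] (G : SimpleGraph V) {k : ℕ} (hk : k ≤ matchNum G) :
    ∃ M : Finset (Sym2 V), IsMatching G M ∧ M.card = k := by
  obtain ⟨M, hM, hc⟩ := exists_isMatching_card_eq_matchNum G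
  obtain ⟨N, hN, rfl⟩ := Finset.exists_subset_card_eq (hk.trans_eq hc.symm)
  exact ⟨N, hM.subset hN, rfl⟩

theorem IsMatching.two_mul_card_le [Fintype V] {G : SimpleGraph V} {M : Finset (Sym2 V)}
    (h : IsMatching G M) : 2 * M.card ≤ Fintype.card V := by
  classical
  have hd : (M : Set (Sym2 V)).PairwiseDisjoint fun e => e.toFinset := by
    intro e he f hf hef
    exact Finset.disjoint_left.2 fun v hv hv' => hef (h.2 e he f hf v
      (Sym2.mem_toFinset.1 hv) (Sym2.mem_toFinset.1 hv'))
  have hcard : (M.biUnion fun e => e.toFinset).card = M.card * 2 := by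
    rw [Finset.card_biUnion hd, Finset.sum_const_nat]
    intro e he
    exact Sym2.card_toFinset_of_not_isDiag e (G.not_isDiag_of_mem_edgeSet (h.1 e he))
  have := Finset.card_le_univ (M.biUnion fun e => e.toFinset)
  omega

theorem two_mul_matchNum_le [Fintype V] (G : SimpleGraph V) :
    2 * matchNum G ≤ Fintype.card V := by
  obtain ⟨M, hM, hc⟩ := exists_isMatching_card_eq_matchNum G
  rw [← hc]
  exact hM.two_mul_card_le

theorem exists_rep_of_mem_edgeSet_concat {G : SimpleGraph V} {f : V → P} {e : Sym2 P}
    (he : e ∈ (concat G f).edgeSet) : ∃ e' ∈ G.edgeSet, e'.map f = e := by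
  induction e using Sym2.ind with
  | _ p q =>
    obtain ⟨-, u, w, rfl, rfl, h⟩ := he
    exact ⟨s(u, w), h, rfl⟩

/-- Choosing an edge of `G` for each edge of a matching of a concatenation gives a matching. -/
theorem IsMatching.image_rep [DecidableEq (Sym2 V)] {G : SimpleGraph V} {f : V → P}
    {M : Finset (Sym2 P)} (h : IsMatching (concat G f) M) (rep : Sym2 P → Sym2 V)
    (hrep : ∀ e ∈ M, rep e ∈ G.edgeSet ∧ (rep e).map f = e) :
    IsMatching G (M.image rep) ∧ (M.image rep).card = M.card := by
  refine ⟨⟨?_, ?_⟩, ?_⟩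
  · simp only [Finset.mem_image, forall_exists_index, and_imp, forall_apply_eq_imp_iff₂]
    exact fun e he => (hrep e he).1
  · simp only [Finset.mem_image, forall_exists_index, and_imp, forall_apply_eq_imp_iff₂]
    intro e he e' he' v hv hv'
    rw [h.2 e he e' he' (f v)]
    · rw [← (hrep e he).2]; exact Sym2.mem_map.2 ⟨v, hv, rfl⟩
    · rw [← (hrep e' he').2]; exact Sym2.mem_map.2 ⟨v, hv', rfl⟩
  · refine Finset.card_image_of_injOn fun e he e' he' hee => ?_
    rw [← (hrep e he).2, ← (hrep e' he').2, hee]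

theorem matchNum_concat_le [Finite V] [Finite P] (G : SimpleGraph V) (f : V → P) :
    matchNum (concat G f) ≤ matchNum G := by
  classical
  obtain ⟨M, hM, hc⟩ := exists_isMatching_card_eq_matchNum (concat G f)
  -- A nonempty matching supplies an edge of G as default value of `rep` outside `M`.
  rcases M.eq_empty_or_nonempty with rfl | ⟨e₀, h₀⟩
  · rw [← hc]; exact Nat.zero_le _
  obtain ⟨x, -⟩ := exists_rep_of_mem_edgeSet_concat (hM.1 e₀ h₀)
  have : ∀ e : Sym2 P, ∃ e' : Sym2 V, e ∈ M → e' ∈ G.edgeSet ∧ e'.map f = e := fun e => by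
    by_cases he : e ∈ M
    · obtain ⟨e', h⟩ := exists_rep_of_mem_edgeSet_concat (hM.1 e he)
      exact ⟨e', fun _ => h⟩
    · exact ⟨x, fun h => absurd h he⟩
  choose rep hrep using this
  have := hM.image_rep rep hrep
  rw [← hc, ← this.2]
  exact this.1.card_le

theorem concat_concat (G : SimpleGraph V) (f : V → P) (h : P → Q) :
    concat (concat G f) h = concat G (h ∘ f) := by
  ext i j
  constructor
  · rintro ⟨hne, p, q, rfl, rfl, -, u, w, rfl, rfl, ha⟩
    exact ⟨hne, u, w, rfl, rfl, ha⟩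
  · rintro ⟨hne, u, w, rfl, rfl, ha⟩
    exact ⟨hne, f u, f w, rfl, rfl, fun h' => hne (congrArg h h'), u, w, rfl, rfl, ha⟩

/-- Merging parts is one more concatenation, so a finer partition is never worse. -/
theorem matchNum_concat_comp_le [Finite P] [Finite Q] (G : SimpleGraph V) (f : V → P)
    (h : P → Q) : matchNum (concat G (h ∘ f)) ≤ matchNum (concat G f) := by
  rw [← concat_concat]
  exact matchNum_concat_le _ _

end Matching

/-! ### Keys of unordered pairs -/

/-- A key for the unordered pair of two numbers below `n`. -/
def enc (n a b : ℕ) : ℕ := (a + b) * (n * n) + a * b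

theorem enc_comm (n a b : ℕ) : enc n a b = enc n b a := by
  unfold enc; ring

/-- In base n² the digits of the key are a + b and ab, and these determine the unordered pair. A
symmetric key avoids ordering the ends of an edge, and a query finds the other end from the sum. -/
theorem enc_div {n a b : ℕ} (ha : a < n) (hb : b < n) : enc n a b / (n * n) = a + b := by
  have h : a * b < n * n := Nat.mul_lt_mul'' ha hb
  unfold enc
  rw [Nat.add_comm, Nat.add_mul_div_right _ _ (by omega), Nat.div_eq_of_lt h, Nat.zero_add]

theorem enc_mod {n a b : ℕ} (ha : a < n) (hb : b < n) : enc n a b % (n * n) = a * b := by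
  have h : a * b < n * n := Nat.mul_lt_mul'' ha hb
  unfold enc
  rw [Nat.add_comm, Nat.add_mul_mod_self_right, Nat.mod_eq_of_lt h]

/-- How to recognize the elements of a pair from its sum and its product. -/
theorem mul_sub_eq_iff {a b v : ℕ} : (v ≤ a + b ∧ v * (a + b - v) = a * b) ↔ v = a ∨ v = b := by
  constructor
  · rintro ⟨hle, h⟩
    zify [hle] at h
    have : ((v : ℤ) - a) * ((v : ℤ) - b) = 0 := by linear_combination -h
    rcases mul_eq_zero.1 this with h | h <;> omega
  · rintro (rfl | rfl)
    · exact ⟨by omega, by rw [Nat.add_sub_cancel_left]⟩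
    · exact ⟨by omega, by rw [Nat.add_sub_cancel, Nat.mul_comm]⟩

theorem enc_inj {n a b a' b' : ℕ} (ha : a < n) (hb : b < n) (ha' : a' < n) (hb' : b' < n) :
    enc n a b = enc n a' b' ↔ (a = a' ∧ b = b') ∨ (a = b' ∧ b = a') := by
  constructor
  · intro h
    have hs : a + b = a' + b' := by rw [← enc_div ha hb, h, enc_div ha' hb']
    have hp : a * b = a' * b' := by rw [← enc_mod ha hb, h, enc_mod ha' hb']
    have : a = a' ∨ a = b' := mul_sub_eq_iff.1 ⟨by omega, by
      rw [← hs, Nat.add_sub_cancel_left, hp]⟩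
    omega
  · rintro (⟨rfl, rfl⟩ | ⟨rfl, rfl⟩)
    · rfl
    · exact enc_comm _ _ _

theorem enc_lt {n a b : ℕ} (ha : a < n) (hb : b < n) : enc n a b < 2 * n ^ 3 := by
  have h : a * b < n * n := Nat.mul_lt_mul'' ha hb
  have : (a + b + 1) * (n * n) ≤ 2 * n * (n * n) := Nat.mul_le_mul_right _ (by omega)
  unfold enc
  nlinarith

/-! ### Unordered lists with positions -/

/-- The first `cnt` entries of `item` list the set `X` without repetition, and `pos` gives the
position of each element of `X`. -/
def ListInv (X : Set ℕ) (cnt : ℕ) (item pos : ℕ → ℕ) : Prop :=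
  (∀ i < cnt, item i ∈ X ∧ pos (item i) = i) ∧ ∀ e ∈ X, pos e < cnt ∧ item (pos e) = e

namespace ListInv

variable {X : Set ℕ} {cnt : ℕ} {item pos : ℕ → ℕ}

theorem insert (h : ListInv X cnt item pos) {e : ℕ} (he : e ∉ X) :
    ListInv (insert e X) (cnt + 1) (Function.update item cnt e) (Function.update pos e cnt) := by
  constructor
  · intro i hi
    by_cases hic : i = cnt
    · subst hic; simp
    · have := h.1 i (by omega)
      rw [Function.update_of_ne hic, Function.update_of_ne (fun h' => he
          (by rw [← h']; exact this.1))]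
      exact ⟨Or.inr this.1, this.2⟩
  · rintro x (rfl | hx)
    · simp
    · have := h.2 x hx
      rw [Function.update_of_ne (fun h' => he (by rw [← h']; exact hx)), Function.update_of_ne
          (by omega)]
      exact ⟨by omega, this.2⟩

theorem pos_cnt (h : ListInv X cnt item pos) {e : ℕ} (he : e ∈ X) : 0 < cnt :=
  (Nat.zero_le _).trans_lt (h.2 e he).1

/-- The last entry moves to the freed position, which takes constant time; if `e` itself is last,
the two writes change nothing. -/
theorem erase (h : ListInv X cnt item pos) {e : ℕ} (he : e ∈ X) :
    ListInv (X \ {e}) (cnt - 1) (Function.update item (pos e) (item (cnt - 1)))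
      (Function.update pos (item (cnt - 1)) (pos e)) := by
  have h0 := h.pos_cnt he
  have hl := h.1 (cnt - 1) (by omega)
  have hE := h.2 e he
  constructor
  · intro i hi
    by_cases hip : i = pos e
    · subst hip
      simp only [Function.update_self, and_true]
      refine ⟨hl.1, fun h' => ?_⟩
      simp only [Set.mem_singleton_iff] at h'
      rw [h'] at hl
      omega
    · have := h.1 i (by omega)
      rw [Function.update_of_ne hip, Function.update_of_ne]
      · refine ⟨⟨this.1, fun h' => ?_⟩, this.2⟩
        simp only [Set.mem_singleton_iff] at h'
        rw [h'] at this
        omega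
      · intro h'
        rw [h'] at this
        omega
  · rintro x ⟨hx, hxe⟩
    have hX := h.2 x hx
    simp only [Set.mem_singleton_iff] at hxe
    by_cases hxl : x = item (cnt - 1)
    · rw [← hxl]
      simp only [Function.update_self, and_true]
      by_contra hge
      have h1 : pos e = cnt - 1 := by omega
      rw [h1] at hE
      exact hxe (hxl.trans hE.2)
    · rw [Function.update_of_ne hxl, Function.update_of_ne]
      · refine ⟨?_, hX.2⟩
        by_contra hge
        have h1 : pos x = cnt - 1 := by omega
        rw [h1] at hX
        exact hxl hX.2.symm
      · intro h'
        rw [h', hE.2] at hX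
        exact hxe hX.2.symm

/-- The lists of all part pairs of an instance share one position array; this transfers the
invariant of the lists that an operation does not concern. -/
theorem congr_pos (h : ListInv X cnt item pos) {pos' : ℕ → ℕ} (hp : ∀ e ∈ X, pos' e = pos e) :
    ListInv X cnt item pos' :=
  ⟨fun i hi => ⟨(h.1 i hi).1, by rw [hp _ (h.1 i hi).1]; exact (h.1 i hi).2⟩,
    fun e he => by rw [hp e he]; exact h.2 e he⟩

theorem cnt_le (h : ListInv X cnt item pos) {B : ℕ} (hB : ∀ e ∈ X, e < B) : cnt ≤ B := by
  have := Finset.card_le_card_of_injOn (s := Finset.range cnt) (t := Finset.range B) item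
    (fun i hi => by simpa using hB _ (h.1 i (by simpa using hi)).1)
    (fun i hi j hj hij => by
      rw [← (h.1 i (by simpa using hi)).2, hij, (h.1 j (by simpa using hj)).2])
  simpa using this

end ListInv

/-! ### Concatenations under updates -/

/-- The graph after an update. -/
abbrev toggle {n : ℕ} (G : SimpleGraph (Fin n)) (p : Pair n) : SimpleGraph (Fin n) :=
  symmDiff G (SimpleGraph.edge p.1.1 p.1.2)

section Toggle

variable {n np : ℕ} (f : Fin n → Fin np) (G : SimpleGraph (Fin n)) (p : Pair n)

theorem toggle_adj_of_ne {a b : Fin n} (h : s(a, b) ≠ s(p.1.1, p.1.2)) :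
    (toggle G p).Adj a b ↔ G.Adj a b := by
  have : ¬ (SimpleGraph.edge p.1.1 p.1.2).Adj a b := by
    rw [SimpleGraph.edge_adj]
    rintro ⟨⟨rfl, rfl⟩ | ⟨rfl, rfl⟩, -⟩
    · exact h rfl
    · exact h Sym2.eq_swap
  simp [toggle, symmDiff, this]

theorem toggle_adj_self : (toggle G p).Adj p.1.1 p.1.2 ↔ ¬ G.Adj p.1.1 p.1.2 := by
  have : (SimpleGraph.edge p.1.1 p.1.2).Adj p.1.1 p.1.2 := by
    rw [SimpleGraph.edge_adj]
    exact ⟨Or.inl ⟨rfl, rfl⟩, p.2⟩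
  simp [toggle, symmDiff, this]

theorem concat_toggle_adj_of_ne {a b : Fin np} (h : s(a, b) ≠ s(f p.1.1, f p.1.2)) :
    (concat (toggle G p) f).Adj a b ↔ (concat G f).Adj a b := by
  have : ∀ u w, f u = a → f w = b → s(u, w) ≠ s(p.1.1, p.1.2) := by
    rintro u w rfl rfl h'
    exact h (by simpa using congrArg (Sym2.map f) h')
  constructor
  · rintro ⟨hne, u, w, hu, hw, ha⟩
    exact ⟨hne, u, w, hu, hw, (toggle_adj_of_ne G p (this u w hu hw)).1 ha⟩
  · rintro ⟨hne, u, w, hu, hw, ha⟩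
    exact ⟨hne, u, w, hu, hw, (toggle_adj_of_ne G p (this u w hu hw)).2 ha⟩

open Classical in
/-- The update of the concatenation that is caused by an update of the graph. -/
noncomputable def stepMove : Option (Pair np) :=
  if h : f p.1.1 ≠ f p.1.2 ∧ ((concat (toggle G p) f).Adj (f p.1.1) (f p.1.2) ↔
      ¬ (concat G f).Adj (f p.1.1) (f p.1.2)) then some ⟨(f p.1.1, f p.1.2), h.1⟩ else none

/-- The updates of the concatenation that are caused by given updates of the graph. -/
noncomputable def instMoves (moves : ℕ → Option (Pair n)) (s : ℕ) : Option (Pair np) :=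
  (moves s).bind (stepMove f (graphAt moves s))

theorem graphAt_succ_some {moves : ℕ → Option (Pair n)} {s : ℕ} {p : Pair n}
    (h : moves s = some p) : graphAt moves (s + 1) = toggle (graphAt moves s) p := by
  rw [graphAt, h]

theorem graphAt_succ_none {moves : ℕ → Option (Pair n)} {s : ℕ} (h : moves s = none) :
    graphAt moves (s + 1) = graphAt moves s := by
  rw [graphAt, h]

theorem concat_bot : concat (⊥ : SimpleGraph (Fin n)) f = ⊥ := by
  ext a b
  simp [concat]

/-- An edge of G influences only the adjacency of the two parts of its ends, so the concatenation
stays or changes in exactly that pair. -/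
theorem concat_toggle : concat (toggle G p) f =
    match stepMove f G p with
    | none => concat G f
    | some p' => toggle (concat G f) p' := by
  unfold stepMove
  split_ifs with h
  · ext a b
    by_cases hab : s(a, b) = s(f p.1.1, f p.1.2)
    · have e₁ : ∀ H : SimpleGraph (Fin np), H.Adj a b ↔ H.Adj (f p.1.1) (f p.1.2) := fun H => by
        rw [← SimpleGraph.mem_edgeSet, ← SimpleGraph.mem_edgeSet, hab]
      rw [e₁, e₁, h.2]
      exact (toggle_adj_self (concat G f) ⟨(f p.1.1, f p.1.2), h.1⟩).symm
    · rw [concat_toggle_adj_of_ne f G p hab]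
      exact (toggle_adj_of_ne (concat G f) ⟨(f p.1.1, f p.1.2), h.1⟩ hab).symm
  · ext a b
    by_cases hab : s(a, b) = s(f p.1.1, f p.1.2)
    · have e₁ : ∀ H : SimpleGraph (Fin np), H.Adj a b ↔ H.Adj (f p.1.1) (f p.1.2) := fun H => by
        rw [← SimpleGraph.mem_edgeSet, ← SimpleGraph.mem_edgeSet, hab]
      rw [e₁, e₁]
      by_cases hne : f p.1.1 = f p.1.2
      · rw [hne]; simp
      · have := fun h' => h ⟨hne, h'⟩
        tauto
    · exact concat_toggle_adj_of_ne f G p hab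

theorem graphAt_instMoves (moves : ℕ → Option (Pair n)) (s : ℕ) :
    graphAt (instMoves f moves) s = concat (graphAt moves s) f := by
  induction s with
  | zero => exact (concat_bot f).symm
  | succ s ih =>
    cases hm : moves s with
    | none =>
      rw [graphAt_succ_none hm, graphAt_succ_none (by simp [instMoves, hm]), ih]
    | some p =>
      rw [graphAt_succ_some hm, concat_toggle]
      have hi : instMoves f moves s = stepMove f (graphAt moves s) p := by simp [instMoves, hm]
      cases hp : stepMove f (graphAt moves s) p with
      | none => rw [graphAt_succ_none (hi.trans hp), ih]
      | some p' => rw [graphAt_succ_some (hi.trans hp), ih]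

/-- The moves of a concatenation up to round `s` depend only on the moves up to round `s`. -/
theorem instMoves_congr {moves moves' : ℕ → Option (Pair n)} {s : ℕ}
    (h : ∀ i ≤ s, moves i = moves' i) : instMoves f moves s = instMoves f moves' s := by
  have hg : ∀ i ≤ s, graphAt moves i = graphAt moves' i := by
    intro i
    induction i with
    | zero => intro; rfl
    | succ i ih =>
      intro hi
      rw [graphAt, graphAt, h i (by omega), ih (by omega)]
  rw [instMoves, instMoves, h s le_rfl, hg s le_rfl]

theorem isSome_of_instMoves {moves : ℕ → Option (Pair n)} {s : ℕ}
    (h : (instMoves f moves s).isSome) : (moves s).isSome := by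
  cases hm : moves s with
  | none => simp [instMoves, hm] at h
  | some p => rfl

theorem concat_adj_of_adj {f : Fin n → Fin np} {G : SimpleGraph (Fin n)} {u w : Fin n}
    (h : G.Adj u w) (hne : f u ≠ f w) : (concat G f).Adj (f u) (f w) :=
  ⟨hne, u, w, rfl, rfl, h⟩

/-! ### The edge lists of a concatenation -/

/-- The keys of the edges of `G` that join the parts with key `κ`. -/
def crossing (κ : ℕ) : Set ℕ :=
  {e | ∃ u w, G.Adj u w ∧ f u ≠ f w ∧ enc n (f u) (f w) = κ ∧ e = enc n u w}

/-- For each pair of parts, the edges between them are listed by `cnt`, `item` and `pos`. -/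
def EdgeLists (cnt : ℕ → ℕ) (item : ℕ → ℕ → ℕ) (pos : ℕ → ℕ) : Prop :=
  ∀ κ, ListInv (crossing f G κ) (cnt κ) (item κ) pos

variable {f G p} {cnt pos : ℕ → ℕ} {item : ℕ → ℕ → ℕ}

theorem edgeLists_bot : EdgeLists f ⊥ (fun _ => 0) (fun _ _ => 0) (fun _ => 0) := by
  intro κ
  refine ⟨fun i hi => absurd hi (Nat.not_lt_zero _), ?_⟩
  rintro e ⟨u, w, h, -⟩
  exact h.elim

theorem enc_fin_inj {u w u' w' : Fin n} :
    enc n u w = enc n u' w' ↔ s(u, w) = s(u', w') := by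
  rw [enc_inj u.2 w.2 u'.2 w'.2, Sym2.eq_iff]
  simp [Fin.ext_iff]

theorem enc_part_inj (hn : np ≤ n) {a b a' b' : Fin np} :
    enc n a b = enc n a' b' ↔ s(a, b) = s(a', b') := by
  rw [enc_inj (a.2.trans_le hn) (b.2.trans_le hn) (a'.2.trans_le hn) (b'.2.trans_le hn),
    Sym2.eq_iff]
  simp [Fin.ext_iff]

theorem mem_crossing_iff {u w : Fin n} {κ : ℕ} :
    enc n u w ∈ crossing f G κ ↔ G.Adj u w ∧ f u ≠ f w ∧ enc n (f u) (f w) = κ := by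
  constructor
  · rintro ⟨u', w', ha, hne, hk, he⟩
    rw [enc_fin_inj, Sym2.eq_iff] at he
    rcases he with ⟨rfl, rfl⟩ | ⟨rfl, rfl⟩
    · exact ⟨ha, hne, hk⟩
    · exact ⟨ha.symm, hne.symm, by rw [enc_comm, hk]⟩
  · rintro ⟨ha, hne, hk⟩
    exact ⟨u, w, ha, hne, hk, rfl⟩

theorem crossing_lt {κ e : ℕ} (h : e ∈ crossing f G κ) : e < 2 * n ^ 3 := by
  obtain ⟨u, w, -, -, -, rfl⟩ := h
  exact enc_lt u.2 w.2

theorem crossing_key_unique {κ κ' e : ℕ} (h : e ∈ crossing f G κ)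
    (h' : e ∈ crossing f G κ') : κ = κ' := by
  obtain ⟨u, w, -, -, rfl, rfl⟩ := h
  exact ((mem_crossing_iff).1 h').2.2

/-- Part pairs are keyed in base n², so `np ≤ n` is what keeps different pairs apart. This is the
reason why partitions into more than n parts are not used as they are. -/
theorem EdgeLists.adj_iff (hn : np ≤ n) (h : EdgeLists f G cnt item pos) {a b : Fin np}
    (hab : a ≠ b) : (concat G f).Adj a b ↔ cnt (enc n a b) ≠ 0 := by
  constructor
  · rintro ⟨hne, u, w, rfl, rfl, ha⟩
    exact ((h _).pos_cnt ((mem_crossing_iff).2 ⟨ha, hne, rfl⟩)).ne'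
  · intro h0
    obtain ⟨⟨u, w, ha, hne, hk, -⟩, -⟩ := (h (enc n a b)).1 0 (by omega)
    rw [enc_part_inj hn, Sym2.eq_iff] at hk
    rcases hk with ⟨rfl, rfl⟩ | ⟨rfl, rfl⟩
    · exact concat_adj_of_adj ha hne
    · exact (concat_adj_of_adj ha hne).symm

/-- The head of the list is the edge of G that represents an edge of the concatenation. -/
theorem EdgeLists.exists_head (hn : np ≤ n) (h : EdgeLists f G cnt item pos) {a b : Fin np}
    (hab : (concat G f).Adj a b) :
    ∃ u w, G.Adj u w ∧ f u = a ∧ f w = b ∧ item (enc n a b) 0 = enc n u w := by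
  have h0 := (h.adj_iff hn hab.ne).1 hab
  obtain ⟨⟨u, w, ha, hne, hk, he⟩, -⟩ := (h (enc n a b)).1 0 (by omega)
  rw [enc_part_inj hn, Sym2.eq_iff] at hk
  rcases hk with ⟨rfl, rfl⟩ | ⟨rfl, rfl⟩
  · exact ⟨u, w, ha, rfl, rfl, he⟩
  · exact ⟨w, u, ha.symm, rfl, rfl, by rw [he, enc_comm]⟩

theorem EdgeLists.cnt_le (h : EdgeLists f G cnt item pos) (κ : ℕ) : cnt κ ≤ 2 * n ^ 3 :=
  (h κ).cnt_le fun _ => crossing_lt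

theorem crossing_toggle_eq {κ e : ℕ} (he : e ≠ enc n p.1.1 p.1.2) :
    e ∈ crossing f (toggle G p) κ ↔ e ∈ crossing f G κ := by
  have key : ∀ u w : Fin n, e = enc n u w → ((toggle G p).Adj u w ↔ G.Adj u w) := by
    rintro u w rfl
    exact toggle_adj_of_ne G p fun h => he (enc_fin_inj.2 h)
  constructor
  · rintro ⟨u, w, ha, hne, hk, hE⟩
    exact ⟨u, w, (key u w hE).1 ha, hne, hk, hE⟩
  · rintro ⟨u, w, ha, hne, hk, hE⟩
    exact ⟨u, w, (key u w hE).2 ha, hne, hk, hE⟩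

theorem EdgeLists.toggle_of_eq (h : EdgeLists f G cnt item pos)
    (hp : f p.1.1 = f p.1.2) : EdgeLists f (toggle G p) cnt item pos := by
  intro κ
  have : crossing f (toggle G p) κ = crossing f G κ := by
    ext e
    by_cases he : e = enc n p.1.1 p.1.2
    · subst he
      simp [mem_crossing_iff, hp]
    · exact crossing_toggle_eq he
  rw [this]
  exact h κ

theorem EdgeLists.insert (h : EdgeLists f G cnt item pos)
    (hp : f p.1.1 ≠ f p.1.2) (ha : ¬ G.Adj p.1.1 p.1.2) {κ e : ℕ}
    (hκ : κ = enc n (f p.1.1) (f p.1.2)) (he : e = enc n p.1.1 p.1.2) :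
    EdgeLists f (toggle G p) (Function.update cnt κ (cnt κ + 1))
      (Function.update item κ (Function.update (item κ) (cnt κ) e))
      (Function.update pos e (cnt κ)) := by
  intro κ'
  have hmem : ∀ κ', e ∉ crossing f G κ' := fun κ' h' => by
    rw [he, mem_crossing_iff] at h'
    exact ha h'.1
  have hmem' : e ∈ crossing f (toggle G p) κ' ↔ κ' = κ := by
    rw [he, mem_crossing_iff, toggle_adj_self, hκ]
    tauto
  by_cases hk : κ' = κ
  · rw [hk, Function.update_self, Function.update_self]
    have : crossing f (toggle G p) κ = Insert.insert e (crossing f G κ) := by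
      ext x
      by_cases hx : x = e
      · subst hx
        simpa [hk] using hmem'
      · rw [crossing_toggle_eq (by rwa [← he])]
        simp [hx]
    rw [this]
    exact (h κ).insert (hmem κ)
  · rw [Function.update_of_ne hk, Function.update_of_ne hk]
    have : crossing f (toggle G p) κ' = crossing f G κ' := by
      ext x
      by_cases hx : x = e
      · subst hx
        simp [hmem', hk, hmem κ']
      · exact crossing_toggle_eq (by rwa [← he])
    rw [this]
    refine (h κ').congr_pos fun x hx => Function.update_of_ne ?_ _ _
    rintro rfl
    exact hmem κ' hx

theorem EdgeLists.erase (h : EdgeLists f G cnt item pos)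
    (hp : f p.1.1 ≠ f p.1.2) (ha : G.Adj p.1.1 p.1.2) {κ e : ℕ}
    (hκ : κ = enc n (f p.1.1) (f p.1.2)) (he : e = enc n p.1.1 p.1.2) :
    EdgeLists f (toggle G p) (Function.update cnt κ (cnt κ - 1))
      (Function.update item κ (Function.update (item κ) (pos e) (item κ (cnt κ - 1))))
      (Function.update pos (item κ (cnt κ - 1)) (pos e)) := by
  intro κ'
  have hmem : e ∈ crossing f G κ := by
    rw [he, mem_crossing_iff]
    exact ⟨ha, hp, hκ.symm⟩
  have hmem' : e ∉ crossing f (toggle G p) κ' := by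
    rw [he, mem_crossing_iff, toggle_adj_self]
    tauto
  by_cases hk : κ' = κ
  · rw [hk, Function.update_self, Function.update_self]
    have : crossing f (toggle G p) κ = crossing f G κ \ {e} := by
      ext x
      by_cases hx : x = e
      · subst hx
        simpa [hk] using hmem'
      · rw [crossing_toggle_eq (by rwa [← he])]
        simp [hx]
    rw [this]
    exact (h κ).erase hmem
  · rw [Function.update_of_ne hk, Function.update_of_ne hk]
    have : crossing f (toggle G p) κ' = crossing f G κ' := by
      ext x
      by_cases hx : x = e
      · subst hx
        exact iff_of_false hmem' fun h' => hk (crossing_key_unique h' hmem)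
      · exact crossing_toggle_eq (by rwa [← he])
    rw [this]
    refine (h κ').congr_pos fun x hx => Function.update_of_ne ?_ _ _
    rintro rfl
    have h0 := (h κ).pos_cnt hmem
    exact hk (crossing_key_unique hx ((h κ).1 _ (by omega)).1)

theorem EdgeLists.pos_le (h : EdgeLists f G cnt item pos)
    (hp : f p.1.1 ≠ f p.1.2) (ha : G.Adj p.1.1 p.1.2) : pos (enc n p.1.1 p.1.2) ≤ 2 * n ^ 3 :=
  ((h _).2 _ ((mem_crossing_iff).2 ⟨ha, hp, rfl⟩)).1.le.trans (h.cnt_le _)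

theorem EdgeLists.last_le (h : EdgeLists f G cnt item pos)
    (hp : f p.1.1 ≠ f p.1.2) (ha : G.Adj p.1.1 p.1.2) {κ : ℕ}
    (hκ : κ = enc n (f p.1.1) (f p.1.2)) : 0 < cnt κ ∧ item κ (cnt κ - 1) ≤ 2 * n ^ 3 := by
  have h0 := (h κ).pos_cnt ((mem_crossing_iff).2 ⟨ha, hp, hκ.symm⟩)
  exact ⟨h0, (crossing_lt ((h κ).1 (cnt κ - 1) (by omega)).1).le⟩

theorem stepMove_of_eq (hp : f p.1.1 = f p.1.2) : stepMove f G p = none := by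
  simp [stepMove, hp]

/-- After an insertion the two parts are adjacent; before it they were adjacent iff the list was
nonempty. -/
theorem EdgeLists.stepMove_insert (hn : np ≤ n) (h : EdgeLists f G cnt item pos)
    (hp : f p.1.1 ≠ f p.1.2) (ha : ¬ G.Adj p.1.1 p.1.2) {κ : ℕ}
    (hκ : κ = enc n (f p.1.1) (f p.1.2)) :
    stepMove f G p = if cnt κ = 0 then some ⟨(f p.1.1, f p.1.2), hp⟩ else none := by
  have h' : (concat (toggle G p) f).Adj (f p.1.1) (f p.1.2) :=
    concat_adj_of_adj ((toggle_adj_self G p).2 ha) hp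
  by_cases h0 : cnt κ = 0 <;> simp [stepMove, hp, h', h.adj_iff hn hp, ← hκ, h0]

/-- Before a deletion the two parts are adjacent; afterwards they are adjacent iff the shortened
list is nonempty. -/
theorem EdgeLists.stepMove_erase (hn : np ≤ n) (h : EdgeLists f G cnt item pos)
    (hp : f p.1.1 ≠ f p.1.2) (ha : G.Adj p.1.1 p.1.2) {κ : ℕ}
    (hκ : κ = enc n (f p.1.1) (f p.1.2)) :
    stepMove f G p = if cnt κ - 1 = 0 then some ⟨(f p.1.1, f p.1.2), hp⟩ else none := by
  have h' : (concat G f).Adj (f p.1.1) (f p.1.2) := concat_adj_of_adj ha hp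
  by_cases h0 : cnt κ - 1 = 0 <;>
    simp [stepMove, hp, h', (h.erase hp ha hκ rfl).adj_iff hn hp, ← hκ, h0]

end Toggle

/-! ### The update program

Registers: `0, 1, 2` input and output, `3` number `n` of vertices, `4` its square, `5` start of the
arrays, `6` number of instances, `7` best instance, `8` array number for simulations, `9` current
instance, `10` key of the updated edge, `11` best size, `12, 13` parts of the end vertices, `14` key
of the parts, `15` list length, `16, 17` for the list operations, `18` size of a matching.

Array `0` holds the addresses of the partition tables. The instance `j` uses the array `4 j + 1` for
the simulated memory, and the arrays `4 j + 2`, `4 j + 3`, `4 j + 4` for the edge lists. -/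

namespace Exp

/-- The expression computing `enc`. -/
def key (e f : Exp) : Exp := op .add (op .mul (op .add e f) (reg 4)) (op .mul e f)

/-- The address of an entry of an edge list. -/
def itemAddr (e f : Exp) : Exp := addr (op .add (reg 8) (lit 2)) (pair e f)

def posAddr (e : Exp) : Exp := addr (op .add (reg 8) (lit 3)) e

def cntAddr (e : Exp) : Exp := addr (op .add (reg 8) (lit 1)) e

end Exp

open Exp in
def insertCom : Com :=
  .seq (wr (itemAddr (reg 14) (reg 15)) (reg 10)) <|
  .seq (wr (posAddr (reg 10)) (reg 15)) <|
  wr (cntAddr (reg 14)) (op .add (reg 15) (lit 1))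

open Exp in
def eraseCom : Com :=
  .seq (asg 15 (op .sub (reg 15) (lit 1))) <|
  .seq (asg 16 (ld (posAddr (reg 10)))) <|
  .seq (asg 17 (ld (itemAddr (reg 14) (reg 15)))) <|
  .seq (wr (itemAddr (reg 14) (reg 16)) (reg 17)) <|
  .seq (wr (posAddr (reg 17)) (reg 16)) <|
  wr (cntAddr (reg 14)) (reg 15)

open Exp in
/-- Simulate the update program `u` for the parts in the registers `12` and `13`. -/
def runCom (u : Com) : Com :=
  .seq (wr (addr (reg 8) (lit 0)) (reg 0)) <|
  .seq (wr (addr (reg 8) (lit 1)) (reg 12)) <|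
  .seq (wr (addr (reg 8) (lit 2)) (reg 13)) <| sim u

-- After either list operation register 15 holds the length of the list without the updated edge.
-- The concatenation changes iff this is 0, so one test serves insertions and deletions.
open Exp in
def crossCom (u : Com) : Com :=
  .seq (asg 14 (key (reg 12) (reg 13))) <|
  .seq (asg 15 (ld (cntAddr (reg 14)))) <|
  .seq (cond (reg 0) insertCom eraseCom) <|
  cond (reg 15) skip (runCom u)

open Exp in
/-- The part of the vertex in register `i` in the current instance. -/
def partExp (i : ℕ) : Exp := ld (op .add (ar (lit 0) (reg 9)) (reg i))

open Exp in
def instCom (u : Com) : Com :=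
  .seq (asg 8 (op .add (op .mul (lit 4) (reg 9)) (lit 1))) <|
  .seq (asg 12 (partExp 1)) <|
  .seq (asg 13 (partExp 2)) <|
  .seq (cond (op .eq (reg 12) (reg 13)) skip (crossCom u)) <|
  .seq (asg 18 (ar (reg 8) (lit 0))) <|
  .seq (cond (op .lt (reg 11) (reg 18)) (.seq (asg 11 (reg 18)) (asg 7 (reg 9))) skip) <|
  asg 9 (op .add (reg 9) (lit 1))

open Exp in
def updateCom (u : Com) : Com :=
  .seq (asg 10 (key (reg 1) (reg 2))) <|
  .seq (asg 11 (lit 0)) <|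
  .seq (asg 7 (lit 0)) <|
  .seq (asg 9 (lit 0)) <|
  .seq (whl (op .lt (reg 9) (reg 6)) (instCom u)) <|
  asg 0 (reg 11)

theorem Exp.eval_key (s : State) (e f : Exp) : (Exp.key e f).eval s =
    (e.eval s + f.eval s) * s.reg 4 + e.eval s * f.eval s := rfl
theorem Exp.eval_itemAddr (s : State) (e f : Exp) : (Exp.itemAddr e f).eval s =
    phys (s.reg 5) (s.reg 8 + 2) (pr (e.eval s) (f.eval s)) := rfl
theorem Exp.eval_posAddr (s : State) (e : Exp) : (Exp.posAddr e).eval s =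
    phys (s.reg 5) (s.reg 8 + 3) (e.eval s) := rfl
theorem Exp.eval_cntAddr (s : State) (e : Exp) : (Exp.cntAddr e).eval s =
    phys (s.reg 5) (s.reg 8 + 1) (e.eval s) := rfl

/-! ### Bounds -/

/-- All registers are at most `B`. -/
def RegLe (B : ℕ) (s : State) : Prop := ∀ i, i < 32 → s.reg i ≤ B

theorem RegLe.setReg {B : ℕ} {s : State} (h : RegLe B s) {i v : ℕ} (hv : v ≤ B) :
    RegLe B (s.setReg i v) := fun j hj => by
  rw [State.setReg_reg]
  split
  · exact hv
  · exact h j hj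

theorem RegLe.tick {B : ℕ} {s : State} (h : RegLe B s) {t : ℕ} : RegLe B (s.tick t) := h

theorem RegLe.fits {B W : ℕ} {s : State} (h : RegLe B s) (hB : B ≤ W) {i : ℕ} (hi : i < 32) :
    (Exp.reg i).Fits W s := ⟨hi, (h i hi).trans hB⟩

/-- The registers are set up for work on the instance `j`, and none is larger than `Z ^ 4`. -/
def Env (E j Z : ℕ) (s : State) : Prop := s.reg 5 = E ∧ s.reg 8 = 4 * j + 1 ∧ RegLe (Z ^ 4) s

theorem Env.setReg {E j Z : ℕ} {s : State} (h : Env E j Z s) {i v : ℕ} (hv : v ≤ Z ^ 4)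
    (h5 : i ≠ 5 := by omega) (h8 : i ≠ 8 := by omega) : Env E j Z (s.setReg i v) :=
  ⟨by simp [h5.symm, h.1], by simp [h8.symm, h.2.1], h.2.2.setReg hv⟩

theorem pow_le_pow_of_ten_le {Z p q : ℕ} (hZ : 10 ≤ Z) (h : p ≤ q) : Z ^ p ≤ Z ^ q :=
  Nat.pow_le_pow_right (by omega) h

theorem mul_pow_le {Z c p : ℕ} (hc : c ≤ Z) : c * Z ^ p ≤ Z ^ (p + 1) := by
  rw [pow_succ, mul_comm]
  exact Nat.mul_le_mul_left _ hc

theorem two_mul_cube_le {Z n : ℕ} (hZ : 10 ≤ Z) (hn : n ≤ Z) : 2 * n ^ 3 ≤ Z ^ 4 :=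
  (Nat.mul_le_mul_left 2 (Nat.pow_le_pow_left hn 3)).trans (mul_pow_le (by omega))

/-- The source of the exponents: edge keys are below 2n³ ≤ Z⁴, a pair of a key and a position is at
most Z⁹, a cell number of an array turns into at most Z¹⁹, and the start address is covered by Z²⁰.
-/
theorem pr_le_pow {Z a b p : ℕ} (hZ : 10 ≤ Z) (ha : a ≤ Z ^ p) (hb : b ≤ Z ^ p) :
    pr a b ≤ Z ^ (2 * p + 1) := by
  have h1 : 1 ≤ Z ^ p := Nat.one_le_pow _ _ (by omega)
  have h2 : (a + b) * (a + b) ≤ (2 * Z ^ p) * (2 * Z ^ p) := Nat.mul_le_mul (by omega) (by omega)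
  have h3 : 5 * Z ^ (2 * p) ≤ Z ^ (2 * p + 1) := mul_pow_le (by omega)
  have h4 : Z ^ (2 * p) = Z ^ p * Z ^ p := by rw [two_mul, pow_add]
  unfold pr
  nlinarith

theorem phys_le_pow {Z W E i x : ℕ} (hZ : 10 ≤ Z) (hE : E ≤ Z) (hi : i ≤ Z) (hx : x ≤ Z ^ 9)
    (hW : Z ^ 20 ≤ W) : phys E i x ≤ W := by
  refine le_trans ?_ hW
  have h9 : Z ^ 1 ≤ Z ^ 9 := pow_le_pow_of_ten_le hZ (by omega)
  rw [pow_one] at h9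
  have h1 : pr i x ≤ Z ^ 19 := pr_le_pow hZ (hi.trans h9) hx
  have h2 : Z ^ 9 ≤ Z ^ 19 := pow_le_pow_of_ten_le hZ (by omega)
  have h3 : 2 * Z ^ 19 ≤ Z ^ 20 := mul_pow_le (by omega)
  unfold phys
  omega

/-! ### Frames -/

/-- The states `s` and `s'` agree outside the arrays of the instance `j`. -/
def Frame (E j : ℕ) (s s' : State) : Prop :=
  (∀ y < E, s'.heap y = s.heap y) ∧
    ∀ i, i ≤ 4 * j ∨ 4 * j + 4 < i → s'.arr E i = s.arr E i

theorem Frame.refl {E j : ℕ} {s : State} : Frame E j s s := ⟨fun _ _ => rfl, fun _ _ => rfl⟩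

theorem Frame.trans {E j : ℕ} {s s' s'' : State} (h : Frame E j s s') (h' : Frame E j s' s'') :
    Frame E j s s'' :=
  ⟨fun y hy => (h'.1 y hy).trans (h.1 y hy), fun i hi => (h'.2 i hi).trans (h.2 i hi)⟩

theorem arr_setHeap_of_ne (s : State) (E x v : ℕ) {i i' : ℕ} (h : i' ≠ i) :
    (s.setHeap (phys E i x) v).arr E i' = s.arr E i' := by
  ext y
  simp [h]

theorem Frame.setHeap {E j : ℕ} {s s' : State} (h : Frame E j s s') {i x v : ℕ}
    (hi : 4 * j + 1 ≤ i ∧ i ≤ 4 * j + 4) : Frame E j s (s'.setHeap (phys E i x) v) :=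
  ⟨fun y hy => by rw [State.heap_setHeap_phys _ _ _ _ _ hy]; exact h.1 y hy,
    fun k hk => by rw [arr_setHeap_of_ne _ _ _ _ (by omega)]; exact h.2 k hk⟩

theorem Frame.of_simulated {E j τ : ℕ} {m : Mem} {s s' : State}
    (h : Simulated E (4 * j + 1) m τ s s') : Frame E j s s' := by
  obtain ⟨-, -, hf, -, -⟩ := h
  refine ⟨fun y hy => hf y fun x => by have := le_phys E (4 * j + 1) x; omega, fun i hi => ?_⟩
  ext x
  refine hf _ fun y h => ?_
  rw [phys_inj] at h
  omega

theorem arr_of_simulated {E i τ i' : ℕ} {m : Mem} {s s' : State}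
    (h : Simulated E i m τ s s') (hi : i' ≠ i) : s'.arr E i' = s.arr E i' := by
  ext x
  refine h.2.2.1 _ fun y h => ?_
  rw [phys_inj] at h
  exact hi h.1

/-- The edge lists of the instance `j` describe `G`. -/
def ListsOK {n np : ℕ} (E : ℕ) (s : State) (j : ℕ) (f : Fin n → Fin np)
    (G : SimpleGraph (Fin n)) : Prop :=
  EdgeLists f G (s.arr E (4 * j + 2)) (fun κ i => s.arr E (4 * j + 3) (pr κ i))
    (s.arr E (4 * j + 4))

/-- All lists of an instance lie in one array, indexed by key and position; a single write changes
one row in one place. -/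
theorem update_pr (a : ℕ → ℕ) (κ i v : ℕ) :
    (fun κ' i' => Function.update a (pr κ i) v (pr κ' i')) =
      Function.update (fun κ' i' => a (pr κ' i')) κ
        (Function.update (fun i' => a (pr κ i')) i v) := by
  ext κ' i'
  simp only [Function.update_apply, pr_inj]
  by_cases hκ : κ' = κ
  · subst hκ
    by_cases hi : i' = i <;> simp [hi]
  · simp [hκ]

/-! ### Correctness of the list operations on the machine -/

section Lists

variable {n np W Z E j : ℕ} {g : Oracle n} {r : ℕ → Bool} {f : Fin n → Fin np}
  {G : SimpleGraph (Fin n)} {p : Pair n} {s : State}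

/-- What the list operations do for an update at the pair `p`. -/
def ListsDone (E j Z : ℕ) (f : Fin n → Fin np) (G : SimpleGraph (Fin n)) (p : Pair n)
    (hp : f p.1.1 ≠ f p.1.2) (s s' : State) : Prop :=
  ListsOK E s' j f (toggle G p) ∧ Frame E j s s' ∧ s'.arr E (4 * j + 1) = s.arr E (4 * j + 1) ∧
    (stepMove f G p = if s'.reg 15 = 0 then some ⟨(f p.1.1, f p.1.2), hp⟩ else none) ∧
    (∀ i, i ≠ 15 → i ≠ 16 → i ≠ 17 → s'.reg i = s.reg i) ∧ RegLe (Z ^ 4) s' ∧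
    s'.time ≤ s.time + 200 ∧ s'.calls = s.calls

theorem fits_itemAddr (hZ : 10 ≤ Z) (hW : Z ^ 20 ≤ W) (hE : E ≤ Z) (hj : 4 * j + 4 ≤ Z)
    (hs : Env E j Z s) {a b : ℕ} (ha : a < 32) (hb : b < 32) :
    (Exp.itemAddr (.reg a) (.reg b)).Fits W s := by
  obtain ⟨h5, h8, hs⟩ := hs
  have hB : Z ^ 4 ≤ W := (pow_le_pow_of_ten_le hZ (by omega)).trans hW
  have hZW : Z ^ 1 ≤ W := (pow_le_pow_of_ten_le hZ (by omega)).trans hW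
  have h9 : pr (s.reg a) (s.reg b) ≤ Z ^ 9 := pr_le_pow hZ (hs a ha) (hs b hb)
  have h10 : Z ^ 9 ≤ W := (pow_le_pow_of_ten_le hZ (by omega)).trans hW
  rw [pow_one] at hZW
  refine Exp.fits_addr ⟨hs.fits hB (by omega), show 2 ≤ W by omega, ?_⟩
    (Exp.fits_pair (hs.fits hB ha) (hs.fits hB hb) (h9.trans h10)) ?_
  · simp; omega
  · exact phys_le_pow hZ (by omega) (by simp; omega) h9 hW

theorem fits_addr_reg (hZ : 10 ≤ Z) (hW : Z ^ 20 ≤ W) (hE : E ≤ Z) (hj : 4 * j + 4 ≤ Z)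
    (hs : Env E j Z s) {a d : ℕ} (ha : a < 32) (hd : d ≤ 3) :
    (Exp.addr (.op .add (.reg 8) (.lit d)) (.reg a)).Fits W s := by
  obtain ⟨h5, h8, hs⟩ := hs
  have hB : Z ^ 4 ≤ W := (pow_le_pow_of_ten_le hZ (by omega)).trans hW
  have hZW : Z ^ 1 ≤ W := (pow_le_pow_of_ten_le hZ (by omega)).trans hW
  rw [pow_one] at hZW
  refine Exp.fits_addr ⟨hs.fits hB (by omega), show d ≤ W by omega, ?_⟩ (hs.fits hB ha) ?_
  · simp; omega
  · exact phys_le_pow hZ (by omega) (by simp; omega)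
      ((hs a ha).trans (pow_le_pow_of_ten_le hZ (by omega))) hW

theorem insertCom_wp (hZ : 10 ≤ Z) (hW : Z ^ 20 ≤ W) (hn : np ≤ n)
    (hE : E ≤ Z) (hE' : 64 ≤ E) (hj : 4 * j + 4 ≤ Z) (hs : Env E j Z s) (hp : f p.1.1 ≠ f p.1.2)
      (ha : ¬ G.Adj p.1.1 p.1.2)
    (h14 : s.reg 14 = enc n (f p.1.1) (f p.1.2)) (h10 : s.reg 10 = enc n p.1.1 p.1.2)
    (h15 : s.reg 15 = s.arr E (4 * j + 2) (s.reg 14)) (hL : ListsOK E s j f G) :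
    WP W g r insertCom (ListsDone E j Z f G p hp s) s := by
  have h5 := hs.1
  have h8 := hs.2.1
  have hB : Z ^ 4 ≤ W := (pow_le_pow_of_ten_le hZ (by omega)).trans hW
  have h64 : ∀ i x, 64 ≤ phys E i x := fun i x => hE'.trans (le_phys _ _ _)
  have hB1 : Z ^ 4 + 1 ≤ W := by
    refine le_trans ?_ ((pow_le_pow_of_ten_le hZ (by omega : 5 ≤ 20)).trans hW)
    have : 2 * Z ^ 4 ≤ Z ^ 5 := mul_pow_le (by omega)
    have : 1 ≤ Z ^ 4 := Nat.one_le_pow _ _ (by omega)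
    omega
  refine WP.seq (WP.wr (phys E (4 * j + 3) (pr (s.reg 14) (s.reg 15))) (s.reg 10) ?_ rfl (h64 _ _)
    (fits_itemAddr hZ hW hE hj hs (by omega) (by omega)) (hs.2.2.fits hB (by omega)) ?_)
  · simp [Exp.eval_itemAddr, h5, h8]
  refine WP.seq (WP.wr (phys E (4 * j + 4) (s.reg 10)) (s.reg 15) ?_ rfl (h64 _ _)
    (fits_addr_reg hZ hW hE hj hs (by omega) (by omega)) (hs.2.2.fits hB (by omega)) ?_)
  · simp [Exp.eval_posAddr, h5, h8]
  refine WP.wr (phys E (4 * j + 2) (s.reg 14)) (s.reg 15 + 1) ?_ ?_ (h64 _ _)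
    (fits_addr_reg hZ hW hE hj hs (by omega) (by omega))
    ⟨hs.2.2.fits hB (by omega), show 1 ≤ W by omega, ?_⟩ ?_
  · simp [Exp.eval_cntAddr, h5, h8]
  · simp
  · have := hs.2.2 15 (by omega)
    simp; omega
  refine ⟨?_, ?_, ?_, ?_, fun i _ _ _ => rfl, hs.2.2, ?_, rfl⟩
  · have := EdgeLists.insert hL hp ha h14 h10
    unfold ListsOK
    convert this using 1
    · ext κ
      simp [Function.update_apply, h15]
    · rw [← h15, ← update_pr]
      ext κ i
      simp [Function.update_apply]
    · ext κ
      simp [Function.update_apply, h15]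
  · exact ((Frame.refl.setHeap (by omega)).setHeap (by omega)).setHeap (by omega)
  · ext x
    simp
  · rw [EdgeLists.stepMove_insert hn hL hp ha h14, ← h15]
    rfl
  · simp [Exp.cost, Exp.itemAddr, Exp.posAddr, Exp.cntAddr, Exp.addr, Exp.pair]

theorem eraseCom_wp (hZ : 10 ≤ Z) (hW : Z ^ 20 ≤ W) (hn : np ≤ n) (hnZ : n ≤ Z)
    (hE : E ≤ Z) (hE' : 64 ≤ E) (hj : 4 * j + 4 ≤ Z) (hs : Env E j Z s) (hp : f p.1.1 ≠ f p.1.2)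
      (ha : G.Adj p.1.1 p.1.2)
    (h14 : s.reg 14 = enc n (f p.1.1) (f p.1.2)) (h10 : s.reg 10 = enc n p.1.1 p.1.2)
    (h15 : s.reg 15 = s.arr E (4 * j + 2) (s.reg 14)) (hL : ListsOK E s j f G) :
    WP W g r eraseCom (ListsDone E j Z f G p hp s) s := by
  have h5 := hs.1
  have h8 := hs.2.1
  have hB : Z ^ 4 ≤ W := (pow_le_pow_of_ten_le hZ (by omega)).trans hW
  have h64 : ∀ i x, 64 ≤ phys E i x := fun i x => hE'.trans (le_phys _ _ _)
  have hZ4 : 1 ≤ Z ^ 4 := Nat.one_le_pow _ _ (by omega)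
  have hc := two_mul_cube_le hZ hnZ
  -- Positions and keys loaded from the heap are at most 2n³, which keeps the registers below Z⁴.
  have hpos := EdgeLists.pos_le hL hp ha
  obtain ⟨hcnt, hlast⟩ := EdgeLists.last_le hL hp ha h14
  rw [← h10] at hpos
  have h15' := hs.2.2 15 (by omega)
  set κ := s.reg 14 with hκ
  set e := s.reg 10 with he
  set c := s.reg 15 - 1 with hcdef
  set i := s.arr E (4 * j + 4) e with hi
  set x := s.arr E (4 * j + 3) (pr κ c) with hx
  rw [← h15, ← hcdef, ← hx] at hlast
  refine WP.seq (WP.asg c rfl (by omega)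
    ⟨hs.2.2.fits hB (by omega), show 1 ≤ W by omega, show s.reg 15 - 1 ≤ W by omega⟩ ?_)
  have hs₁ : Env E j Z (s.setReg 15 c) := hs.setReg (by omega)
  refine WP.seq (WP.asg i ?_ (by omega) ⟨fits_addr_reg hZ hW hE hj hs₁ (by omega) (by omega),
    ?_⟩ ?_)
  · simp [Exp.eval_posAddr, h5, h8, i, e, State.arr]
  · simpa [h5, Exp.eval_posAddr] using h64 _ _
  have hs₂ : Env E j Z ((s.setReg 15 c).setReg 16 i) := hs₁.setReg (by omega)
  refine WP.seq (WP.asg x ?_ (by omega) ⟨fits_itemAddr hZ hW hE hj hs₂ (by omega) (by omega),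
    ?_⟩ ?_)
  · simp [Exp.eval_itemAddr, h5, h8, x, κ, State.arr]
  · simpa [h5, Exp.eval_itemAddr] using h64 _ _
  have hs₃ : Env E j Z (((s.setReg 15 c).setReg 16 i).setReg 17 x) := hs₂.setReg (by omega)
  refine WP.seq (WP.wr (phys E (4 * j + 3) (pr κ i)) x ?_ ?_ (h64 _ _)
    (fits_itemAddr hZ hW hE hj hs₃ (by omega) (by omega)) (hs₃.2.2.fits hB (by omega)) ?_)
  · simp [Exp.eval_itemAddr, h5, h8, κ]
  · simp
  refine WP.seq (WP.wr (phys E (4 * j + 4) x) i ?_ ?_ (h64 _ _)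
    (fits_addr_reg hZ hW hE hj hs₃ (by omega) (by omega)) (hs₃.2.2.fits hB (by omega)) ?_)
  · simp [Exp.eval_posAddr, h5, h8]
  · simp
  refine WP.wr (phys E (4 * j + 2) κ) c ?_ ?_ (h64 _ _)
    (fits_addr_reg hZ hW hE hj hs₃ (by omega) (by omega)) (hs₃.2.2.fits hB (by omega)) ?_
  · simp [Exp.eval_cntAddr, h5, h8, κ]
  · simp
  refine ⟨?_, ?_, ?_, ?_, fun i h₁ h₂ h₃ => ?_, hs₃.2.2, ?_, rfl⟩
  · have := EdgeLists.erase hL hp ha h14 h10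
    unfold ListsOK
    convert this using 1
    · ext κ'
      simp [Function.update_apply, hcdef, h15]
    · rw [← h15, ← update_pr]
      ext κ' i'
      simp [Function.update_apply, i, x, c]
    · ext e'
      simp [Function.update_apply, i, x, c, h15]
  · exact ((Frame.refl.setHeap (by omega)).setHeap (by omega)).setHeap (by omega)
  · ext x
    simp
  · rw [EdgeLists.stepMove_erase hn hL hp ha h14, ← h15]
    simp [c]
  · simp [h₁, h₂, h₃]
  · simp [Exp.cost, Exp.itemAddr, Exp.posAddr, Exp.cntAddr, Exp.addr, Exp.pair]

end Lists

/-! ### One update of one instance -/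

/-- An instance: the address of its partition table, the number of parts, the accuracy parameter and
the partition. -/
structure Inst (n : ℕ) where
  tb : ℕ
  np : ℕ
  D : ℕ
  f : Fin n → Fin np

/-- The partition table lies in the heap below the arrays, where no update writes. -/
def Inst.Valid {n : ℕ} (I : Inst n) (E : ℕ) : Prop := I.np ≤ n ∧ 64 ≤ I.tb ∧ I.tb + n ≤ E

/-- The state holds the instance number `j`, whose simulated memory is `m`. -/
def InstOK {n : ℕ} (E : ℕ) (s : State) (j : ℕ) (I : Inst n) (G : SimpleGraph (Fin n)) (m : Mem) :
    Prop :=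
  s.arr E 0 j = I.tb ∧ (∀ v : Fin n, s.heap (I.tb + v) = I.f v) ∧
    (∀ x, s.arr E (4 * j + 1) x = m x) ∧ ListsOK E s j I.f G

/-- The four arrays of different instances are disjoint, and the tables are read-only. -/
theorem InstOK.frame {n E j j' : ℕ} {I : Inst n} {G : SimpleGraph (Fin n)} {m : Mem} {s s' : State}
    (h : InstOK E s j I G m) (hI : I.Valid E) (hf : Frame E j' s s') (hj : j ≠ j') :
    InstOK E s' j I G m := by
  obtain ⟨h₁, h₂, h₃, h₄⟩ := h
  refine ⟨by rw [hf.2 0 (by omega)]; exact h₁, fun v => ?_, ?_, ?_⟩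
  · rw [hf.1 _ (by have := hI.2.2; omega)]; exact h₂ v
  · rw [hf.2 (4 * j + 1) (by omega)]; exact h₃
  · unfold ListsOK
    rw [hf.2 (4 * j + 2) (by omega), hf.2 (4 * j + 3) (by omega), hf.2 (4 * j + 4) (by omega)]
    exact h₄

/-- The simulated algorithm performs the update of the concatenation caused by `p`. -/
def InstStep {n np n₀ : ℕ} (u : Com) (W₀ : ℕ) (g₀ : Oracle n₀) (r₀ : ℕ → Bool)
    (f : Fin n → Fin np) (G : SimpleGraph (Fin n)) (p : Pair n) (m m' : Mem) (cost : ℕ) : Prop :=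
  match stepMove f G p with
  | none => m' = m ∧ cost = 0
  | some p' => ∃ l, Exec W₀ g₀ r₀ u (updateMem (concat G f) p' m) m' cost l

section Step

variable {n n₀ W Z W₀ E j : ℕ} {g : Oracle n} {g₀ : Oracle n₀} {r r₀ : ℕ → Bool}
  {G : SimpleGraph (Fin n)} {p : Pair n} {s : State} {u : Com}
  {m m' : Mem} {cost : ℕ}

theorem phys_self_le (hZ : 10 ≤ Z) (hW : Z ^ 20 ≤ W) : phys Z Z Z ≤ W :=
  phys_le_pow hZ le_rfl le_rfl (Nat.le_self_pow (by omega) Z) hW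

theorem fits_addr_lit (hZ : 10 ≤ Z) (hW : Z ^ 20 ≤ W) (hE : E ≤ Z) (hj : 4 * j + 4 ≤ Z)
    (hs : Env E j Z s) {d : ℕ} (hd : d ≤ 3) : (Exp.addr (.reg 8) (.lit d)).Fits W s := by
  obtain ⟨h5, h8, hs⟩ := hs
  have hB : Z ^ 4 ≤ W := (pow_le_pow_of_ten_le hZ (by omega)).trans hW
  have hZW : Z ≤ W := (le_phys _ _ _).trans (phys_self_le hZ hW)
  refine Exp.fits_addr (hs.fits hB (by omega)) (show d ≤ W by omega) ?_
  exact (phys_mono (E' := Z) (i' := Z) (x' := Z) (by omega) (by simp; omega)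
    (by simp; omega)).trans (phys_self_le hZ hW)

/-- The data of a simulated run that stays within the word size `W₀`. -/
structure SimData (u : Com) (W₀ Z : ℕ) : Prop where
  callFree : u.CallFree
  cellBound : u.cellBound ≤ Z
  one_le : 1 ≤ W₀
  le : W₀ ≤ Z

theorem runCom_wp (hu : SimData u W₀ Z) (hZ : 10 ≤ Z) (hW : Z ^ 20 ≤ W) (hE : E ≤ Z)
    (hE' : 64 ≤ E) (hj : 4 * j + 4 ≤ Z) (hs : Env E j Z s) {np : ℕ} {H : SimpleGraph (Fin np)}
    {p' : Pair np} {l : List ℕ} (hnp : np ≤ W₀) (hm : ∀ y, m y ≤ W₀)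
    (hr : ∀ y, r (phys E (4 * j + 1) y) = r₀ y)
    (hx : Exec W₀ g₀ r₀ u (updateMem H p' m) m' cost l)
    (ha : s.reg 0 = updateMem H p' m 0) (h12 : s.reg 12 = p'.1.1) (h13 : s.reg 13 = p'.1.2)
    (harr : ∀ x, s.arr E (4 * j + 1) x = m x) :
    WP W g r (runCom u) (Simulated E (4 * j + 1) m' (100 + 40 * cost) s) s := by
  classical
  have h5 := hs.1
  have h8 := hs.2.1
  have hB : Z ^ 4 ≤ W := (pow_le_pow_of_ten_le hZ (by omega)).trans hW
  have h64 : ∀ i x, 64 ≤ phys E i x := fun i x => hE'.trans (le_phys _ _ _)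
  have h0 : updateMem H p' m 0 = if H.Adj p'.1.1 p'.1.2 then 0 else 1 := by
    unfold updateMem
    simp only [Function.update_apply]
    norm_num
  rw [h0] at ha
  refine WP.seq (WP.wr (phys E (4 * j + 1) 0) _ (by simp [h5, h8]) rfl (h64 _ _)
    (fits_addr_lit hZ hW hE hj hs (by omega)) (hs.2.2.fits hB (by omega)) ?_)
  have s₁ := Simulated.write 0 (s.reg 0) ((Exp.addr (.reg 8) (.lit 0)).cost +
      (Exp.reg 0).cost + 1) harr
  refine WP.seq (WP.wr (phys E (4 * j + 1) 1) (s.reg 12) (by simp [h5, h8]) rfl (h64 _ _)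
    (fits_addr_lit hZ hW hE hj hs (by omega)) (hs.2.2.fits hB (by omega)) ?_)
  have s₂ := s₁.trans (Simulated.write 1 (s.reg 12)
    ((Exp.addr (.reg 8) (.lit 1)).cost + (Exp.reg 12).cost + 1) s₁.2.1)
  refine WP.seq (WP.wr (phys E (4 * j + 1) 2) (s.reg 13) (by simp [h5, h8]) rfl (h64 _ _)
    (fits_addr_lit hZ hW hE hj hs (by omega)) (hs.2.2.fits hB (by omega)) ?_)
  have s₃ := s₂.trans (Simulated.write 2 (s.reg 13)
    ((Exp.addr (.reg 8) (.lit 2)).cost + (Exp.reg 13).cost + 1) s₂.2.1)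
  have hmem : Function.update (Function.update (Function.update m 0 (s.reg 0)) 1 (s.reg 12)) 2
      (s.reg 13) = updateMem H p' m := by
    unfold updateMem
    rw [h12, h13, ha]
  rw [hmem] at s₃
  refine (sim_wp hx hu.callFree hu.cellBound hu.one_le ?_ hu.le (phys_self_le hZ hW) hE' hE
    (by omega) hr _ (by exact h5) (by exact h8) s₃.2.1).mono fun s' h' => (s₃.trans h').mono ?_
  · intro y
    have h₁ := p'.1.1.2
    have h₂ := p'.1.2.2
    have h₃ := hu.one_le
    unfold updateMem
    simp only [Function.update_apply]
    split_ifs <;> first | omega | exact hm y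
  · simp [Exp.cost, Exp.addr, Exp.pair]

/-- What the processing of the instance `j` does to the state, except for the bookkeeping. -/
def CrossDone (E j Z : ℕ) {np : ℕ} (f : Fin n → Fin np) (G : SimpleGraph (Fin n)) (p : Pair n)
    (m' : Mem) (t : ℕ) (s s' : State) : Prop :=
  ListsOK E s' j f (toggle G p) ∧ Frame E j s s' ∧ (∀ x, s'.arr E (4 * j + 1) x = m' x) ∧
    (∀ i, i < 14 → s'.reg i = s.reg i) ∧ RegLe (Z ^ 4) s' ∧
    s'.time ≤ s.time + t ∧ s'.calls = s.calls

theorem fits_key (hZ : 10 ≤ Z) (hW : Z ^ 20 ≤ W) (hs : RegLe (Z ^ 4) s) {a b : ℕ} (ha : a < 32)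
    (hb : b < 32) (h4 : s.reg 4 ≤ Z ^ 4) :
    (Exp.key (.reg a) (.reg b)).Fits W s := by
  have hB : Z ^ 4 ≤ W := (pow_le_pow_of_ten_le hZ (by omega)).trans hW
  have h1 : 1 ≤ Z ^ 4 := Nat.one_le_pow _ _ (by omega)
  have ha' := hs a ha
  have hb' := hs b hb
  have h2 : (s.reg a + s.reg b) * s.reg 4 ≤ 2 * Z ^ 4 * Z ^ 4 :=
    Nat.mul_le_mul (by omega) h4
  have h3 : s.reg a * s.reg b ≤ Z ^ 4 * Z ^ 4 := Nat.mul_le_mul ha' hb'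
  have h5 : 3 * Z ^ 8 ≤ Z ^ 9 := mul_pow_le (by omega)
  have h6 : Z ^ 9 ≤ W := (pow_le_pow_of_ten_le hZ (by omega)).trans hW
  have h7 : Z ^ 8 = Z ^ 4 * Z ^ 4 := by rw [← pow_add]
  have h8 : Z ^ 4 ≤ Z ^ 4 * Z ^ 4 := Nat.le_mul_of_pos_left _ h1
  refine ⟨⟨⟨hs.fits hB ha, hs.fits hB hb, ?_⟩, hs.fits hB (by omega), ?_⟩,
    ⟨hs.fits hB ha, hs.fits hB hb, ?_⟩, ?_⟩
  · simp only [BinOp.eval_add, Exp.eval_reg]; nlinarith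
  · simp only [BinOp.eval_mul, BinOp.eval_add, Exp.eval_reg, Exp.eval_op]; nlinarith
  · simp only [BinOp.eval_mul, Exp.eval_reg]; nlinarith
  · simp only [BinOp.eval_mul, BinOp.eval_add, Exp.eval_reg, Exp.eval_op]; nlinarith

open Classical in
theorem crossCom_wp {np : ℕ} {f : Fin n → Fin np} (hu : SimData u W₀ Z) (hZ : 10 ≤ Z)
    (hW : Z ^ 20 ≤ W) (hn : np ≤ n) (hnZ : n ≤ Z) (hE : E ≤ Z)
    (hE' : 64 ≤ E) (hj : 4 * j + 4 ≤ Z) (hs : Env E j Z s) (hnp : np ≤ W₀) (hm : ∀ y, m y ≤ W₀)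
    (hr : ∀ y, r (phys E (4 * j + 1) y) = r₀ y)
    (hx : InstStep u W₀ g₀ r₀ f G p m m' cost) (hp : f p.1.1 ≠ f p.1.2)
    (h0 : s.reg 0 = if G.Adj p.1.1 p.1.2 then 0 else 1) (h4 : s.reg 4 = n * n)
    (h10 : s.reg 10 = enc n p.1.1 p.1.2)
    (h12 : s.reg 12 = f p.1.1) (h13 : s.reg 13 = f p.1.2)
    (harr : ∀ x, s.arr E (4 * j + 1) x = m x) (hL : ListsOK E s j f G) :
    WP W g r (crossCom u) (CrossDone E j Z f G p m' (400 + 40 * cost) s) s := by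
  have h5 := hs.1
  have h8 := hs.2.1
  have hB : Z ^ 4 ≤ W := (pow_le_pow_of_ten_le hZ (by omega)).trans hW
  have h64 : ∀ i x, 64 ≤ phys E i x := fun i x => hE'.trans (le_phys _ _ _)
  have hc := two_mul_cube_le hZ hnZ
  set κ := enc n (f p.1.1) (f p.1.2) with hκ
  have hκle : κ ≤ Z ^ 4 :=
    (enc_lt ((f p.1.1).2.trans_le hn) ((f p.1.2).2.trans_le hn)).le.trans hc
  have hcnt := (EdgeLists.cnt_le hL κ).trans hc
  refine WP.seq (WP.asg κ ?_ (hκle.trans hB) (fits_key hZ hW hs.2.2 (by omega) (by omega)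
    (hs.2.2 4 (by omega))) ?_)
  · simp [Exp.eval_key, h4, h12, h13, κ, enc]
  have hs₁ : Env E j Z (s.setReg 14 κ) := hs.setReg hκle
  refine WP.seq (WP.asg (s.arr E (4 * j + 2) κ) ?_ (hcnt.trans hB)
    ⟨fits_addr_reg hZ hW hE hj hs₁ (by omega) (by omega), ?_⟩ ?_)
  · simp [Exp.eval_cntAddr, h5, h8, State.arr]
  · simpa [h5, Exp.eval_cntAddr] using h64 _ _
  have hs₂ : Env E j Z ((s.setReg 14 κ).setReg 15 (s.arr E (4 * j + 2) κ)) := hs₁.setReg hcnt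
  set t₁ := (Exp.key (.reg 12) (.reg 13)).cost + 1
  set t₂ := (Exp.cntAddr (.reg 14)).ld.cost + 1
  set s₂ := (((s.setReg 14 κ).tick t₁).setReg 15 (s.arr E (4 * j + 2) κ)).tick t₂ with hs₂def
  have key : WP W g r (cond (.reg 0) insertCom eraseCom)
      (ListsDone E j Z f G p hp (s₂.tick 2)) s₂ := by
    refine WP.cond (hs₂.2.2.fits hB (by omega)) (fun hne => ?_) fun he => ?_
    · have hadj : ¬ G.Adj p.1.1 p.1.2 := fun h => hne (by simp [s₂, h0, h])
      refine insertCom_wp (s := s₂.tick 2) hZ hW hn hE hE' hj hs₂ hp hadj ?_ ?_ ?_ hL <;>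
        simp [s₂, h10, hκ]
    · have hadj : G.Adj p.1.1 p.1.2 := by
        by_contra h
        simp [s₂, h0, h] at he
      refine eraseCom_wp (s := s₂.tick 2) hZ hW hn hnZ hE hE' hj hs₂ hp hadj ?_ ?_ ?_ hL <;>
        simp [s₂, h10, hκ]
  refine WP.seq (key.mono fun s₃ h₃ => ?_)
  obtain ⟨l₃, f₃, a₃, m₃, r₃, b₃, t₃, c₃⟩ := h₃
  have e₃ : Env E j Z s₃ := ⟨by rw [r₃ 5 (by omega) (by omega) (by omega)]; exact hs₂.1,
    by rw [r₃ 8 (by omega) (by omega) (by omega)]; exact hs₂.2.1, b₃⟩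
  have hreg : ∀ i, i < 14 → s₃.reg i = s.reg i := fun i hi => by
    rw [r₃ i (by omega) (by omega) (by omega)]
    simp [s₂, show i ≠ 14 by omega, show i ≠ 15 by omega]
  have htime : s₃.time ≤ s.time + 260 := by
    refine t₃.trans ?_
    simp [s₂, t₁, t₂, Exp.cost, Exp.key, Exp.cntAddr, Exp.addr, Exp.pair]
  have hcalls : s₃.calls = s.calls := c₃
  have hfr : Frame E j s s₃ := f₃
  have harr₃ : ∀ x, s₃.arr E (4 * j + 1) x = m x := fun x => by rw [a₃]; exact harr x
  unfold InstStep at hx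
  rw [m₃] at hx
  refine WP.cond (b₃.fits hB (by omega)) (fun hne => WP.skip ?_) fun he => ?_
  · rw [if_neg (by simpa using hne)] at hx
    obtain ⟨rfl, rfl⟩ := hx
    exact ⟨l₃, hfr, harr₃, hreg, b₃, by simp [Exp.cost]; omega, hcalls⟩
  · have he' : s₃.reg 15 = 0 := by simpa using he
    rw [if_pos he'] at hx m₃
    obtain ⟨l, hx⟩ := hx
    refine (runCom_wp (s := s₃.tick 2) hu hZ hW hE hE' hj e₃ hnp hm hr hx ?_ ?_ ?_ harr₃).mono
      fun s₄ h₄ => ?_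
    · have hmv := concat_toggle f G p
      rw [m₃] at hmv
      simp only at hmv
      -- If the concatenation changes, it changes in the same direction as G, so the flag in
      -- register 0 is passed to the copy as it is.
      have : (concat G f).Adj (f p.1.1) (f p.1.2) ↔ G.Adj p.1.1 p.1.2 := by
        have h₁ := toggle_adj_self (concat G f) ⟨(f p.1.1, f p.1.2), hp⟩
        rw [← hmv] at h₁
        by_cases hG : G.Adj p.1.1 p.1.2
        · exact iff_of_true (concat_adj_of_adj hG hp) hG
        · refine iff_of_false ?_ hG
          exact h₁.1 (concat_adj_of_adj ((toggle_adj_self G p).2 hG) hp)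
      have h1 : s₃.reg 0 = s.reg 0 := hreg 0 (by omega)
      unfold updateMem
      simp only [Function.update_apply]
      simp [h1, h0, this]
    · exact (hreg 12 (by omega)).trans h12
    · exact (hreg 13 (by omega)).trans h13
    · refine ⟨?_, Frame.trans (s' := s₃.tick 2) hfr (Frame.of_simulated h₄), h₄.2.1, fun i hi =>
          ?_, ?_, ?_, ?_⟩
      · unfold ListsOK
        rw [arr_of_simulated h₄ (by omega), arr_of_simulated h₄ (by omega),
          arr_of_simulated h₄ (by omega)]
        exact l₃
      · rw [h₄.1]; exact hreg i hi
      · unfold RegLe; rw [h₄.1]; exact b₃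
      · have := h₄.2.2.2.1
        simp only [State.tick_time] at this
        omega
      · rw [h₄.2.2.2.2]; exact hcalls

/-- What an update does to the instance `j`. -/
def InstDone (E j Z : ℕ) (I : Inst n) (G : SimpleGraph (Fin n)) (p : Pair n)
    (m' : Mem) (t : ℕ) (s s' : State) : Prop :=
  InstOK E s' j I (toggle G p) m' ∧ Frame E j s s' ∧
    (∀ i, i < 11 → i ≠ 7 → i ≠ 8 → i ≠ 9 → s'.reg i = s.reg i) ∧ s'.reg 9 = j + 1 ∧
    (s'.reg 11 = max (s.reg 11) (m' 0)) ∧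
    (s'.reg 7 = if s.reg 11 < m' 0 then j else s.reg 7) ∧ RegLe (Z ^ 4) s' ∧
    s'.time ≤ s.time + t ∧ s'.calls = s.calls

open Classical in
theorem instCom_wp {I : Inst n} (hI : I.Valid E) (hu : SimData u W₀ Z) (hZ : 10 ≤ Z)
    (hW : Z ^ 20 ≤ W) (hnZ : n ≤ Z) (hE : E ≤ Z)
    (hE' : 64 ≤ E) (hj : 4 * j + 4 ≤ Z) (hs : RegLe (Z ^ 4) s) (hnp : I.np ≤ W₀)
    (hm : ∀ y, m y ≤ W₀) (hm' : ∀ y, m' y ≤ W₀)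
    (hr : ∀ y, r (phys E (4 * j + 1) y) = r₀ y)
    (hx : InstStep u W₀ g₀ r₀ I.f G p m m' cost)
    (h0 : s.reg 0 = if G.Adj p.1.1 p.1.2 then 0 else 1) (h1 : s.reg 1 = p.1.1)
    (h2 : s.reg 2 = p.1.2) (h4 : s.reg 4 = n * n) (h5 : s.reg 5 = E) (h9 : s.reg 9 = j)
    (h10 : s.reg 10 = enc n p.1.1 p.1.2) (hok : InstOK E s j I G m) :
    WP W g r (instCom u) (InstDone E j Z I G p m' (500 + 40 * cost) s) s := by
  obtain ⟨hn, htb, htE⟩ := hI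
  have hB : Z ^ 4 ≤ W := (pow_le_pow_of_ten_le hZ (by omega)).trans hW
  have hZ4 : Z ≤ Z ^ 4 := Nat.le_self_pow (by omega) Z
  have hWZ := hu.le
  have h64 : ∀ i x, 64 ≤ phys E i x := fun i x => hE'.trans (le_phys _ _ _)
  have hpart : ∀ (s' : State) (i : ℕ) (v : Fin n), i < 32 → s'.reg i = v → s'.reg 5 = E →
      s'.reg 9 = j → RegLe (Z ^ 4) s' → s'.heap = s.heap →
      (partExp i).eval s' = I.f v ∧ (partExp i).Fits W s' := by
    intro s' i v hi hv h5' h9' hs' hh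
    have harr : s'.arr E 0 j = I.tb := by
      have := hok.1
      unfold State.arr at this ⊢
      rw [hh, this]
    have hf : (Exp.ar (.lit 0) (.reg 9)).Fits W s' := by
      refine Exp.fits_ar (show 0 ≤ W by omega) (hs'.fits hB (by omega)) ?_ (by omega)
      exact (phys_mono (E' := Z) (i' := Z) (x' := Z) (by omega) (by simp)
        (by simp; omega)).trans (phys_self_le hZ hW)
    refine ⟨?_, ⟨hf, hs'.fits hB hi, ?_⟩, ?_⟩
    · simp [partExp, h5', h9', harr, hv, hh, hok.2.1 v]
    · have := v.2
      simp [h5', h9', harr, hv]; omega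
    · simp [h5', h9', harr, hv]; omega
  refine WP.seq (WP.asg (4 * j + 1) (by simp [h9]) (by omega)
    ⟨⟨show 4 ≤ W by omega, hs.fits hB (by omega), ?_⟩, show 1 ≤ W by omega, ?_⟩ ?_)
  · simp [h9]; omega
  · simp [h9]; omega
  have hs₁ : Env E j Z (s.setReg 8 (4 * j + 1)) :=
    ⟨by simp [h5], by simp, hs.setReg (by omega)⟩
  set s₁ := (s.setReg 8 (4 * j + 1)).tick
    ((Exp.op .add (Exp.op .mul (.lit 4) (.reg 9)) (.lit 1)).cost + 1) with hs₁d
  obtain ⟨v₁, f₁⟩ := hpart s₁ 1 p.1.1 (by omega) (by simp [s₁, h1]) (by simp [s₁, h5])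
    (by simp [s₁, h9]) hs₁.2.2 rfl
  have hf₁ := (I.f p.1.1).2
  have hf₂ := (I.f p.1.2).2
  refine WP.seq (WP.asg _ v₁ (by omega) f₁ ?_)
  have hs₂ : Env E j Z (s₁.setReg 12 (I.f p.1.1)) := Env.setReg hs₁ (by omega)
  set s₂ := (s₁.setReg 12 (I.f p.1.1)).tick ((partExp 1).cost + 1) with hs₂d
  obtain ⟨v₂, f₂⟩ := hpart s₂ 2 p.1.2 (by omega) (by simp [s₂, s₁, h2]) (by simp [s₂, s₁, h5])
    (by simp [s₂, s₁, h9]) hs₂.2.2 rfl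
  refine WP.seq (WP.asg _ v₂ (by omega) f₂ ?_)
  have hs₃ : Env E j Z (s₂.setReg 13 (I.f p.1.2)) := Env.setReg hs₂ (by omega)
  set s₃ := (s₂.setReg 13 (I.f p.1.2)).tick ((partExp 2).cost + 1) with hs₃d
  have hs₃' : Env E j Z s₃ := hs₃
  have r12 : s₃.reg 12 = I.f p.1.1 := by simp [s₃, s₂]
  have r13 : s₃.reg 13 = I.f p.1.2 := by simp [s₃]
  have hreg : ∀ i, i < 12 → i ≠ 8 → s₃.reg i = s.reg i := fun i hi h8 => by
    simp [s₃, s₂, s₁, show i ≠ 12 by omega, show i ≠ 13 by omega, h8]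
  have htime : s₃.time ≤ s.time + 38 := by
    simp [s₃, s₂, s₁, Exp.cost, partExp, Exp.ar, Exp.addr, Exp.pair]
  have key : WP W g r (cond (.op .eq (.reg 12) (.reg 13)) skip (crossCom u))
      (CrossDone E j Z I.f G p m' (410 + 40 * cost) s₃) s₃ := by
    refine WP.cond ⟨hs₃'.2.2.fits hB (by omega), hs₃'.2.2.fits hB (by omega), ?_⟩
      (fun hne => WP.skip ?_) fun he => ?_
    · simp only [BinOp.eval_eq]
      split_ifs <;> omega
    · have heq : I.f p.1.1 = I.f p.1.2 := by
        have : (s₃.reg 12) = s₃.reg 13 := by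
          by_contra h
          simp [h] at hne
        rw [r12, r13] at this
        exact Fin.ext this
      unfold InstStep at hx
      rw [stepMove_of_eq heq] at hx
      obtain ⟨rfl, rfl⟩ := hx
      exact ⟨EdgeLists.toggle_of_eq hok.2.2.2 heq, Frame.refl, hok.2.2.1, fun _ _ => rfl,
        hs₃'.2.2, by simp [Exp.cost], rfl⟩
    · have hne : I.f p.1.1 ≠ I.f p.1.2 := fun h => by
        simp [r12, r13, h] at he
      refine (crossCom_wp (s := s₃.tick _) hu hZ hW hn hnZ hE hE' hj hs₃' hnp hm hr hx hne
        ((hreg 0 (by omega) (by omega)).trans h0) ((hreg 4 (by omega) (by omega)).trans h4)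
        ((hreg 10 (by omega) (by omega)).trans h10) r12 r13 hok.2.2.1 hok.2.2.2).mono
        fun s₄ h₄ => ?_
      obtain ⟨a₁, a₂, a₃, a₄, a₅, a₆, a₇⟩ := h₄
      refine ⟨a₁, a₂, a₃, a₄, a₅, a₆.trans ?_, a₇⟩
      simp [Exp.cost]; omega
  refine WP.seq (key.mono fun s₄ h₄ => ?_)
  obtain ⟨a₁, a₂, a₃, a₄, a₅, a₆, a₇⟩ := h₄
  have e₄ : Env E j Z s₄ := ⟨(a₄ 5 (by omega)).trans hs₃'.1, (a₄ 8 (by omega)).trans hs₃'.2.1, a₅⟩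
  have hm0 := hm' 0
  refine WP.seq (WP.asg (m' 0) ?_ (by omega) ⟨fits_addr_lit hZ hW hE hj e₄ (by omega), ?_⟩ ?_)
  · simp [e₄.1, e₄.2.1, a₃]
  · simpa [e₄.1] using h64 _ _
  have e₅ : Env E j Z (s₄.setReg 18 (m' 0)) := Env.setReg e₄ (by omega)
  set s₅ := (s₄.setReg 18 (m' 0)).tick ((Exp.ar (.reg 8) (.lit 0)).cost + 1) with hs₅d
  have e₅' : Env E j Z s₅ := e₅
  have r18 : s₅.reg 18 = m' 0 := by simp [s₅]
  have r11 : s₅.reg 11 = s.reg 11 := by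
    simp [s₅, a₄ 11 (by omega), hreg 11 (by omega) (by omega)]
  have r9 : s₅.reg 9 = j := by
    simp [s₅, a₄ 9 (by omega), hreg 9 (by omega) (by omega), h9]
  have r7 : s₅.reg 7 = s.reg 7 := by
    simp [s₅, a₄ 7 (by omega), hreg 7 (by omega) (by omega)]
  have hreg₅ : ∀ i, i < 11 → i ≠ 7 → i ≠ 8 → i ≠ 9 → s₅.reg i = s.reg i := fun i hi _ h8 _ => by
    simp [s₅, show i ≠ 18 by omega, a₄ i (by omega), hreg i (by omega) h8]
  have t₅ : s₅.time ≤ s.time + 460 + 40 * cost := by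
    simp [s₅, Exp.cost, Exp.ar, Exp.addr, Exp.pair]
    omega
  have ok₅ : InstOK E s₅ j I (toggle G p) m' := by
    refine ⟨?_, fun v => ?_, a₃, a₁⟩
    · change s₄.arr E 0 j = _
      rw [a₂.2 0 (by omega)]
      exact hok.1
    · change s₄.heap _ = _
      rw [a₂.1 _ (by omega)]
      exact hok.2.1 v
  have key₂ : WP W g r (cond (.op .lt (.reg 11) (.reg 18)) (.seq (asg 11 (.reg 18))
      (asg 7 (.reg 9))) skip) (fun s' => s'.heap = s₅.heap ∧
        (∀ i, i ≠ 11 → i ≠ 7 → s'.reg i = s₅.reg i) ∧ (s'.reg 11 = max (s.reg 11) (m' 0)) ∧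
        (s'.reg 7 = if s.reg 11 < m' 0 then j else s.reg 7) ∧ RegLe (Z ^ 4) s' ∧
        s'.time ≤ s₅.time + 20 ∧ s'.calls = s₅.calls) s₅ := by
    refine WP.cond ⟨e₅'.2.2.fits hB (by omega), e₅'.2.2.fits hB (by omega), ?_⟩
      (fun hne => ?_) fun he => WP.skip ?_
    · simp only [BinOp.eval_lt]
      split_ifs <;> omega
    · have hlt : s.reg 11 < m' 0 := by
        by_contra h
        simp [r11, r18, h] at hne
      refine WP.seq (WP.asg (m' 0) (by simp [r18]) (by omega) (e₅'.2.2.fits hB (by omega)) ?_)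
      have e₆ : Env E j Z (s₅.setReg 11 (m' 0)) := Env.setReg e₅' (by omega)
      refine WP.asg j (by simp [r9]) (by omega) (e₆.2.2.fits hB (by omega)) ?_
      refine ⟨rfl, fun i hi hi' => by simp [hi, hi'], ?_, by simp [hlt], ?_,
        by simp [Exp.cost], rfl⟩
      · simp [hlt.le]
      · exact e₆.2.2.setReg (by omega)
    · have hle : ¬ s.reg 11 < m' 0 := by
        intro h
        simp [r11, r18, h] at he
      exact ⟨rfl, fun _ _ _ => rfl, by simp [r11]; omega, by simp [hle, r7], e₅'.2.2,
        by simp [Exp.cost], rfl⟩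
  refine WP.seq (key₂.mono fun s₆ h₆ => ?_)
  obtain ⟨b₁, b₂, b₃, b₄, b₅, b₆, b₇⟩ := h₆
  have r9₆ : s₆.reg 9 = j := (b₂ 9 (by omega) (by omega)).trans r9
  refine WP.asg (j + 1) (by simp [r9₆]) (by omega)
    ⟨b₅.fits hB (by omega), show 1 ≤ W by omega, by simp [r9₆]; omega⟩ ?_
  have harr : ∀ i, s₆.arr E i = s₅.arr E i := fun i => by
    ext x; unfold State.arr; rw [b₁]
  refine ⟨?_, ?_, fun i h₁ h₂ h₃ h₄ => ?_, by simp, by simp [b₃], by simp [b₄],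
    b₅.setReg (by omega), ?_, ?_⟩
  · refine ⟨?_, ?_, ?_, ?_⟩
    · change s₆.arr E 0 j = _
      rw [harr]; exact ok₅.1
    · change ∀ v : Fin n, s₆.heap _ = _
      rw [b₁]; exact ok₅.2.1
    · change ∀ x, s₆.arr E _ x = _
      rw [harr]; exact ok₅.2.2.1
    · change EdgeLists _ _ (s₆.arr E _) (fun κ i => s₆.arr E _ (pr κ i)) (s₆.arr E _)
      rw [harr, harr, harr]; exact ok₅.2.2.2
  · refine ⟨fun y hy => ?_, fun i hi => ?_⟩
    · change s₆.heap y = _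
      rw [b₁]; exact a₂.1 y hy
    · change s₆.arr E i = _
      rw [harr]; exact a₂.2 i hi
  · simp only [State.tick_reg, State.setReg_reg, if_neg h₄]
    rw [b₂ i (by omega) h₂, hreg₅ i h₁ h₂ h₃ h₄]
  · simp [Exp.cost]; omega
  · change s₆.calls = _
    rw [b₇]; exact a₇

end Step

/-! ### The update of all instances -/

/-- The parameters of a run: start `E` of the arrays, number `N` of instances, instances, word sizes
of the simulated machines, a bound `Z` for the basic quantities. -/
structure Setup (n : ℕ) where
  E : ℕ
  N : ℕ
  inst : ℕ → Inst n
  word : ℕ → ℕ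
  Z : ℕ

/-- `Z` bounds the basic quantities and `Z ^ 20` all addresses; the last array number is 4N. A
positive number of instances guarantees that there is a best one. -/
structure Setup.Valid {n : ℕ} (S : Setup n) (W : ℕ) : Prop where
  ten_le : 10 ≤ S.Z
  pow_le : S.Z ^ 20 ≤ W
  n_le : n ≤ S.Z
  E_le : S.E ≤ S.Z
  le_E : 64 ≤ S.E
  N_pos : 0 < S.N
  N_le : 4 * S.N + 4 ≤ S.Z
  inst_valid : ∀ j < S.N, (S.inst j).Valid S.E
  np_le : ∀ j < S.N, (S.inst j).np ≤ S.word j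

/-- The state between two updates; `ms j` is the simulated memory of the instance `j`. -/
structure WorldOK {n : ℕ} (S : Setup n) (s : State) (G : SimpleGraph (Fin n)) (ms : ℕ → Mem) :
    Prop where
  reg4 : s.reg 4 = n * n
  reg5 : s.reg 5 = S.E
  reg6 : s.reg 6 = S.N
  regLe : RegLe (S.Z ^ 4) s
  inst : ∀ j < S.N, InstOK S.E s j (S.inst j) G (ms j)
  mem_le : ∀ j < S.N, ∀ y, ms j y ≤ S.word j
  best_lt : s.reg 7 < S.N
  best : ∀ j < S.N, ms j 0 ≤ ms (s.reg 7) 0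

section

variable {n W : ℕ} {S : Setup n} {g : Oracle n} {r : ℕ → Bool} {G : SimpleGraph (Fin n)}
  {p : Pair n} {s : State} {u : Com} {ms ms' : ℕ → Mem} {cost : ℕ → ℕ}
  {g₀ : ∀ j, Oracle (S.inst j).np} {r₀ : ℕ → ℕ → Bool}

open Classical in
/-- The invariant of the loop through the instances. -/
structure LoopInv (S : Setup n) (G : SimpleGraph (Fin n)) (p : Pair n) (ms ms' : ℕ → Mem)
    (cost : ℕ → ℕ) (s₀ : State) (j : ℕ) (s : State) : Prop where
  reg0 : s.reg 0 = if G.Adj p.1.1 p.1.2 then 0 else 1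
  reg1 : s.reg 1 = p.1.1
  reg2 : s.reg 2 = p.1.2
  reg4 : s.reg 4 = n * n
  reg5 : s.reg 5 = S.E
  reg6 : s.reg 6 = S.N
  reg9 : s.reg 9 = j
  reg10 : s.reg 10 = enc n p.1.1 p.1.2
  regLe : RegLe (S.Z ^ 4) s
  done : ∀ i < j, InstOK S.E s i (S.inst i) (toggle G p) (ms' i)
  todo : ∀ i, j ≤ i → i < S.N → InstOK S.E s i (S.inst i) G (ms i)
  best : (s.reg 7 = 0 ∧ s.reg 11 = 0) ∨ (s.reg 7 < j ∧ s.reg 11 = ms' (s.reg 7) 0)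
  le : ∀ i < j, ms' i 0 ≤ s.reg 11
  time : s.time ≤ s₀.time + 60 + ∑ i ∈ Finset.range j, (510 + 40 * cost i)
  calls : s.calls = s₀.calls

open Classical in
theorem updateCom_wp (hS : S.Valid W) (hu : ∀ j < S.N, SimData u (S.word j) S.Z)
    (hw : WorldOK S s G ms)
    (hm' : ∀ j < S.N, ∀ y, ms' j y ≤ S.word j)
    (hr : ∀ j < S.N, ∀ y, r (phys S.E (4 * j + 1) y) = r₀ j y)
    (hx : ∀ j < S.N, InstStep u (S.word j) (g₀ j) (r₀ j) (S.inst j).f G p (ms j) (ms' j) (cost j))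
    {s₁ : State} (h₁ : s₁ = ((s.setReg 0 (if G.Adj p.1.1 p.1.2 then 0 else 1)).setReg 1
      p.1.1).setReg 2 p.1.2) :
    WP W g r (updateCom u) (fun s' => WorldOK S s' (toggle G p) ms' ∧
      s'.reg 0 = ms' (s'.reg 7) 0 ∧ s'.calls = s.calls ∧
      s'.time ≤ s.time + 100 + ∑ i ∈ Finset.range S.N, (510 + 40 * cost i)) s₁ := by
  obtain ⟨hZ, hW, hn, hE, hE', hN, hNZ, hv, hnp⟩ := hS
  have hB : S.Z ^ 4 ≤ W := (pow_le_pow_of_ten_le hZ (by omega)).trans hW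
  have hZ4 : S.Z ≤ S.Z ^ 4 := Nat.le_self_pow (by omega) S.Z
  have hp1 := p.1.1.2
  have hp2 := p.1.2.2
  have hle₁ : RegLe (S.Z ^ 4) s₁ := by
    subst h₁
    refine ((hw.regLe.setReg ?_).setReg (by omega)).setReg (by omega)
    split_ifs <;> omega
  have hek : enc n p.1.1 p.1.2 ≤ S.Z ^ 4 := (enc_lt hp1 hp2).le.trans (two_mul_cube_le hZ hn)
  refine WP.seq (WP.asg (enc n p.1.1 p.1.2) ?_ (hek.trans hB)
    (fits_key hZ hW hle₁ (by omega) (by omega) (hle₁ 4 (by omega))) ?_)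
  · simp [Exp.eval_key, h₁, hw.reg4, enc]
  refine WP.seq (WP.asg 0 rfl (by omega) (Nat.zero_le _) ?_)
  refine WP.seq (WP.asg 0 rfl (by omega) (Nat.zero_le _) ?_)
  refine WP.seq (WP.asg 0 rfl (by omega) (Nat.zero_le _) ?_)
  refine WP.seq (WP.whl S.N (LoopInv S G p ms ms' cost s) ?_ ?_ ?_ ?_)
  · intro j hj s' h
    refine ⟨⟨h.regLe.fits hB (by omega), h.regLe.fits hB (by omega), ?_⟩, ?_⟩
    · simp only [BinOp.eval_lt]; split_ifs <;> omega
    · simp [h.reg9, h.reg6]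
  · subst h₁
    refine ⟨by simp, by simp, by simp, by simp [hw.reg4], by simp [hw.reg5], by simp [hw.reg6],
      by simp, by simp, ?_, fun i hi => absurd hi (Nat.not_lt_zero _), fun i _ hi => hw.inst i hi,
      Or.inl ⟨by simp, by simp⟩, fun i hi => absurd hi (Nat.not_lt_zero _), ?_, rfl⟩
    · refine RegLe.tick (RegLe.tick (RegLe.setReg (RegLe.tick (RegLe.setReg (RegLe.tick
        (RegLe.setReg (RegLe.tick (RegLe.setReg hle₁ hek)) ?_)) ?_)) ?_)) <;> exact Nat.zero_le _
    · simp [Exp.cost, Exp.key]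
  · intro j hj s' h
    refine (instCom_wp (I := S.inst j) (hv j hj) (hu j hj) hZ hW hn hE hE' (by omega) h.regLe
      (hnp j hj) (hw.mem_le j hj) (hm' j hj) (hr j hj) (hx j hj) h.reg0 h.reg1 h.reg2 h.reg4 h.reg5
      h.reg9 h.reg10 (h.todo j le_rfl hj)).mono fun s'' h'' => ?_
    obtain ⟨a₁, a₂, a₃, a₄, a₅, a₆, a₇, a₈, a₉⟩ := h''
    refine ⟨?_, ?_, ?_, ?_, ?_, ?_, a₄, ?_, a₇, ?_, ?_, ?_, ?_, ?_, a₉.trans h.calls⟩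
    · exact (a₃ 0 (by omega) (by omega) (by omega) (by omega)).trans h.reg0
    · exact (a₃ 1 (by omega) (by omega) (by omega) (by omega)).trans h.reg1
    · exact (a₃ 2 (by omega) (by omega) (by omega) (by omega)).trans h.reg2
    · exact (a₃ 4 (by omega) (by omega) (by omega) (by omega)).trans h.reg4
    · exact (a₃ 5 (by omega) (by omega) (by omega) (by omega)).trans h.reg5
    · exact (a₃ 6 (by omega) (by omega) (by omega) (by omega)).trans h.reg6
    · exact (a₃ 10 (by omega) (by omega) (by omega) (by omega)).trans h.reg10
    · intro i hi
      by_cases hij : i = j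
      · subst hij; exact a₁
      · exact (h.done i (by omega)).frame (hv i (by omega)) a₂ hij
    · intro i hi hiN
      exact (h.todo i (by omega) hiN).frame (hv i hiN) a₂ (by omega)
    · change (s''.reg 7 = 0 ∧ s''.reg 11 = 0) ∨ (s''.reg 7 < j + 1 ∧ s''.reg 11 = ms' (s''.reg 7) 0)
      rw [a₅, a₆]
      split_ifs with hlt
      · exact Or.inr ⟨by omega, max_eq_right hlt.le⟩
      · rw [max_eq_left (by omega)]
        rcases h.best with hb | hb
        · exact Or.inl hb
        · exact Or.inr ⟨by omega, hb.2⟩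
    · intro i hi
      change _ ≤ s''.reg 11
      rw [a₅]
      by_cases hij : i = j
      · subst hij; exact le_max_right _ _
      · exact (h.le i (by omega)).trans (le_max_left _ _)
    · rw [Finset.sum_range_succ]
      have := h.time
      simp [Exp.cost]; omega
  · intro s' h
    refine WP.asg (s'.reg 11) rfl ((h.regLe 11 (by omega)).trans hB) (h.regLe.fits hB (by omega)) ?_
    have hbest : s'.reg 7 < S.N ∧ s'.reg 11 = ms' (s'.reg 7) 0 := by
      -- The maximum is updated only on strict improvement over 0. Without any, all matchings are
      -- empty and the default, instance 0, is a best one.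
      rcases h.best with ⟨h7, h11⟩ | ⟨h7, h11⟩
      · have := h.le 0 hN
        exact ⟨by omega, by rw [h7]; omega⟩
      · exact ⟨h7, h11⟩
    refine ⟨⟨by simp [h.reg4], by simp [h.reg5], by simp [h.reg6], ?_, h.done, hm', ?_, ?_⟩, ?_,
      h.calls, ?_⟩
    · exact h.regLe.setReg (h.regLe 11 (by omega))
    · simpa using hbest.1
    · intro j hj
      simp only [State.tick_reg, State.setReg_reg]
      rw [if_neg (by omega), ← hbest.2]
      exact h.le j hj
    · simpa using hbest.2
    · have := h.time
      simp [Exp.cost]; omega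

end

/-! ### Queries -/

-- On entry register 0 holds the queried vertex v, register 12 its part, and register 13 the partner
-- part plus one. The head {u, w} of the list for these parts yields u + w and uw. The candidate u +
-- w - v is the partner iff v(u + w - v) = uw; otherwise v is not an end of the representative, and
-- unmatched.
open Exp in
def decodeCom : Com :=
  .seq (asg 13 (op .sub (reg 13) (lit 1))) <|
  .seq (asg 14 (key (reg 12) (reg 13))) <|
  .seq (asg 16 (lit 0)) <|
  .seq (asg 15 (ld (itemAddr (reg 14) (reg 16)))) <|
  .seq (asg 16 (op .div (reg 15) (reg 4))) <|
  .seq (asg 17 (op .mod (reg 15) (reg 4))) <|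
  cond (op .lt (reg 16) (reg 0)) (asg 0 (lit 0)) <|
  .seq (asg 16 (op .sub (reg 16) (reg 0))) <|
  cond (op .eq (op .mul (reg 0) (reg 16)) (reg 17)) (asg 0 (op .add (reg 16) (lit 1)))
    (asg 0 (lit 0))

-- The simulated query may overwrite the memory of the best copy, because the memory after a query
-- is discarded.
open Exp in
def mateCom (q : Com) : Com :=
  .seq (asg 9 (reg 7)) <|
  .seq (asg 8 (op .add (op .mul (lit 4) (reg 9)) (lit 1))) <|
  .seq (asg 12 (partExp 0)) <|
  .seq (wr (addr (reg 8) (lit 0)) (reg 12)) <|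
  .seq (sim q) <|
  .seq (asg 13 (ar (reg 8) (lit 0))) <|
  cond (reg 13) decodeCom (asg 0 (lit 0))

section

variable {n np W Z E j : ℕ} {g : Oracle n} {r : ℕ → Bool} {f : Fin n → Fin np}
  {G : SimpleGraph (Fin n)} {s : State}

theorem decodeCom_wp (hZ : 10 ≤ Z) (hW : Z ^ 20 ≤ W) (hn : np ≤ n) (hnZ : n ≤ Z)
    (hE : E ≤ Z) (hE' : 64 ≤ E) (hj : 4 * j + 4 ≤ Z) (hs : Env E j Z s) {v u w : Fin n}
    {a b : Fin np} (h0 : s.reg 0 = v) (h4 : s.reg 4 = n * n) (h12 : s.reg 12 = a)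
    (h13 : s.reg 13 = b + 1) (hi : s.arr E (4 * j + 3) (pr (enc n a b) 0) = enc n u w) :
    WP W g r decodeCom (fun s' => s'.time ≤ s.time + 200 ∧
      ((v = u ∧ s'.reg 0 = w + 1) ∨ (v = w ∧ s'.reg 0 = u + 1) ∨
        (v ≠ u ∧ v ≠ w ∧ s'.reg 0 = 0))) s := by
  have hB : Z ^ 4 ≤ W := (pow_le_pow_of_ten_le hZ (by omega)).trans hW
  have hB9 : Z ^ 9 ≤ W := (pow_le_pow_of_ten_le hZ (by omega)).trans hW
  have hZ4 : Z ≤ Z ^ 4 := Nat.le_self_pow (by omega) Z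
  have h2Z : 2 * Z ≤ Z ^ 4 := by
    have h₁ : 2 * Z ^ 1 ≤ Z ^ 2 := mul_pow_le (by omega)
    have h₂ : Z ^ 2 ≤ Z ^ 4 := pow_le_pow_of_ten_le hZ (by omega)
    rw [pow_one] at h₁
    omega
  have ha' := a.2
  have hb' := b.2
  have hu' := u.2
  have hw' := w.2
  have hv' := v.2
  have hc := two_mul_cube_le hZ hnZ
  have hκ : enc n a b ≤ Z ^ 4 := (enc_lt (by omega) (by omega)).le.trans hc
  have he : enc n u w ≤ Z ^ 4 := (enc_lt hu' hw').le.trans hc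
  have hnn : n * n ≤ Z ^ 4 := by
    rw [← h4]; exact hs.2.2 4 (by omega)
  have hpp : (u : ℕ) * w < n * n := Nat.mul_lt_mul'' hu' hw'
  refine WP.seq (WP.asg b (by simp [h13]) (by omega)
    ⟨hs.2.2.fits hB (by omega), show 1 ≤ W by omega, by simp [h13]; omega⟩ ?_)
  have hs₁ : Env E j Z (s.setReg 13 b) := hs.setReg (by omega)
  refine WP.seq (WP.asg (enc n a b) ?_ (hκ.trans hB) (fits_key hZ hW hs₁.2.2 (by omega) (by omega)
    (hs₁.2.2 4 (by omega))) ?_)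
  · simp [Exp.eval_key, h4, h12, enc]
  have hs₂ : Env E j Z ((s.setReg 13 b).setReg 14 (enc n a b)) := hs₁.setReg hκ
  refine WP.seq (WP.asg 0 rfl (by omega) (Nat.zero_le _) ?_)
  have hs₃ : Env E j Z (((s.setReg 13 b).setReg 14 (enc n a b)).setReg 16 0) :=
    hs₂.setReg (Nat.zero_le _)
  refine WP.seq (WP.asg (enc n u w) ?_ (he.trans hB)
    ⟨fits_itemAddr hZ hW hE hj hs₃ (by omega) (by omega), ?_⟩ ?_)
  · rw [← hi]
    simp [Exp.eval_itemAddr, hs.1, hs.2.1, State.arr]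
  · have : 64 ≤ phys E (4 * j + 1 + 2) (pr (enc n a b) 0) := hE'.trans (le_phys _ _ _)
    simpa [hs.1, hs.2.1, Exp.eval_itemAddr] using this
  have hs₄ : Env E j Z ((((s.setReg 13 b).setReg 14 (enc n a b)).setReg 16 0).setReg 15
    (enc n u w)) := hs₃.setReg he
  refine WP.seq (WP.asg (u + w) ?_ (by omega)
    ⟨hs₄.2.2.fits hB (by omega), hs₄.2.2.fits hB (by omega), ?_⟩ ?_)
  · simp [h4, enc_div hu' hw']
  · simp [h4, enc_div hu' hw']; omega
  have hs₅ : Env E j Z (((((s.setReg 13 b).setReg 14 (enc n a b)).setReg 16 0).setReg 15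
    (enc n u w)).setReg 16 (u + w)) := hs₄.setReg (by omega)
  refine WP.seq (WP.asg (u * w) ?_ (by omega)
    ⟨hs₅.2.2.fits hB (by omega), hs₅.2.2.fits hB (by omega), ?_⟩ ?_)
  · simp [h4, enc_mod hu' hw']
  · simp [h4, enc_mod hu' hw']; omega
  have hs₆ := hs₅.setReg (i := 17) (v := u * w) (by omega)
  refine WP.cond ⟨hs₆.2.2.fits hB (by omega), hs₆.2.2.fits hB (by omega), ?_⟩
    (fun hne => ?_) fun hz => ?_
  · simp only [BinOp.eval_lt]; split_ifs <;> omega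
  · refine WP.asg 0 rfl (by omega) (Nat.zero_le _) ?_
    have hlt : (u : ℕ) + w < v := by
      by_contra h
      simp [h0, h] at hne
    refine ⟨by simp [Exp.cost, Exp.key, Exp.itemAddr, Exp.addr, Exp.pair], Or.inr (Or.inr
      ⟨?_, ?_, by simp⟩)⟩ <;> (rintro rfl; omega)
  · have hle : (v : ℕ) ≤ u + w := by
      by_contra h
      simp [h0, h] at hz
    refine WP.seq (WP.asg (u + w - v) (by simp [h0]) (by omega)
      ⟨hs₆.2.2.fits hB (by omega), hs₆.2.2.fits hB (by omega), by simp [h0]; omega⟩ ?_)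
    have hs₇ := hs₆.setReg (i := 16) (v := u + w - v) (by omega)
    refine WP.cond ⟨⟨hs₇.2.2.fits hB (by omega), hs₇.2.2.fits hB (by omega), ?_⟩,
      hs₇.2.2.fits hB (by omega), ?_⟩ (fun hne => ?_) fun hz => ?_
    · have : (v : ℕ) * (u + w - v) ≤ Z ^ 4 * Z ^ 4 := Nat.mul_le_mul (by omega) (by omega)
      have h8 : Z ^ 8 = Z ^ 4 * Z ^ 4 := by rw [← pow_add]
      have h9 : Z ^ 8 ≤ Z ^ 9 := pow_le_pow_of_ten_le hZ (by omega)
      simp [h0]; omega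
    · simp only [BinOp.eval_eq]; split_ifs <;> omega
    · refine WP.asg (u + w - v + 1) (by simp) (by omega)
        ⟨hs₇.2.2.fits hB (by omega), show 1 ≤ W by omega, by simp; omega⟩ ?_
      have heq : (v : ℕ) * (u + w - v) = u * w := by
        by_contra h
        simp [h0, h] at hne
      refine ⟨by simp [Exp.cost, Exp.key, Exp.itemAddr, Exp.addr, Exp.pair], ?_⟩
      rcases mul_sub_eq_iff.1 ⟨hle, heq⟩ with h | h
      · exact Or.inl ⟨Fin.ext h, by simp; omega⟩
      · exact Or.inr (Or.inl ⟨Fin.ext h, by simp; omega⟩)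
    · refine WP.asg 0 rfl (by omega) (Nat.zero_le _) ?_
      have heq : (v : ℕ) * (u + w - v) ≠ u * w := by
        intro h
        simp [h0, h] at hz
      have hnot : ¬ ((v : ℕ) = u ∨ (v : ℕ) = w) := fun h => heq (mul_sub_eq_iff.2 h).2
      refine ⟨by simp [Exp.cost, Exp.key, Exp.itemAddr, Exp.addr, Exp.pair], Or.inr (Or.inr
        ⟨?_, ?_, by simp⟩)⟩ <;> (rintro rfl; simp at hnot)

end

/-- `R` stands for correctness of the answer, so that the program is verified without reference to
the matching: the copy reports either no partner part or a part `b`, whose list with the part of `v`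
has head {u, w}. -/
theorem mateCom_wp {n W n₀ : ℕ} {S : Setup n} {g : Oracle n} {g₀ : Oracle n₀} {r r₀ : ℕ → Bool}
    {G : SimpleGraph (Fin n)} {s : State} {q : Com} {ms : ℕ → Mem} (hS : S.Valid W)
    (hw : WorldOK S s G ms) {j : ℕ} (hj7 : s.reg 7 = j) (hq : SimData q (S.word j) S.Z)
    (hr : ∀ y, r (phys S.E (4 * j + 1) y) = r₀ y)
    {v : Fin n} {m' : Mem} {t : ℕ} {l : List ℕ}
    (hx : Exec (S.word j) g₀ r₀ q (Function.update (ms j) 0 ((S.inst j).f v)) m' t l) (R : ℕ → Prop)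
    (hR : (m' 0 = 0 ∧ R 0) ∨ ∃ (b : Fin (S.inst j).np) (u w : Fin n), m' 0 = b + 1 ∧
      s.arr S.E (4 * j + 3) (pr (enc n ((S.inst j).f v) b) 0) = enc n u w ∧
      (v = u → R (w + 1)) ∧ (v = w → R (u + 1)) ∧ (v ≠ u → v ≠ w → R 0)) :
    WP W g r (mateCom q) (fun s' => R (s'.reg 0) ∧ s'.time ≤ s.time + 400 + 40 * t)
      (s.setReg 0 v) := by
  obtain ⟨hZ, hW, hn, hE, hE', hN, hNZ, hv, hnp⟩ := hS
  have hB : S.Z ^ 4 ≤ W := (pow_le_pow_of_ten_le hZ (by omega)).trans hW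
  have hZ4 : S.Z ≤ S.Z ^ 4 := Nat.le_self_pow (by omega) S.Z
  have hj : j < S.N := hj7 ▸ hw.best_lt
  obtain ⟨hnpn, htb, htE⟩ := hv j hj
  have hok := hw.inst j hj
  have hvn := v.2
  have hf := ((S.inst j).f v).2
  have hnpj := hnp j hj
  have h64 : ∀ i x, 64 ≤ phys S.E i x := fun i x => hE'.trans (le_phys _ _ _)
  have hle₁ : RegLe (S.Z ^ 4) (s.setReg 0 v) := hw.regLe.setReg (by omega)
  refine WP.seq (WP.asg j (by simp [hj7]) (by omega) (hle₁.fits hB (by omega)) ?_)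
  have hle₂ : RegLe (S.Z ^ 4) ((s.setReg 0 v).setReg 9 j) := hle₁.setReg (by omega)
  refine WP.seq (WP.asg (4 * j + 1) (by simp) (by omega)
    ⟨⟨show 4 ≤ W by omega, hle₂.fits hB (by omega), ?_⟩, show 1 ≤ W by omega, ?_⟩ ?_)
  · simp; omega
  · simp; omega
  have e₃ : Env S.E j S.Z (((s.setReg 0 v).setReg 9 j).setReg 8 (4 * j + 1)) :=
    ⟨by simp [hw.reg5], by simp, hle₂.setReg (by omega)⟩
  refine WP.seq (WP.asg ((S.inst j).f v) ?_ (by omega) ⟨⟨Exp.fits_ar (show 0 ≤ W by omega)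
    (e₃.2.2.fits hB (by omega)) ?_ ?_, e₃.2.2.fits hB (by omega), ?_⟩, ?_⟩ ?_)
  · simp [partExp, hw.reg5, hok.1, hok.2.1 v]
  · exact (phys_mono (E' := S.Z) (i' := S.Z) (x' := S.Z) (by simp [hw.reg5]; omega) (by simp)
        (by simp; omega)).trans (phys_self_le hZ hW)
  · simp [hw.reg5]; omega
  · simp [hw.reg5, hok.1]; omega
  · simp [hw.reg5, hok.1]; omega
  have e₄ : Env S.E j S.Z ((((s.setReg 0 v).setReg 9 j).setReg 8 (4 * j + 1)).setReg 12
    ((S.inst j).f v)) := e₃.setReg (by omega)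
  refine WP.seq (WP.wr (phys S.E (4 * j + 1) 0) ((S.inst j).f v) (by simp [hw.reg5]) (by simp)
    (h64 _ _) (fits_addr_lit hZ hW hE (by omega) e₄ (by omega)) (e₄.2.2.fits hB (by omega)) ?_)
  set t₁ := (Exp.reg 7).cost + 1
  set t₂ := (Exp.op .add (Exp.op .mul (.lit 4) (.reg 9)) (.lit 1)).cost + 1
  set t₃ := (partExp 0).cost + 1
  set t₄ := (Exp.addr (.reg 8) (.lit 0)).cost + (Exp.reg 12).cost + 1
  set s₄ := (((((((s.setReg 0 v).setReg 9 j).tick t₁).setReg 8 (4 * j + 1)).tick t₂).setReg 12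
    ((S.inst j).f v)).tick t₃) with hs₄
  have h₅ := Simulated.write (E := S.E) (i := 4 * j + 1) (s := s₄) 0 ((S.inst j).f v) t₄ hok.2.2.1
  have hmem : ∀ y, Function.update (ms j) 0 (((S.inst j).f v : ℕ)) y ≤ S.word j := fun y => by
    rw [Function.update_apply]
    split
    · omega
    · exact hw.mem_le j hj y
  refine WP.seq ((sim_wp hx hq.callFree hq.cellBound hq.one_le hmem hq.le (phys_self_le hZ hW) hE'
    hE (by omega) hr _ (by exact e₄.1) (by exact e₄.2.1) h₅.2.1).mono fun s₆ h₆' => ?_)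
  have h₆ := h₅.trans h₆'
  have e₆ : Env S.E j S.Z s₆ := by unfold Env RegLe; rw [h₆.1]; exact e₄
  have hm0 : m' 0 ≤ S.word j := hx.le_word hq.callFree hq.one_le hmem 0
  have hqle := hq.le
  refine WP.seq (WP.asg (m' 0) ?_ (by omega)
    ⟨fits_addr_lit hZ hW hE (by omega) e₆ (by omega), ?_⟩ ?_)
  · simp [e₆.1, e₆.2.1, h₆.2.1]
  · simpa [e₆.1] using h64 _ _
  have e₇ : Env S.E j S.Z (s₆.setReg 13 (m' 0)) := e₆.setReg (by omega)
  have ht₆ : s₆.time ≤ s.time + 50 + 40 * t := by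
    refine h₆.2.2.2.1.trans ?_
    simp [s₄, t₁, t₂, t₃, t₄, Exp.cost, partExp, Exp.ar, Exp.addr, Exp.pair]
    omega
  refine WP.cond (e₇.2.2.fits hB (by omega)) (fun hne => ?_) fun hz => ?_
  · rcases hR with ⟨h0, -⟩ | ⟨b, u, w, hb, hi, hR₁, hR₂, hR₃⟩
    · exact absurd (by simpa using h0) hne
    refine (decodeCom_wp (np := (S.inst j).np) (j := j) (a := (S.inst j).f v) (b := b) (u := u)
        (w := w)
      (v := v) hZ hW hnpn hn hE hE' (by omega) (by exact e₇) ?_ ?_ ?_ ?_ ?_).mono fun s₈ h₈ => ?_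
    · simp [h₆.1, s₄]
    · simp [h₆.1, s₄, hw.reg4]
    · simp [h₆.1, s₄]
    · simp [hb]
    · rw [← hi]
      change s₆.arr S.E _ _ = _
      rw [arr_of_simulated h₆ (by omega)]
      rfl
    · refine ⟨?_, ?_⟩
      · rcases h₈.2 with ⟨h, h'⟩ | ⟨h, h'⟩ | ⟨h, h', h''⟩
        · rw [h']; exact hR₁ h
        · rw [h']; exact hR₂ h
        · rw [h'']; exact hR₃ h h'
      · refine h₈.1.trans ?_
        simp [Exp.cost, Exp.ar, Exp.addr, Exp.pair]
        omega
  · have h0 : m' 0 = 0 := by simpa using hz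
    rcases hR with ⟨-, hR⟩ | ⟨b, u, w, hb, -⟩
    · refine WP.asg 0 rfl (by omega) (Nat.zero_le _) ⟨by simpa using hR, ?_⟩
      simp [Exp.cost, Exp.ar, Exp.addr, Exp.pair]
      omega
    · omega

/-! ### The scales -/

/-- The matching sizes for which the generator is called: they grow by a factor `1 + 1 / c`. -/
def scale (c : ℕ) : ℕ → ℕ
  | 0 => 1
  -- The extra 1 forces growth at small scales and makes up for the rounding; integers below the new
  -- scale are still at most k + k/c for the old scale k.
  | t + 1 => scale c t + 1 + scale c t / c

theorem scale_lt_succ (c t : ℕ) : scale c t < scale c (t + 1) := by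
  exact Nat.lt_of_lt_of_le (Nat.lt_succ_self _) (Nat.le_add_right _ _)

theorem scale_strictMono (c : ℕ) : StrictMono (scale c) :=
  strictMono_nat_of_lt_succ (scale_lt_succ c)

theorem succ_le_scale (c t : ℕ) : t + 1 ≤ scale c t := by
  induction t with
  | zero => exact le_rfl
  | succ t ih => have := scale_lt_succ c t; omega

theorem exists_lt_scale (n c : ℕ) : ∃ t, n < 2 * scale c t :=
  ⟨n, by have := succ_le_scale c n; omega⟩

/-- The number of scales `k` with `2 k ≤ n`. -/
noncomputable def numScales (n c : ℕ) : ℕ := Nat.find (exists_lt_scale n c)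

theorem lt_numScales {n c t : ℕ} : t < numScales n c ↔ 2 * scale c t ≤ n := by
  constructor
  · intro h
    have := Nat.find_min (exists_lt_scale n c) h
    omega
  · intro h
    by_contra hge
    have h₁ := Nat.find_spec (exists_lt_scale n c)
    have h₂ := (scale_strictMono c).monotone (not_lt.1 hge)
    unfold numScales at h₂
    omega

theorem scale_le {n c t : ℕ} (h : t ≤ numScales n c) : scale c t ≤ n + 1 := by
  cases t with
  | zero => simp [scale]
  | succ t =>
    have h₁ := lt_numScales.1 (Nat.lt_of_succ_le h)
    have h₂ := Nat.div_le_self (scale c t) c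
    rw [scale]
    omega

/-! ### The heap image of the generator's answers -/

section Layout

variable {n : ℕ} (g : Oracle n) (c : ℕ)

/-- The addresses at which the answers of the generator are written. -/
def famAddr : ℕ → ℕ
  | 0 => 64 + n
  | t + 1 => famAddr t + 2 + (g (scale c t)).num * n

theorem famAddr_mono : Monotone (famAddr g c) :=
  monotone_nat_of_le_succ fun t => by rw [famAddr]; omega

theorem le_famAddr (t : ℕ) : 64 + n ≤ famAddr g c t := famAddr_mono g c (Nat.zero_le t)

/-- The heap contains the identity table and the first `T` answers of the generator. -/
structure Layout (T : ℕ) (H : ℕ → ℕ) : Prop where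
  ident : ∀ i < n, H (64 + i) = i
  num : ∀ t < T, H (famAddr g c t) = (g (scale c t)).num
  parts : ∀ t < T, H (famAddr g c t + 1) = (g (scale c t)).parts
  part : ∀ t < T, ∀ (i : Fin (g (scale c t)).num) (v : Fin n),
    H (famAddr g c t + 2 + i * n + v) = (g (scale c t)).part i v

variable {g c}

theorem Layout.congr {T : ℕ} {H H' : ℕ → ℕ} (h : Layout g c T H)
    (hH : ∀ y < famAddr g c T, H' y = H y) : Layout g c T H' := by
  have hT : ∀ t < T, famAddr g c t + 2 + (g (scale c t)).num * n ≤ famAddr g c T := fun t ht =>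
    famAddr_mono g c (Nat.succ_le_of_lt ht)
  refine ⟨fun i hi => ?_, fun t ht => ?_, fun t ht => ?_, fun t ht i v => ?_⟩
  · rw [hH _ (by have := le_famAddr g c T; omega)]; exact h.ident i hi
  · rw [hH _ (by have := hT t ht; omega)]; exact h.num t ht
  · rw [hH _ (by have := hT t ht; omega)]; exact h.parts t ht
  · rw [hH]
    · exact h.part t ht i v
    · have h₁ := hT t ht
      have h₂ : (i + 1) * n ≤ (g (scale c t)).num * n := Nat.mul_le_mul_right _ i.2
      have h₃ := v.2
      rw [Nat.add_mul] at h₂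
      omega

theorem Family.write_lt {F : Family n} {b y : ℕ} {m : Mem} (h : y < b) : F.write b m y = m y := by
  unfold Family.write
  rw [if_neg (by omega), if_neg (by omega), dif_neg (by omega)]

theorem Family.write_ge {F : Family n} {b y : ℕ} {m : Mem} (hn : 0 < n)
    (h : b + 2 + F.num * n ≤ y) : F.write b m y = m y := by
  unfold Family.write
  rw [if_neg (by omega), if_neg (by omega), dif_neg]
  rintro ⟨-, h₁, -⟩
  rw [Nat.div_lt_iff_lt_mul hn] at h₁
  omega

theorem Family.write_part (F : Family n) (b : ℕ) (m : Mem) (i : Fin F.num) (v : Fin n) :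
    F.write b m (b + 2 + i * n + v) = F.part i v := by
  have hn : 0 < n := (Nat.zero_le _).trans_lt v.2
  have h₁ : b + 2 + (i : ℕ) * n + v - (b + 2) = v + i * n := by omega
  have h₂ : ((v : ℕ) + i * n) / n = i := by
    rw [Nat.add_mul_div_right _ _ hn, Nat.div_eq_of_lt v.2, Nat.zero_add]
  have h₃ : ((v : ℕ) + i * n) % n = v := by rw [Nat.add_mul_mod_self_right, Nat.mod_eq_of_lt v.2]
  unfold Family.write
  simp only [h₁, h₂, h₃]
  rw [if_neg (by omega), if_neg (by omega), dif_pos ⟨by omega, i.2, v.2⟩]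

theorem Layout.write {T : ℕ} {H : ℕ → ℕ} (h : Layout g c T H) :
    Layout g c (T + 1) ((g (scale c T)).write (famAddr g c T) H) := by
  have h' : Layout g c T ((g (scale c T)).write (famAddr g c T) H) :=
    h.congr fun y hy => Family.write_lt hy
  refine ⟨h'.ident, fun t ht => ?_, fun t ht => ?_, fun t ht => ?_⟩
  · rcases Nat.lt_succ_iff_lt_or_eq.1 ht with ht | rfl
    · exact h'.num t ht
    · simp [Family.write]
  · rcases Nat.lt_succ_iff_lt_or_eq.1 ht with ht | rfl
    · exact h'.parts t ht
    · simp [Family.write]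
  · rcases Nat.lt_succ_iff_lt_or_eq.1 ht with ht | rfl
    · exact h'.part t ht
    · exact Family.write_part _ _ _

end Layout

/-! ### Calling the generator

Further registers: `20` holds the parameter `c` of the scales, `21` the current scale, `22` the
current address. -/

open Exp in
def moreScales : Exp := op .lt (op .mul (lit 2) (reg 21)) (op .add (reg 3) (lit 1))

-- The first cell of a written answer is its number of partitions, which determines where the answer
-- ends.
open Exp in
def nextAddr : Exp := op .add (op .add (reg 22) (lit 2)) (op .mul (ld (reg 22)) (reg 3))

open Exp in
def nextScale : Exp := op .add (op .add (reg 21) (lit 1)) (op .div (reg 21) (reg 20))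

open Exp in
/-- Write the identity table and call the generator for all scales. -/
def genCom (c₁ : ℕ) : Com :=
  .seq (asg 3 (reg 0)) <|
  .seq (asg 4 (op .mul (reg 3) (reg 3))) <|
  .seq (asg 20 (op .mul (lit c₁) (reg 1))) <|
  .seq (asg 9 (lit 0)) <|
  .seq (whl (op .lt (reg 9) (reg 3))
    (.seq (wr (op .add (lit 64) (reg 9)) (reg 9)) (asg 9 (op .add (reg 9) (lit 1))))) <|
  .seq (asg 22 (op .add (lit 64) (reg 3))) <|
  .seq (asg 21 (lit 1)) <|
  .seq (whl moreScales
    (.seq (call (reg 21) (reg 22)) (.seq (asg 22 nextAddr) (asg 21 nextScale)))) <|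
  asg 5 (reg 22)

section

variable {n W Z c : ℕ} {g : Oracle n} {r : ℕ → Bool} {s : State}

/-- Bounds for the preprocessing. -/
structure GenBounds (g : Oracle n) (c Z W : ℕ) : Prop where
  ten_le : 64 ≤ Z
  pow_le : Z ^ 20 ≤ W
  n_le : n ≤ Z
  c_le : c ≤ Z
  addr_le : famAddr g c (numScales n c) ≤ Z
  parts_le : ∀ t < numScales n c, (g (scale c t)).parts ≤ Z

theorem GenBounds.le_pow {g : Oracle n} (h : GenBounds g c Z W) :
    10 * Z ≤ Z ^ 4 ∧ n * n ≤ Z ^ 4 ∧ Z ^ 4 + 10 ≤ W ∧ 2 * Z ^ 4 ≤ W := by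
  have h₁ : 10 * Z ^ 1 ≤ Z ^ 2 := mul_pow_le (by have := h.ten_le; omega)
  have h₂ : Z ^ 2 ≤ Z ^ 4 := Nat.pow_le_pow_right (by have := h.ten_le; omega) (by omega)
  have h₃ : n * n ≤ Z * Z := Nat.mul_le_mul h.n_le h.n_le
  have h₄ : 20 * Z ^ 4 ≤ Z ^ 5 := mul_pow_le (by have := h.ten_le; omega)
  have h₅ : Z ^ 5 ≤ Z ^ 20 := Nat.pow_le_pow_right (by have := h.ten_le; omega) (by omega)
  have h₆ := h.pow_le
  have h₇ : 1 ≤ Z ^ 4 := Nat.one_le_pow _ _ (by have := h.ten_le; omega)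
  rw [pow_one] at h₁
  rw [sq] at h₁ h₂
  omega

/-- The registers during the preprocessing. -/
structure ScaleRegs (n c Z : ℕ) (g : Oracle n) (t : ℕ) (s : State) : Prop where
  reg3 : s.reg 3 = n
  reg4 : s.reg 4 = n * n
  reg20 : s.reg 20 = c
  reg21 : s.reg 21 = scale c t
  reg22 : s.reg 22 = famAddr g c t
  regLe : RegLe (Z ^ 4) s

theorem ScaleRegs.moreScales {t : ℕ} (h : ScaleRegs n c Z g t s) (hb : GenBounds g c Z W)
    (ht : t ≤ numScales n c) :
    moreScales.Fits W s ∧ (moreScales.eval s ≠ 0 ↔ t < numScales n c) := by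
  have hp := hb.le_pow
  have h₁ := hb.n_le
  have h₂ := scale_le ht
  have h₃ := hb.ten_le
  refine ⟨⟨⟨show 2 ≤ W by omega, h.regLe.fits (by omega) (by omega), ?_⟩,
    ⟨h.regLe.fits (by omega) (by omega), show 1 ≤ W by omega, ?_⟩, ?_⟩, ?_⟩
  · simp [h.reg21]; omega
  · simp [h.reg3]; omega
  · simp only [BinOp.eval_lt]; split_ifs <;> omega
  · rw [lt_numScales]
    simp [DynMatching.moreScales, h.reg21, h.reg3]

/-- The preprocessing runs twice through the scales, once to call the generator and once to start
the copies. Both loops end with this code, hence the general postcondition. -/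
theorem ScaleRegs.advance {t : ℕ} {Q : State → Prop} (h : ScaleRegs n c Z g t s)
    (hb : GenBounds g c Z W) (ht : t < numScales n c)
    (hh : s.heap (famAddr g c t) = (g (scale c t)).num)
    (hQ : ∀ s' : State, ScaleRegs n c Z g (t + 1) s' → s'.heap = s.heap → s'.calls = s.calls →
      (∀ i, i ≠ 21 → i ≠ 22 → s'.reg i = s.reg i) → Q s') :
    WP W g r (.seq (asg 22 nextAddr) (asg 21 nextScale)) Q s := by
  have hp := hb.le_pow
  have h₁ := hb.n_le
  have h₂ := scale_le ht.le
  have h₂' := scale_le (Nat.succ_le_of_lt ht)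
  have h₃ := hb.ten_le
  have h₄ := (famAddr_mono g c (Nat.succ_le_of_lt ht)).trans hb.addr_le
  have h₅ := le_famAddr g c t
  rw [Nat.succ_eq_add_one, famAddr] at h₄
  rw [Nat.succ_eq_add_one, scale] at h₂'
  have h₆ : (g (scale c t)).num ≤ (g (scale c t)).num * n := Nat.le_mul_of_pos_right _ (by
    have := lt_numScales.1 ht
    have := succ_le_scale c t
    omega)
  refine WP.seq (WP.asg (famAddr g c (t + 1)) ?_ (by rw [famAddr]; omega)
    ⟨⟨h.regLe.fits (by omega) (by omega), show 2 ≤ W by omega, ?_⟩,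
      ⟨⟨h.regLe.fits (by omega) (by omega), ?_⟩, h.regLe.fits (by omega) (by omega), ?_⟩, ?_⟩ ?_)
  · simp [nextAddr, h.reg22, h.reg3, hh, famAddr]
  · simp [h.reg22]; omega
  · simp [h.reg22]; omega
  · simp [h.reg22, h.reg3, hh]; omega
  · simp [h.reg22, h.reg3, hh]; omega
  have hle : RegLe (Z ^ 4) (s.setReg 22 (famAddr g c (t + 1))) :=
    h.regLe.setReg (by rw [famAddr]; omega)
  have h₇ := Nat.div_le_self (scale c t) c
  refine WP.asg (scale c (t + 1)) ?_ (by rw [scale]; omega)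
    ⟨⟨hle.fits (by omega) (by omega), show 1 ≤ W by omega, ?_⟩,
      ⟨hle.fits (by omega) (by omega), hle.fits (by omega) (by omega), ?_⟩, ?_⟩ ?_
  · simp [nextScale, h.reg21, h.reg20, scale]
  · simp [h.reg21]; omega
  · simp [h.reg21, h.reg20]; omega
  · simp [h.reg21, h.reg20]; omega
  refine hQ _ ⟨by simp [h.reg3], by simp [h.reg4], by simp [h.reg20], by simp, by simp,
    hle.setReg (by rw [scale]; omega)⟩ rfl rfl fun i h21 h22 => by simp [h21, h22]

/-- The state after the calls of the generator. -/
structure GenDone (g : Oracle n) (c Z : ℕ) (s : State) : Prop where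
  regs : s.reg 3 = n ∧ s.reg 4 = n * n ∧ s.reg 20 = c
  reg5 : s.reg 5 = famAddr g c (numScales n c)
  regLe : RegLe (Z ^ 4) s
  layout : Layout g c (numScales n c) s.heap
  zero : ∀ y, famAddr g c (numScales n c) ≤ y → s.heap y = 0
  calls : s.calls = (List.range (numScales n c)).map (scale c)

theorem genCom_wp {c₁ x : ℕ} (hb : GenBounds g (c₁ * x) Z W) (hc₁ : c₁ ≤ Z)
    (h0 : s.reg 0 = n) (h1 : s.reg 1 = x) (hle : RegLe (Z ^ 4) s) (hh : ∀ y, s.heap y = 0)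
    (hc : s.calls = []) : WP W g r (genCom c₁) (GenDone g (c₁ * x) Z) s := by
  have hp := hb.le_pow
  have h₁ := hb.n_le
  have h₂ := hb.ten_le
  have h₃ := hb.c_le
  have hB : Z ^ 4 ≤ W := by omega
  set c := c₁ * x with hcdef
  refine WP.seq (WP.asg n (by simp [h0]) (by omega) (hle.fits hB (by omega)) ?_)
  have hle₁ : RegLe (Z ^ 4) (s.setReg 3 n) := hle.setReg (by omega)
  refine WP.seq (WP.asg (n * n) (by simp) (by omega) ⟨hle₁.fits hB (by omega),
    hle₁.fits hB (by omega), by simp; omega⟩ ?_)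
  have hle₂ : RegLe (Z ^ 4) ((s.setReg 3 n).setReg 4 (n * n)) := hle₁.setReg (by omega)
  refine WP.seq (WP.asg c (by simp [h1, c]) (by omega) ⟨show c₁ ≤ W by omega,
    hle₂.fits hB (by omega), by simp [h1, ← hcdef]; omega⟩ ?_)
  have hle₃ := hle₂.setReg (i := 20) (v := c) (by omega)
  refine WP.seq (WP.asg 0 rfl (by omega) (Nat.zero_le _) ?_)
  have hle₄ := hle₃.setReg (i := 9) (v := 0) (by omega)
  -- The table of the identity partition occupies the first n heap cells.
  refine WP.seq (WP.whl n (fun i s' => s'.reg 3 = n ∧ s'.reg 4 = n * n ∧ s'.reg 20 = c ∧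
    s'.reg 9 = i ∧ RegLe (Z ^ 4) s' ∧ s'.calls = [] ∧
    (∀ y, s'.heap y = if 64 ≤ y ∧ y < 64 + i then y - 64 else 0)) ?_ ?_ ?_ ?_)
  · rintro i hi s' ⟨a₁, a₂, a₃, a₄, a₅, a₆, a₇⟩
    refine ⟨⟨a₅.fits hB (by omega), a₅.fits hB (by omega), ?_⟩, ?_⟩
    · simp only [BinOp.eval_lt]; split_ifs <;> omega
    · simp [a₁, a₄]
  · refine ⟨by simp, by simp, by simp, by simp, hle₄, hc, fun y => ?_⟩
    rw [if_neg (by omega)]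
    exact hh y
  · rintro i hi s' ⟨a₁, a₂, a₃, a₄, a₅, a₆, a₇⟩
    refine WP.seq (WP.wr (64 + i) i (by simp [a₄]) (by simp [a₄]) (by omega)
      ⟨show 64 ≤ W by omega, a₅.fits hB (by omega), by simp [a₄]; omega⟩
      (a₅.fits hB (by omega)) ?_)
    refine WP.asg (i + 1) (by simp [a₄]) (by omega)
      ⟨a₅.fits hB (by omega), show 1 ≤ W by omega, by simp [a₄]; omega⟩ ?_
    refine ⟨by simp [a₁], by simp [a₂], by simp [a₃], by simp, ?_, a₆, fun y => ?_⟩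
    · exact RegLe.setReg a₅ (by omega)
    · simp only [State.tick_heap, State.setReg_heap, State.setHeap_heap]
      by_cases hy : y = 64 + i
      · rw [if_pos hy, if_pos (by omega)]; omega
      · rw [if_neg hy, a₇ y]
        by_cases hy' : 64 ≤ y ∧ y < 64 + i
        · rw [if_pos hy', if_pos (by omega)]
        · rw [if_neg hy', if_neg (by omega)]
  rintro s' ⟨a₁, a₂, a₃, a₄, a₅, a₆, a₇⟩
  refine WP.seq (WP.asg (64 + n) (by simp [a₁]) (by omega)
    ⟨show 64 ≤ W by omega, a₅.fits hB (by omega), by simp [a₁]; omega⟩ ?_)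
  have hle₅ := a₅.setReg (i := 22) (v := 64 + n) (by omega)
  refine WP.seq (WP.asg 1 rfl (by omega) (show 1 ≤ W by omega) ?_)
  have hle₆ := hle₅.setReg (i := 21) (v := 1) (by omega)
  refine WP.seq (WP.whl (numScales n c) (fun t s' => ScaleRegs n c Z g t s' ∧
    Layout g c t s'.heap ∧ (∀ y, famAddr g c t ≤ y → s'.heap y = 0) ∧
    s'.calls = (List.range t).map (scale c)) ?_ ?_ ?_ ?_)
  · rintro t ht s' ⟨b₁, -⟩
    exact b₁.moreScales hb ht
  · refine ⟨⟨by simp [a₁], by simp [a₂], by simp [a₃], by simp [scale], by simp [famAddr], hle₆⟩,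
      ⟨fun i hi => ?_, fun t ht => absurd ht (Nat.not_lt_zero _),
        fun t ht => absurd ht (Nat.not_lt_zero _), fun t ht => absurd ht (Nat.not_lt_zero _)⟩,
      fun y hy => ?_, a₆⟩
    · simp only [State.tick_heap, State.setReg_heap, a₇]
      rw [if_pos (by omega)]; omega
    · simp only [State.tick_heap, State.setReg_heap, a₇]
      rw [famAddr] at hy
      rw [if_neg (by omega)]
  · rintro t ht s' ⟨b₁, b₂, b₃, b₄⟩
    have hn0 : 0 < n := by
      have := lt_numScales.1 ht
      have := succ_le_scale c t
      omega
    have h₄ := (famAddr_mono g c (Nat.succ_le_of_lt ht)).trans hb.addr_le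
    have h₅ := le_famAddr g c t
    rw [Nat.succ_eq_add_one, famAddr] at h₄
    have h₆ : (g (scale c t)).num ≤ (g (scale c t)).num * n := Nat.le_mul_of_pos_right _ hn0
    have h₇ := hb.parts_le t ht
    refine WP.seq (WP.call (scale c t) (famAddr g c t) b₁.reg21 b₁.reg22 (by omega)
      (b₁.regLe.fits hB (by omega)) (b₁.regLe.fits hB (by omega)) (by omega) (by omega) (by omega)
      ?_)
    refine ScaleRegs.advance (t := t) ⟨b₁.reg3, b₁.reg4, b₁.reg20, b₁.reg21, b₁.reg22, b₁.regLe⟩ hb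
      ht ?_ fun s'' c₁ c₂ c₃ c₄ => ⟨⟨c₁.reg3, c₁.reg4, c₁.reg20, c₁.reg21, c₁.reg22, c₁.regLe⟩,
        ?_, fun y hy => ?_, ?_⟩
    · exact b₂.write.num t (by omega)
    · simp only [State.tick_heap, c₂]
      exact b₂.write
    · rw [famAddr] at hy
      simp only [State.tick_heap, c₂, State.setFamily]
      rw [Family.write_ge hn0 hy]
      exact b₃ y (by omega)
    · rw [State.tick_calls, c₃, List.range_succ, List.map_append, ← b₄]
      rfl
  · rintro s' ⟨b₁, b₂, b₃, b₄⟩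
    have h₄ := hb.addr_le
    refine WP.asg _ b₁.reg22 (by omega) (b₁.regLe.fits hB (by omega)) ?_
    exact ⟨⟨by simp [b₁.reg3], by simp [b₁.reg4], by simp [b₁.reg20]⟩, by simp,
      RegLe.setReg b₁.regLe (by omega), b₂, b₃, b₄⟩

end

/-! ### The instances -/

section Instances

variable {n : ℕ}

/-- The instance for one partition of a family for the matching size `k`; the identity replaces
partitions into more than `n` parts. -/
def mkInst (F : Family n) (k c addr : ℕ) (i : Fin F.num) : Inst n :=
  if n < F.parts then ⟨64, n, n * c / k + 1, id⟩
  -- At least two parts, because the guarantees of the simulated algorithm start with two vertices.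
  -- The accuracy parameter exceeds the real quotient of (parts · c) by k, so that the additive
  -- error is at most k / c.
  else ⟨addr + 2 + i * n, max 2 F.parts, max 2 F.parts * c / k + 1,
    fun v => (F.part i v).castLE (le_max_right _ _)⟩

variable (g : Oracle n) (c : ℕ)

def scaleInsts (t : ℕ) : List (Inst n) :=
  List.ofFn (mkInst (g (scale c t)) (scale c t) c (famAddr g c t))

/-- The instances of the first `T` scales. -/
def insts (T : ℕ) : List (Inst n) := (List.range T).flatMap (scaleInsts g c)

instance : Inhabited (Inst n) := ⟨⟨64, n, 1, id⟩⟩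

/-- The instance number `j`. -/
noncomputable def instAt (j : ℕ) : Inst n := (insts g c (numScales n c)).getD j default

theorem insts_succ (T : ℕ) : insts g c (T + 1) = insts g c T ++ scaleInsts g c T := by
  simp [insts, List.range_succ]

theorem isPrefix_insts {T T' : ℕ} (h : T ≤ T') : insts g c T <+: insts g c T' := by
  induction h with
  | refl => exact List.prefix_refl _
  | step _ ih => exact ih.trans (by rw [insts_succ]; exact List.prefix_append _ _)

theorem length_insts_succ (T : ℕ) :
    (insts g c (T + 1)).length = (insts g c T).length + (g (scale c T)).num := by
  simp [insts_succ, scaleInsts]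

theorem length_insts_mono : Monotone fun T => (insts g c T).length := fun _ _ h =>
  (isPrefix_insts g c h).length_le

theorem instAt_eq {t : ℕ} (ht : t < numScales n c) (i : Fin (g (scale c t)).num) :
    instAt g c ((insts g c t).length + i) =
      mkInst (g (scale c t)) (scale c t) c (famAddr g c t) i := by
  obtain ⟨l, hl⟩ := isPrefix_insts g c (Nat.succ_le_of_lt ht)
  unfold instAt
  rw [List.getD_eq_getElem?_getD, ← hl, Nat.succ_eq_add_one, insts_succ, List.append_assoc,
    List.getElem?_append_right (by omega), Nat.add_sub_cancel_left,
    List.getElem?_append_left (by simp [scaleInsts])]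
  simp [scaleInsts]

/-- Each instance belongs to a partition at some scale. -/
theorem exists_instAt {j : ℕ} {T : ℕ} (hT : T ≤ numScales n c) (hj : j < (insts g c T).length) :
    ∃ t < T, ∃ i : Fin (g (scale c t)).num, j = (insts g c t).length + i := by
  induction T with
  | zero => simp [insts] at hj
  | succ T ih =>
    by_cases hlt : j < (insts g c T).length
    · obtain ⟨t, ht, i, h⟩ := ih (by omega) hlt
      exact ⟨t, by omega, i, h⟩
    · rw [length_insts_succ] at hj
      exact ⟨T, by omega, ⟨j - (insts g c T).length, by omega⟩, by simp; omega⟩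

theorem mkInst_table {t : ℕ} {H : ℕ → ℕ} (hL : Layout g c (numScales n c) H)
    (ht : t < numScales n c) (i : Fin (g (scale c t)).num) (v : Fin n) :
    H ((mkInst (g (scale c t)) (scale c t) c (famAddr g c t) i).tb + v) =
      (mkInst (g (scale c t)) (scale c t) c (famAddr g c t) i).f v := by
  by_cases h : n < (g (scale c t)).parts
  · rw [mkInst, if_pos h]
    exact hL.ident v v.2
  · rw [mkInst, if_neg h]
    exact hL.part t ht i v

theorem mkInst_valid {t : ℕ} (hn : 2 ≤ n) (ht : t < numScales n c)
    (i : Fin (g (scale c t)).num) :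
    (mkInst (g (scale c t)) (scale c t) c (famAddr g c t) i).Valid
      (famAddr g c (numScales n c)) := by
  have h₁ := le_famAddr g c t
  have h₂ := famAddr_mono g c (Nat.succ_le_of_lt ht)
  have h₃ : (i + 1) * n ≤ (g (scale c t)).num * n := Nat.mul_le_mul_right _ i.2
  rw [Nat.add_mul] at h₃
  rw [Nat.succ_eq_add_one, famAddr] at h₂
  unfold mkInst
  split
  · exact ⟨le_rfl, le_rfl, by simp; omega⟩
  · exact ⟨by simp; omega, by simp; omega, by simp; omega⟩

end Instances

/-! ### Starting the instances

Further registers: `23` number of partitions, `24` number of parts, `25` number of vertices of the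
instances, `26` current partition, `27` whether the identity is used, `28` accuracy parameter. -/

open Exp in
def rowCom (st : Com) : Com :=
  .seq (cond (reg 27) (wr (addr (lit 0) (reg 9)) (lit 64))
    (wr (addr (lit 0) (reg 9))
      (op .add (op .add (reg 22) (lit 2)) (op .mul (reg 26) (reg 3))))) <|
  .seq (asg 8 (op .add (op .mul (lit 4) (reg 9)) (lit 1))) <|
  .seq (wr (addr (reg 8) (lit 0)) (reg 25)) <|
  .seq (wr (addr (reg 8) (lit 1)) (reg 28)) <|
  .seq (sim st) <|
  .seq (asg 9 (op .add (reg 9) (lit 1))) <|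
  asg 26 (op .add (reg 26) (lit 1))

open Exp in
def paramsCom : Com :=
  .seq (asg 23 (ld (reg 22))) <|
  .seq (asg 24 (ld (op .add (reg 22) (lit 1)))) <|
  .seq (asg 27 (op .lt (reg 3) (reg 24))) <|
  .seq (cond (reg 27) (asg 25 (reg 3))
    (cond (op .lt (reg 24) (lit 2)) (asg 25 (lit 2)) (asg 25 (reg 24)))) <|
  .seq (asg 28 (op .add (op .div (op .mul (reg 25) (reg 20)) (reg 21)) (lit 1))) <|
  asg 26 (lit 0)

open Exp in
def instPhaseCom (st : Com) : Com :=
  .seq (asg 22 (op .add (lit 64) (reg 3))) <|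
  .seq (asg 21 (lit 1)) <|
  .seq (asg 9 (lit 0)) <|
  .seq (whl moreScales (.seq paramsCom
    (.seq (whl (op .lt (reg 26) (reg 23)) (rowCom st))
      (.seq (asg 22 nextAddr) (asg 21 nextScale))))) <|
  .seq (asg 6 (reg 9)) <|
  .seq (asg 7 (lit 0)) <|
  asg 0 (lit 0)

section

variable {n W Z c : ℕ} {g : Oracle n} {r : ℕ → Bool} {s : State} {ms : ℕ → Mem} {st : Com}

/-- The first `J` instances have been started. -/
structure Started (g : Oracle n) (c : ℕ) (H : ℕ → ℕ) (ms : ℕ → Mem) (J : ℕ) (s : State) :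
    Prop where
  reg5 : s.reg 5 = famAddr g c (numScales n c)
  reg9 : s.reg 9 = J
  low : ∀ y < famAddr g c (numScales n c), s.heap y = H y
  table : ∀ j < J, s.arr (famAddr g c (numScales n c)) 0 j = (instAt g c j).tb
  mem : ∀ j < J, ∀ x, s.arr (famAddr g c (numScales n c)) (4 * j + 1) x = ms j x
  zero : ∀ i x, i ≠ 0 → (∀ j < J, i ≠ 4 * j + 1) →
    s.arr (famAddr g c (numScales n c)) i x = 0

/-- The registers while the instances of one scale are started. -/
structure RowRegs (F : Family n) (k c : ℕ) (s : State) : Prop where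
  reg23 : s.reg 23 = F.num
  reg25 : s.reg 25 = if n < F.parts then n else max 2 F.parts
  reg27 : s.reg 27 = if n < F.parts then 1 else 0
  reg28 : s.reg 28 = s.reg 25 * c / k + 1

theorem paramsCom_wp {t : ℕ} (hb : GenBounds g c Z W) (ht : t < numScales n c) (hn : 2 ≤ n)
    (h : ScaleRegs n c Z g t s) (hL : Layout g c (numScales n c) s.heap) :
    WP W g r paramsCom (fun s' => RowRegs (g (scale c t)) (scale c t) c s' ∧ s'.reg 26 = 0 ∧
      s'.heap = s.heap ∧ s'.calls = s.calls ∧ (∀ i, i < 23 → s'.reg i = s.reg i) ∧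
      RegLe (Z ^ 4) s') s := by
  have hp := hb.le_pow
  have h₁ := hb.n_le
  have h₃ := hb.ten_le
  have hB : Z ^ 4 ≤ W := by omega
  have h₄ := (famAddr_mono g c (Nat.succ_le_of_lt ht)).trans hb.addr_le
  have h₅ := le_famAddr g c t
  rw [Nat.succ_eq_add_one, famAddr] at h₄
  have h₆ : (g (scale c t)).num ≤ (g (scale c t)).num * n := Nat.le_mul_of_pos_right _ (by omega)
  have h₇ := hb.parts_le t ht
  have h₈ := hb.c_le
  set F := g (scale c t)
  refine WP.seq (WP.asg F.num ?_ (by omega) ⟨h.regLe.fits hB (by omega), ?_⟩ ?_)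
  · simp [h.reg22, hL.num t ht, F]
  · simp [h.reg22]; omega
  have l₁ := h.regLe.setReg (i := 23) (v := F.num) (by omega)
  refine WP.seq (WP.asg F.parts ?_ (by omega) ⟨⟨l₁.fits hB (by omega), show 1 ≤ W by omega, ?_⟩,
    ?_⟩ ?_)
  · simp [h.reg22, hL.parts t ht, F]
  · simp [h.reg22]; omega
  · simp [h.reg22]; omega
  have l₂ := l₁.setReg (i := 24) (v := F.parts) (by omega)
  have hf1 : (if n < F.parts then 1 else 0) ≤ 1 := by split_ifs <;> omega
  refine WP.seq (WP.asg (if n < F.parts then 1 else 0) (by simp [h.reg3]) (by omega)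
    ⟨l₂.fits hB (by omega), l₂.fits hB (by omega), by simp [h.reg3]; omega⟩ ?_)
  have l₃ := l₂.setReg (i := 27) (v := if n < F.parts then 1 else 0) (by omega)
  set t₁ := (Exp.reg 22).ld.cost + 1
  set t₂ := (Exp.op .add (Exp.reg 22) (.lit 1)).ld.cost + 1
  set t₃ := (Exp.op .lt (Exp.reg 3) (Exp.reg 24)).cost + 1
  set s₃ := (((((s.setReg 23 F.num).tick t₁).setReg 24 F.parts).tick t₂).setReg 27
    (if n < F.parts then 1 else 0)).tick t₃ with hs₃
  have l₃' : RegLe (Z ^ 4) s₃ := l₃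
  set np := if n < F.parts then n else max 2 F.parts with hnp
  have hnp' : np ≤ Z := by
    rw [hnp]; split_ifs
    · omega
    · exact max_le (by omega) h₇
  have key : WP W g r (cond (.reg 27) (asg 25 (.reg 3))
    (cond (.op .lt (.reg 24) (.lit 2)) (asg 25 (.lit 2)) (asg 25 (.reg 24))))
    (fun s' => ∃ t, s' = (s₃.setReg 25 np).tick t) s₃ := by
    refine WP.cond (l₃'.fits hB (by omega)) (fun hne => ?_) fun hz => ?_
    · have hlt : n < F.parts := by
        by_contra h'
        simp [s₃, h'] at hne
      refine WP.asg np (by simp [s₃, h.reg3, np, hlt]) (by omega) (l₃'.fits hB (by omega))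
        ⟨(Exp.reg 27).cost + 1 + ((Exp.reg 3).cost + 1), rfl⟩
    · have hlt : ¬ n < F.parts := by
        intro h'
        simp [s₃, h'] at hz
      refine WP.cond ⟨l₃'.fits hB (by omega), show 2 ≤ W by omega, ?_⟩ (fun hne => ?_) fun hz => ?_
      · simp only [BinOp.eval_lt]; split_ifs <;> omega
      · have h2 : F.parts < 2 := by
          by_contra h'
          simp [s₃, h'] at hne
        refine WP.asg np ?_ (by omega) (show 2 ≤ W by omega) ⟨(Exp.reg 27).cost + 1 +
          ((Exp.op .lt (Exp.reg 24) (Exp.lit 2)).cost + 1) + ((Exp.lit 2).cost + 1), rfl⟩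
        simp [np, hlt]; omega
      · have h2 : ¬ F.parts < 2 := by
          intro h'
          simp [s₃, h'] at hz
        refine WP.asg np ?_ (by omega) (l₃'.fits hB (by omega)) ⟨(Exp.reg 27).cost + 1 +
          ((Exp.op .lt (Exp.reg 24) (Exp.lit 2)).cost + 1) + ((Exp.reg 24).cost + 1), rfl⟩
        simp [np, hlt, s₃]; omega
  refine WP.seq (key.mono ?_)
  rintro _ ⟨t₄, rfl⟩
  have l₄ := l₃'.setReg (i := 25) (v := np) (by omega)
  have hnpc : np * c ≤ Z * Z := Nat.mul_le_mul hnp' h₈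
  have hZZ : Z * Z + 1 ≤ Z ^ 4 := by
    have h9 : 2 * Z ^ 2 ≤ Z ^ 3 := mul_pow_le (by omega)
    have h10 : Z ^ 3 ≤ Z ^ 4 := Nat.pow_le_pow_right (by omega) (by omega)
    have h11 : 1 ≤ Z ^ 2 := Nat.one_le_pow _ _ (by omega)
    rw [← sq]; omega
  have hdiv := Nat.div_le_self (np * c) (scale c t)
  refine WP.seq (WP.asg (np * c / scale c t + 1) ?_ (by omega) ⟨⟨⟨l₄.fits hB (by omega),
    l₄.fits hB (by omega), ?_⟩, l₄.fits hB (by omega), ?_⟩, show 1 ≤ W by omega, ?_⟩ ?_)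
  · simp [s₃, h.reg20, h.reg21]
  · simp [s₃, h.reg20]; omega
  · simp [s₃, h.reg20, h.reg21]; omega
  · simp [s₃, h.reg20, h.reg21]; omega
  have l₅ := l₄.setReg (i := 28) (v := np * c / scale c t + 1) (by omega)
  refine WP.asg 0 rfl (by omega) (Nat.zero_le _) ?_
  exact ⟨⟨by simp [s₃, F], by simp [np], by simp [s₃, F], by simp⟩, by simp, rfl, rfl,
    fun i hi => by simp [s₃, show i ≠ 23 by omega, show i ≠ 24 by omega, show i ≠ 25 by omega,
      show i ≠ 26 by omega, show i ≠ 27 by omega, show i ≠ 28 by omega], l₅.setReg (Nat.zero_le _)⟩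

end

section

variable {n W Z c : ℕ} {g : Oracle n} {r : ℕ → Bool} {s : State} {ms : ℕ → Mem} {st : Com}

/-- The preprocessing of the simulated algorithm for the instance `I` ends in the memory `m`. -/
structure InstStart (st : Com) (W₀ Z : ℕ) (r₀ : ℕ → Bool) (I : Inst n) (m : Mem) : Prop where
  exec : ∃ t l, Exec W₀ (noOracle I.np ()) r₀ st (startMem I.np I.D) m t l
  data : SimData st W₀ Z
  np_le : I.np ≤ W₀
  D_le : I.D ≤ W₀

theorem InstStart.startMem_le {W₀ : ℕ} {r₀ : ℕ → Bool} {I : Inst n} {m : Mem}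
    (h : InstStart st W₀ Z r₀ I m) (y : ℕ) : startMem I.np I.D y ≤ W₀ := by
  unfold startMem
  have := h.np_le
  have := h.D_le
  split_ifs <;> omega

theorem InstStart.mem_le {W₀ : ℕ} {r₀ : ℕ → Bool} {I : Inst n} {m : Mem}
    (h : InstStart st W₀ Z r₀ I m) (y : ℕ) : m y ≤ W₀ := by
  obtain ⟨t, l, hx⟩ := h.exec
  exact hx.le_word h.data.callFree h.data.one_le h.startMem_le y

theorem ScaleRegs.congr {t : ℕ} {s' : State} (h : ScaleRegs n c Z g t s)
    (hr : ∀ i, i ≠ 8 → i ≠ 9 → i < 23 → s'.reg i = s.reg i) (hle : RegLe (Z ^ 4) s') :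
    ScaleRegs n c Z g t s' :=
  ⟨(hr 3 (by omega) (by omega) (by omega)).trans h.reg3,
    (hr 4 (by omega) (by omega) (by omega)).trans h.reg4,
    (hr 20 (by omega) (by omega) (by omega)).trans h.reg20,
    (hr 21 (by omega) (by omega) (by omega)).trans h.reg21,
    (hr 22 (by omega) (by omega) (by omega)).trans h.reg22, hle⟩

theorem rowCom_wp {t : ℕ} {H : ℕ → ℕ} {W₀ : ℕ} {r₀ : ℕ → Bool} (hb : GenBounds g c Z W)
    (ht : t < numScales n c) (i : Fin (g (scale c t)).num) {J : ℕ}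
    (hJ : J = (insts g c t).length + i) (hJZ : 4 * J + 4 ≤ Z)
    (hst : InstStart st W₀ Z r₀ (instAt g c J) (ms J))
    (hr : ∀ y, r (phys (famAddr g c (numScales n c)) (4 * J + 1) y) = r₀ y)
    (h : ScaleRegs n c Z g t s) (hrow : RowRegs (g (scale c t)) (scale c t) c s)
    (h26 : s.reg 26 = i) (hS : Started g c H ms J s) :
    WP W g r (rowCom st) (fun s' => ScaleRegs n c Z g t s' ∧
      RowRegs (g (scale c t)) (scale c t) c s' ∧ s'.reg 26 = i + 1 ∧ Started g c H ms (J + 1) s' ∧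
      s'.calls = s.calls) s := by
  have hp := hb.le_pow
  have h₁ := hb.n_le
  have h₂ := hb.ten_le
  have hW := hb.pow_le
  have hB : Z ^ 4 ≤ W := by omega
  have h₄ := (famAddr_mono g c (Nat.succ_le_of_lt ht)).trans hb.addr_le
  have h₅ := le_famAddr g c t
  have h₆ := hb.addr_le
  have h₇ := le_famAddr g c (numScales n c)
  have h₈ := hb.c_le
  rw [Nat.succ_eq_add_one, famAddr] at h₄
  have h₉ : (i : ℕ) * n ≤ (g (scale c t)).num * n := Nat.mul_le_mul_right _ i.2.le
  have h₁₀ : (i : ℕ) ≤ J := by omega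
  set E := famAddr g c (numScales n c) with hE
  -- Instances are numbered scale by scale, so those started so far are all of the earlier scales
  -- and the first `i` of this one.
  have hI : instAt g c J = mkInst (g (scale c t)) (scale c t) c (famAddr g c t) i := by
    rw [hJ]; exact instAt_eq g c ht i
  have hnp : (instAt g c J).np = s.reg 25 := by
    rw [hI, hrow.reg25, mkInst]; split_ifs <;> rfl
  have hD : (instAt g c J).D = s.reg 28 := by
    rw [hI, hrow.reg28, hrow.reg25, mkInst]; split_ifs <;> rfl
  have h5 : s.reg 5 = E := hS.reg5
  have h9 := hS.reg9
  have hphys : ∀ i' ≤ Z, ∀ x ≤ Z, phys E i' x ≤ W := fun i' hi' x hx =>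
    (phys_mono h₆ hi' hx).trans (phys_self_le (by omega) hW)
  have haddr : (Exp.addr (.lit 0) (.reg 9)).Fits W s :=
    Exp.fits_addr (Nat.zero_le _) (h.regLe.fits hB (by omega))
      (by simpa [h5, h9] using hphys 0 (by omega) J (by omega))
  have haddr' : (Exp.addr (.lit 0) (.reg 9)).eval s = phys E 0 J := by simp [h5, h9]
  have key : WP W g r (cond (.reg 27) (wr (.addr (.lit 0) (.reg 9)) (.lit 64))
      (wr (.addr (.lit 0) (.reg 9))
      (.op .add (.op .add (.reg 22) (.lit 2)) (.op .mul (.reg 26) (.reg 3)))))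
      (fun s' => ∃ t, s' = (s.setHeap (phys E 0 J) (instAt g c J).tb).tick t) s := by
    refine WP.cond (h.regLe.fits hB (by omega)) (fun hne => ?_) fun hz => ?_
    · have hlt : n < (g (scale c t)).parts := by
        by_contra h'
        simp [hrow.reg27, h'] at hne
      refine WP.wr _ _ haddr' ?_ (by have := le_phys E 0 J; omega)
        ((Exp.fits_tick _ _ _).2 haddr) (show 64 ≤ W by omega) ⟨(Exp.reg 27).cost + 1 +
          ((Exp.addr (.lit 0) (.reg 9)).cost + (Exp.lit 64).cost + 1), rfl⟩
      simp [hI, mkInst, hlt]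
    · have hlt : ¬ n < (g (scale c t)).parts := by
        intro h'
        simp [hrow.reg27, h'] at hz
      refine WP.wr _ _ haddr' ?_ (by have := le_phys E 0 J; omega)
        ((Exp.fits_tick _ _ _).2 haddr) ⟨⟨h.regLe.fits hB (by omega), show 2 ≤ W by omega, ?_⟩,
          ⟨h.regLe.fits hB (by omega), h.regLe.fits hB (by omega), ?_⟩, ?_⟩
        ⟨(Exp.reg 27).cost + 1 + ((Exp.addr (.lit 0) (.reg 9)).cost + (Exp.op .add (.op .add
          (.reg 22) (.lit 2)) (.op .mul (.reg 26) (.reg 3))).cost + 1), rfl⟩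
      · simp [hI, mkInst, hlt, h.reg22, h26, h.reg3]
      · simp [h.reg22]; omega
      · simp [h26, h.reg3]; omega
      · simp [h.reg22, h26, h.reg3]; omega
  refine WP.seq (key.mono ?_)
  rintro _ ⟨t₀, rfl⟩
  refine WP.seq (WP.asg (4 * J + 1) (by simp [h9]) (by omega) ⟨⟨show 4 ≤ W by omega,
    h.regLe.fits hB (by omega), by simp [h9]; omega⟩, show 1 ≤ W by omega, by simp [h9]; omega⟩ ?_)
  have l₁ := h.regLe.setReg (i := 8) (v := 4 * J + 1) (by omega)
  refine WP.seq (WP.wr (phys E (4 * J + 1) 0) (instAt g c J).np (by simp [h5]) (by simp [hnp])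
    (by have := le_phys E (4 * J + 1) 0; omega)
    (Exp.fits_addr (l₁.fits hB (by omega)) (Nat.zero_le _) ?_) (l₁.fits hB (by omega)) ?_)
  · simpa [h5] using hphys (4 * J + 1) (by omega) 0 (by omega)
  refine WP.seq (WP.wr (phys E (4 * J + 1) 1) (instAt g c J).D (by simp [h5]) (by simp [hD])
    (by have := le_phys E (4 * J + 1) 1; omega)
    (Exp.fits_addr (l₁.fits hB (by omega)) (show 1 ≤ W by omega) ?_) (l₁.fits hB (by omega)) ?_)
  · simpa [h5] using hphys (4 * J + 1) (by omega) 1 (by omega)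
  obtain ⟨t₁, l, hx⟩ := hst.exec
  refine WP.seq ((sim_wp hx hst.data.callFree hst.data.cellBound hst.data.one_le hst.startMem_le
    hst.data.le (phys_self_le (by omega) hW) (by omega) h₆ (by omega) hr _ (by simp [h5]) (by simp)
    fun x => ?_).mono fun s' hs' => ?_)
  · simp only [State.arr_tick, State.arr_setHeap, State.arr_setReg]
    -- The array of the new copy is untouched and hence zero, as the initial memory of its
    -- preprocessing has to be outside the two input cells.
    have hz : s.arr E (4 * J + 1) x = 0 := hS.zero (4 * J + 1) x (by omega) (by omega)
    unfold startMem
    by_cases hx1 : x = 1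
    · simp [hx1]
    · by_cases hx0 : x = 0
      · simp [hx0]
      · simp [hx0, hx1, hz]
  have a₁ := hs'.1
  have a₂ := hs'.2.1
  have a₃ : ∀ i', i' ≠ 4 * J + 1 → ∀ x, s'.arr E i' x =
      if i' = 0 ∧ x = J then (instAt g c J).tb else s.arr E i' x := fun i' hi' x => by
    rw [arr_of_simulated hs' hi']
    simp [hi']
  have a₄ : ∀ y < E, s'.heap y = s.heap y := fun y hy => by
    rw [hs'.2.2.1 y fun x => by have := le_phys E (4 * J + 1) x; omega]
    simp only [State.tick_heap]
    rw [State.heap_setHeap_phys _ _ _ _ _ hy, State.tick_heap,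
      State.heap_setHeap_phys _ _ _ _ _ hy, State.tick_heap, State.setReg_heap, State.tick_heap,
      State.heap_setHeap_phys _ _ _ _ _ hy]
  have a₅ : ∀ i', i' ≠ 8 → s'.reg i' = s.reg i' := fun i' hi' => by rw [a₁]; simp [hi']
  have a₆ : RegLe (Z ^ 4) s' := fun i' hi' => by rw [a₁]; exact l₁ i' hi'
  refine WP.seq (WP.asg (J + 1) (by simp [a₅, h9]) (by omega) ⟨a₆.fits hB (by omega),
    show 1 ≤ W by omega, by simp [a₅, h9]; omega⟩ ?_)
  have l₂ := a₆.setReg (i := 9) (v := J + 1) (by omega)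
  refine WP.asg (i + 1) (by simp [a₅, h26]) (by omega) ⟨l₂.fits hB (by omega),
    show 1 ≤ W by omega, by simp [a₅, h26]; omega⟩ ?_
  refine ⟨h.congr (fun j h8 h9 h23 => ?_) (l₂.setReg (by omega)), ⟨?_, ?_, ?_, ?_⟩, by simp,
    ⟨?_, by simp, fun y hy => (a₄ y hy).trans (hS.low y hy), fun j hj => ?_, fun j hj x => ?_,
      fun i' x h0 hi' => ?_⟩, hs'.2.2.2.2⟩
  · simp [h9, show j ≠ 26 by omega, a₅ j h8]
  · simp [a₅, hrow.reg23]
  · simp [a₅, hrow.reg25]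
  · simp [a₅, hrow.reg27]
  · simp [a₅, hrow.reg28]
  · simp [a₅, h5, hE]
  · simp only [State.arr_tick, State.arr_setReg]
    rw [a₃ 0 (by omega) j]
    by_cases hjJ : j = J
    · simp [hjJ]
    · rw [if_neg (by omega)]; exact hS.table j (by omega)
  · simp only [State.arr_tick, State.arr_setReg]
    by_cases hjJ : j = J
    · rw [hjJ]; exact a₂ x
    · rw [a₃ _ (by omega) x, if_neg (by omega)]; exact hS.mem j (by omega) x
  · simp only [State.arr_tick, State.arr_setReg]
    rw [a₃ _ (hi' J (by omega)) x, if_neg (by omega)]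
    exact hS.zero i' x h0 fun j hj => hi' j (by omega)

/-- The state after the instances have been started. -/
theorem instPhaseCom_wp {word : ℕ → ℕ} {r₀ : ℕ → ℕ → Bool} {N : ℕ} (hn : 2 ≤ n)
    (hb : GenBounds g c Z W) (hN : N = (insts g c (numScales n c)).length) (hNZ : 4 * N + 4 ≤ Z)
    (hst : ∀ j < N, InstStart st (word j) Z (r₀ j) (instAt g c j) (ms j))
    (hr : ∀ j < N, ∀ y, r (phys (famAddr g c (numScales n c)) (4 * j + 1) y) = r₀ j y)
    (hg : GenDone g c Z s) :
    WP W g r (instPhaseCom st) (fun s' => s'.reg 0 = 0 ∧ s'.reg 4 = n * n ∧ s'.reg 6 = N ∧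
      s'.reg 7 = 0 ∧ RegLe (Z ^ 4) s' ∧ Started g c s.heap ms N s') s := by
  have hp := hb.le_pow
  have h₁ := hb.n_le
  have h₂ := hb.ten_le
  have hB : Z ^ 4 ≤ W := by omega
  have hle := hg.regLe
  refine WP.seq (WP.asg (64 + n) (by simp [hg.regs.1]) (by omega)
    ⟨show 64 ≤ W by omega, hle.fits hB (by omega), by simp [hg.regs.1]; omega⟩ ?_)
  refine WP.seq (WP.asg 1 rfl (by omega) (show 1 ≤ W by omega) ?_)
  refine WP.seq (WP.asg 0 rfl (by omega) (Nat.zero_le _) ?_)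
  refine WP.seq (WP.whl (numScales n c) (fun t s' => ScaleRegs n c Z g t s' ∧
    Started g c s.heap ms (insts g c t).length s') ?_ ?_ ?_ ?_)
  · rintro t ht s' ⟨b₁, -⟩
    exact b₁.moreScales hb ht
  · refine ⟨⟨by simp [hg.regs], by simp [hg.regs], by simp [hg.regs], by simp [scale],
      by simp [famAddr], ?_⟩, by simp [hg.reg5], by simp [insts], fun y _ => rfl,
      fun j hj => absurd hj (Nat.not_lt_zero _), fun j hj => absurd hj (Nat.not_lt_zero _),
      fun i x _ _ => hg.zero _ (le_phys _ _ _)⟩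
    exact RegLe.setReg (RegLe.setReg (RegLe.setReg hle (by omega)) (by omega)) (by omega)
  · rintro t ht s' ⟨b₁, b₂⟩
    have hL : Layout g c (numScales n c) s'.heap := hg.layout.congr b₂.low
    refine WP.seq ((paramsCom_wp hb ht hn b₁ hL).mono ?_)
    rintro s₁ ⟨c₁, c₂, c₃, c₄, c₅, c₆⟩
    refine WP.seq (WP.whl (g (scale c t)).num (fun i s' => ScaleRegs n c Z g t s' ∧
      RowRegs (g (scale c t)) (scale c t) c s' ∧ s'.reg 26 = i ∧
      Started g c s.heap ms ((insts g c t).length + i) s') ?_ ?_ ?_ ?_)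
    · rintro i hi s₂ ⟨d₁, d₂, d₃, -⟩
      refine ⟨⟨d₁.regLe.fits hB (by omega), d₁.regLe.fits hB (by omega), ?_⟩, ?_⟩
      · simp only [BinOp.eval_lt]; split_ifs <;> omega
      · simp [d₃, d₂.reg23]
    · refine ⟨b₁.congr (fun i _ _ hi => c₅ i hi) c₆, ⟨c₁.reg23, c₁.reg25, c₁.reg27, c₁.reg28⟩, c₂,
        (c₅ 5 (by omega)).trans b₂.reg5, (c₅ 9 (by omega)).trans b₂.reg9, ?_, ?_, ?_, ?_⟩
      · rw [State.tick_heap, c₃]; exact b₂.low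
      · simp only [State.arr, State.tick_heap, c₃]; exact b₂.table
      · simp only [State.arr, State.tick_heap, c₃]; exact b₂.mem
      · simp only [State.arr, State.tick_heap, c₃]; exact b₂.zero
    · rintro i hi s₂ ⟨d₁, d₂, d₃, d₄⟩
      have hlt : (insts g c t).length + i < N := by
        rw [hN]
        refine lt_of_lt_of_le ?_ (length_insts_mono g c (Nat.succ_le_of_lt ht))
        simp only [Nat.succ_eq_add_one, length_insts_succ]
        omega
      refine (rowCom_wp hb ht ⟨i, hi⟩ rfl (by simp; omega) (hst _ hlt) (hr _ hlt) d₁ d₂ d₃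
        d₄).mono fun s₃ h₃ => ?_
      obtain ⟨e₁, e₂, e₃, e₄, -⟩ := h₃
      exact ⟨⟨e₁.reg3, e₁.reg4, e₁.reg20, e₁.reg21, e₁.reg22, e₁.regLe⟩,
        ⟨e₂.reg23, e₂.reg25, e₂.reg27, e₂.reg28⟩, e₃,
        ⟨e₄.reg5, e₄.reg9, e₄.low, e₄.table, e₄.mem, e₄.zero⟩⟩
    · rintro s₂ ⟨d₁, d₂, d₃, d₄⟩
      have hL₂ : Layout g c (numScales n c) s₂.heap := hg.layout.congr d₄.low
      refine ScaleRegs.advance (t := t)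
        ⟨d₁.reg3, d₁.reg4, d₁.reg20, d₁.reg21, d₁.reg22, d₁.regLe⟩ hb ht (hL₂.num t ht) ?_
      intro s₃ e₁ e₂ e₃ e₄
      refine ⟨⟨e₁.reg3, e₁.reg4, e₁.reg20, e₁.reg21, e₁.reg22, e₁.regLe⟩,
        (e₄ 5 (by omega) (by omega)).trans d₄.reg5, ?_, ?_, ?_, ?_, ?_⟩
      · rw [length_insts_succ]
        exact (e₄ 9 (by omega) (by omega)).trans d₄.reg9
      · rw [State.tick_heap, e₂]; exact d₄.low
      · simp only [State.arr, State.tick_heap, e₂, length_insts_succ]; exact d₄.table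
      · simp only [State.arr, State.tick_heap, e₂, length_insts_succ]; exact d₄.mem
      · simp only [State.arr, State.tick_heap, e₂, length_insts_succ]; exact d₄.zero
  rintro s₁ ⟨b₁, b₂⟩
  rw [← hN] at b₂
  refine WP.seq (WP.asg N b₂.reg9 (by omega) (b₁.regLe.fits hB (by omega)) ?_)
  refine WP.seq (WP.asg 0 rfl (by omega) (Nat.zero_le _) ?_)
  refine WP.asg 0 rfl (by omega) (Nat.zero_le _) ?_
  refine ⟨by simp, by simp [b₁.reg4], by simp, by simp, ?_, by simp [b₂.reg5], by simp [b₂.reg9],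
    b₂.low, b₂.table, b₂.mem, b₂.zero⟩
  exact RegLe.setReg (RegLe.setReg (RegLe.setReg b₁.regLe (by omega)) (by omega)) (by omega)

/-! ### The preprocessing -/

def startCom (c₁ : ℕ) (st : Com) : Com := .seq (genCom c₁) (instPhaseCom st)

/-- The setup with the instances for the answers `g` of the generator. -/
noncomputable def mkSetup (g : Oracle n) (c Z : ℕ) (word : ℕ → ℕ) : Setup n where
  E := famAddr g c (numScales n c)
  N := (insts g c (numScales n c)).length
  inst := instAt g c
  word := word
  Z := Z

theorem startCom_wp {word : ℕ → ℕ} {r₀ : ℕ → ℕ → Bool} {c₁ x : ℕ} (hn : 2 ≤ n)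
    (hb : GenBounds g (c₁ * x) Z W) (hc₁ : c₁ ≤ Z)
    (hN0 : 0 < (mkSetup g (c₁ * x) Z word).N) (hNZ : 4 * (mkSetup g (c₁ * x) Z word).N + 4 ≤ Z)
    (hst : ∀ j < (mkSetup g (c₁ * x) Z word).N,
      InstStart st (word j) Z (r₀ j) (instAt g (c₁ * x) j) (ms j))
    (h0 : ∀ j < (mkSetup g (c₁ * x) Z word).N, ms j 0 = 0)
    (hr : ∀ j < (mkSetup g (c₁ * x) Z word).N, ∀ y,
      r (phys (mkSetup g (c₁ * x) Z word).E (4 * j + 1) y) = r₀ j y)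
    (hs0 : s.reg 0 = n) (hs1 : s.reg 1 = x) (hle : RegLe (Z ^ 4) s) (hh : ∀ y, s.heap y = 0)
    (hc : s.calls = []) :
    WP W g r (startCom c₁ st) (fun s' => WorldOK (mkSetup g (c₁ * x) Z word) s' ⊥ ms ∧
      s'.reg 0 = 0) s := by
  refine WP.seq ((genCom_wp hb hc₁ hs0 hs1 hle hh hc).mono fun s₁ hg => ?_)
  refine (instPhaseCom_wp hn hb rfl hNZ hst hr hg).mono ?_
  rintro s₂ ⟨b₁, b₂, b₃, b₄, b₅, b₆⟩
  refine ⟨⟨b₂, b₆.reg5, b₃, b₅, fun j hj => ⟨b₆.table j hj, fun v => ?_, b₆.mem j hj, ?_⟩,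
    fun j hj => (hst j hj).mem_le, by rw [b₄]; exact hN0, fun j hj => ?_⟩, b₁⟩
  · obtain ⟨t, ht, i, rfl⟩ := exists_instAt g (c₁ * x) le_rfl hj
    change s₂.heap ((instAt g (c₁ * x) _).tb + v) = ((instAt g (c₁ * x) _).f v : ℕ)
    rw [instAt_eq g _ ht i]
    exact mkInst_table g _ (hg.layout.congr b₆.low) ht i v
  · have hz : ∀ i, (i = 4 * j + 2 ∨ i = 4 * j + 3 ∨ i = 4 * j + 4) → ∀ y,
        s₂.arr (mkSetup g (c₁ * x) Z word).E i y = 0 := fun i hi y =>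
      b₆.zero i y (by omega) fun j' _ => by omega
    have := edgeLists_bot (f := ((mkSetup g (c₁ * x) Z word).inst j).f)
    unfold ListsOK
    convert this using 1
    · exact funext (hz _ (Or.inl rfl))
    · exact funext fun κ => funext fun i => hz _ (Or.inr (Or.inl rfl)) _
    · exact funext (hz _ (Or.inr (Or.inr rfl)))
  · rw [h0 j hj]; exact Nat.zero_le _

end

/-! ### The algorithm -/

/-- The dynamic matching algorithm that maintains the matchings of all concatenations with `A`; the
ratio of consecutive scales is about `1 + ε / c₁`. -/
def boost (c₁ : ℕ) (A : Algo) : Algo where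
  start := startCom c₁ A.start
  update := updateCom A.update
  mate := mateCom A.mate

theorem boost_callsOnlyAtStart (c₁ : ℕ) (A : Algo) : (boost c₁ A).CallsOnlyAtStart := by
  simp [Algo.CallsOnlyAtStart, boost, updateCom, instCom, crossCom, insertCom, eraseCom, runCom,
    mateCom, decodeCom, Com.CallFree, sim_callFree]

theorem boost_deterministic (c₁ : ℕ) {A : Algo} (h : A.Deterministic) :
    (boost c₁ A).Deterministic := by
  obtain ⟨h₁, h₂, h₃⟩ := h
  simp [Algo.Deterministic, boost, updateCom, instCom, crossCom, insertCom, eraseCom, runCom,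
    mateCom, decodeCom, Com.RandFree, sim_randFree, startCom, genCom, instPhaseCom, rowCom,
    paramsCom, h₁, h₂, h₃]

theorem instPhaseCom_callFree (st : Com) : (instPhaseCom st).CallFree := by
  simp [instPhaseCom, rowCom, paramsCom, Com.CallFree, sim_callFree]

/-- The state at the beginning of the preprocessing. -/
def startState (n x : ℕ) : State := ⟨startMem n x, fun _ => 0, 0, []⟩

theorem rel_startState (n x : ℕ) : Rel (startMem n x) (startState n x) :=
  ⟨fun _ _ => rfl, fun y hy => by
    change startMem n x y = 0
    rw [startMem, if_neg (by omega), if_neg (by omega)]⟩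

theorem regLe_startState {n x B : ℕ} (hn : n ≤ B) (hx : x ≤ B) : RegLe B (startState n x) := by
  intro i _
  change startMem n x i ≤ B
  unfold startMem
  split_ifs <;> omega

/-- The claim concerns every execution, with arbitrary answers and word size. For a huge word size
`genCom_wp` provides an execution that calls precisely the scales, which are distinct; executions do
not depend on the word size (`Exec.unique`), so the given one makes the same calls. The second phase
makes none. -/
theorem boost_singleCalls (c₁ : ℕ) (A : Algo) : (boost c₁ A).SingleCalls := by
  intro n x W g r m t l h
  cases h with
  | seq h₁ h₂ =>
    rename_i m₁ t₁ t₂ l₁ l₂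
    rw [h₂.calls_eq_nil (instPhaseCom_callFree _), List.append_nil]
    set Z := 64 + n + c₁ + x + c₁ * x + famAddr g (c₁ * x) (numScales n (c₁ * x)) +
      ∑ t ∈ Finset.range (numScales n (c₁ * x)), (g (scale (c₁ * x) t)).parts with hZ
    have hb : GenBounds g (c₁ * x) Z (Z ^ 20) := by
      refine ⟨by omega, le_rfl, by omega, by omega, by omega, fun t ht => ?_⟩
      have := Finset.single_le_sum (f := fun t => (g (scale (c₁ * x) t)).parts)
        (fun _ _ => Nat.zero_le _) (Finset.mem_range.2 ht)
      omega
    have hZ4 : Z ≤ Z ^ 4 := Nat.le_self_pow (by omega) Z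
    obtain ⟨m', t', l', s', h', -, -, h₃, h₄⟩ := genCom_wp (r := r) (s := startState n x) hb
      (by omega) rfl rfl (regLe_startState (by omega) (by omega)) (fun _ => rfl) rfl _
      (rel_startState n x)
    obtain ⟨-, -, rfl⟩ := h₁.unique h'
    have h₅ := h₄.calls
    rw [h₃] at h₅
    rw [show l₁ = (List.range (numScales n (c₁ * x))).map (scale (c₁ * x)) by
      simpa [startState] using h₅]
    exact List.Nodup.map (scale_strictMono _).injective List.nodup_range

/-! ### Runs -/

theorem Rel.setReg {m : Mem} {s : State} (h : Rel m s) {i : ℕ} (v : ℕ) (hi : i < 32) :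
    Rel (Function.update m i v) (s.setReg i v) := by
  refine ⟨fun y hy => ?_, fun y hy => ?_⟩
  · rw [Function.update_apply, State.setReg_reg]
    split_ifs
    · rfl
    · exact h.1 y hy
  · rw [Function.update_of_ne (by omega)]
    exact h.2 y hy

theorem exists_seq_of_step {β : Type*} [Inhabited β] {P : ℕ → β → Prop} {R : ℕ → β → β → ℕ → Prop}
    (H : ℕ) {b : β} (h0 : P 0 b) (hs : ∀ s < H, ∀ b, P s b → ∃ b' c, P (s + 1) b' ∧ R s b b' c) :
    ∃ (f : ℕ → β) (cost : ℕ → ℕ), f 0 = b ∧ (∀ s ≤ H, P s (f s)) ∧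
      ∀ s < H, R s (f s) (f (s + 1)) (cost s) := by
  choose! nxt c h₁ h₂ using hs
  let f : ℕ → β := fun s => Nat.rec b (fun s b => nxt s b) s
  have hP : ∀ s ≤ H, P s (f s) := by
    intro s
    induction s with
    | zero => exact fun _ => h0
    | succ s ih => exact fun hs => h₁ s (by omega) _ (ih (by omega))
  exact ⟨f, fun s => c s (f s), rfl, hP, fun s hs => h₂ s hs _ (hP s hs.le)⟩

theorem updateMem_le {n W : ℕ} {G : SimpleGraph (Fin n)} {p : Pair n} {m : Mem} (hW : 1 ≤ W)
    (hn : n ≤ W) (hm : ∀ y, m y ≤ W) (y : ℕ) : updateMem G p m y ≤ W := by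
  have h₁ := p.1.1.2
  have h₂ := p.1.2.2
  have h₃ := hm y
  unfold updateMem
  simp only [Function.update_apply]
  split_ifs <;> omega

theorem IsMatching.card_bot {V : Type} {M : Finset (Sym2 V)} (h : IsMatching ⊥ M) : M.card = 0 := by
  rw [Finset.card_eq_zero, Finset.eq_empty_iff_forall_notMem]
  intro e he
  simpa using h.1 e he

section Run

variable {n W Z : ℕ} {S : Setup n} {g : Oracle n} {A : Algo} {G : SimpleGraph (Fin n)}

/-- From the matching of the best instance a matching of the graph is obtained. -/
theorem holds_of_worldOK {c₁ q q' : ℕ} {α β : ℝ} {γ : ℕ → ℝ} {s : State} {m : Mem}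
    {ms : ℕ → Mem} (hα : 0 ≤ α) (hS : S.Valid W)
    (hmate : ∀ j < S.N, SimData A.mate (S.word j) S.Z) (hw : WorldOK S s G ms) (hm : Rel m s)
    (h0 : s.reg 0 = ms (s.reg 7) 0)
    (hH : ∀ j < S.N, Holds A (S.word j) (noOracle (S.inst j).np ()) q α (γ j)
      (concat G (S.inst j).f) (ms j))
    (hβ : ∀ b : ℕ, (∀ j < S.N, (matchNum (concat G (S.inst j).f) : ℝ) ≤ α * b + γ j) →
      (matchNum G : ℝ) ≤ β * b)
    (hq : 400 + 40 * q ≤ q') : Holds (boost c₁ A) W g q' β 0 G m := by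
  classical
  have hbest := hw.best
  have hlt := hw.best_lt
  generalize hj : s.reg 7 = j at h0 hbest hlt
  obtain ⟨M, hM, -, hMc, hMq⟩ := hH j hlt
  obtain ⟨-, -, -, hL⟩ := hw.inst j hlt
  set f := (S.inst j).f with hf
  -- Representatives are the heads of the lists, not arbitrary edges: the last clause links the
  -- lifted matching with what a query reads.
  have hrep : ∀ e : Sym2 (Fin (S.inst j).np), ∃ e' : Sym2 (Fin n), e ∈ M →
      (e' ∈ G.edgeSet ∧ e'.map f = e) ∧ ∀ a b, e = s(a, b) → ∃ u w, e' = s(u, w) ∧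
        s.arr S.E (4 * j + 3) (pr (enc n a b) 0) = enc n u w := by
    intro e
    induction e using Sym2.ind with
    | _ a b =>
    by_cases he : s(a, b) ∈ M
    · obtain ⟨u, w, h₁, h₂, h₃, h₄⟩ := hL.exists_head (hS.inst_valid j hlt).1 (hM.1 _ he)
      refine ⟨s(u, w), fun _ => ⟨⟨h₁, by simp [h₂, h₃]⟩, fun a' b' hab => ⟨u, w, rfl, ?_⟩⟩⟩
      rcases Sym2.eq_iff.1 hab with ⟨rfl, rfl⟩ | ⟨rfl, rfl⟩
      · exact h₄
      · rw [show enc n b a = enc n a b from enc_comm _ _ _]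
        exact h₄
    · have v : Fin n := ⟨0, by
        have h1 := a.2
        have h2 := (hS.inst_valid j hlt).1
        omega⟩
      exact ⟨s(v, v), fun h => absurd h he⟩
  choose rep hrep using hrep
  obtain ⟨hM', hc'⟩ := hM.image_rep rep fun e he => (hrep e he).1
  have hmem : ∀ v w, s(v, w) ∈ M.image rep → s(f v, f w) ∈ M ∧ rep s(f v, f w) = s(v, w) := by
    intro v w h
    obtain ⟨e, he, h⟩ := Finset.mem_image.1 h
    have := (hrep e he).1.2
    rw [h, Sym2.map_mk] at this
    rw [this]
    exact ⟨he, h⟩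
  refine ⟨M.image rep, hM', ?_, ?_, fun v => ?_⟩
  · rw [hc', add_zero]
    refine hβ _ fun i hi => ?_
    obtain ⟨Mi, -, h₁, h₂, -⟩ := hH i hi
    have h₃ : Mi.card ≤ M.card := by rw [← h₂, ← hMc]; exact hbest i hi
    have h₄ : (Mi.card : ℝ) ≤ M.card := by exact_mod_cast h₃
    nlinarith [mul_le_mul_of_nonneg_left h₄ hα]
  · rw [hm.1 0 (by omega), h0, hMc, hc']
  obtain ⟨m₁, t, l, hx, ht, hres⟩ := hMq (f v)
  have key := mateCom_wp (g := g) (r := fun _ => false) hS hw hj (hmate j hlt) (fun _ => rfl) hx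
    (fun x => (x = 0 ∧ ∀ w, s(v, w) ∉ M.image rep) ∨ ∃ w : Fin n, s(v, w) ∈ M.image rep ∧ x = w + 1)
    ?_ _ (hm.setReg (v : ℕ) (by omega))
  · obtain ⟨m', t', l', s', hx', hm₁, ht', -, hR, hT⟩ := key
    refine ⟨m', t', l', hx', ?_, ?_⟩
    · simp only [State.setReg_time] at ht'
      omega
    · rw [hm₁.1 0 (by omega)]; exact hR
  · rcases hres with ⟨h₁, h₂⟩ | ⟨b, h₁, h₂⟩
    · exact Or.inl ⟨h₁, Or.inl ⟨rfl, fun w hw => h₂ _ (hmem v w hw).1⟩⟩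
    · obtain ⟨u, w, h₃, h₄⟩ := (hrep _ h₁).2 _ _ rfl
      have huw : s(u, w) ∈ M.image rep := h₃ ▸ Finset.mem_image_of_mem rep h₁
      refine Or.inr ⟨b, u, w, h₂, h₄, ?_, ?_, fun hu hw => Or.inl ⟨rfl, fun w' hw' => ?_⟩⟩
      · rintro rfl
        exact Or.inr ⟨w, huw, rfl⟩
      · rintro rfl
        exact Or.inr ⟨u, by rwa [Sym2.eq_swap], rfl⟩
      -- A lifted edge at `v` comes from the only matched edge at the part of `v`, so it would be
      -- its representative {u, w}, which does not contain `v`.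
      · obtain ⟨h₅, h₆⟩ := hmem v w' hw'
        have h₇ := hM.2 _ h₅ _ h₁ (f v) (Sym2.mem_mk_left _ _) (Sym2.mem_mk_left _ _)
        rw [h₇, h₃] at h₆
        rcases Sym2.eq_iff.1 h₆ with ⟨rfl, -⟩ | ⟨-, rfl⟩
        · exact hu rfl
        · exact hw rfl

/-- The successful runs of `A` on the concatenations give a run of the boosted algorithm. -/
theorem boost_run {c₁ x q q' H : ℕ} {α β : ℝ} {γ τ : ℕ → ℝ} {tm : TimeMode} {k : ℕ → ℕ}
    {word : ℕ → ℕ} {moves : ℕ → Option (Pair n)} {r : ℕ → ℕ → Bool} (hn : 2 ≤ n) (hα : 0 ≤ α)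
    (hb : GenBounds g (c₁ * x) Z W) (hc₁ : c₁ ≤ Z) (hx : x ≤ Z)
    (hSd : S = mkSetup g (c₁ * x) Z word) (hS : S.Valid W)
    (hD : ∀ j < S.N, (S.inst j).D ≤ S.word j)
    (hstart : ∀ j < S.N, SimData A.start (S.word j) S.Z)
    (hupd : ∀ j < S.N, SimData A.update (S.word j) S.Z)
    (hmate : ∀ j < S.N, SimData A.mate (S.word j) S.Z)
    (hrun : ∀ j < S.N, RunSucceeds A (S.inst j).D (S.word j) q α (γ j) (τ j) tm (k j)
      (noOracle (S.inst j).np ()) (instMoves (S.inst j).f moves)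
      (fun s y => r s (phys S.E (4 * j + 1) y)) H)
    (hβ : ∀ (G : SimpleGraph (Fin n)) (b : ℕ),
      (∀ j < S.N, (matchNum (concat G (S.inst j).f) : ℝ) ≤ α * b + γ j) →
      (matchNum G : ℝ) ≤ β * b)
    (hq : 400 + 40 * q ≤ q') :
    ∃ (mem : ℕ → Mem) (cost : ℕ → ℕ) (costs : ℕ → ℕ → ℕ),
      (∃ t l, Exec W g (r 0) (boost c₁ A).start (startMem n x) (mem 0) t l) ∧
      (∀ s < H,
        match moves s with
        | none => mem (s + 1) = mem s ∧ cost s = 0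
        | some p => ∃ l, Exec W g (r (s + 1)) (boost c₁ A).update
            (updateMem (graphAt moves s) p (mem s)) (mem (s + 1)) (cost s) l) ∧
      (∀ s ≤ H, Holds (boost c₁ A) W g q' β 0 (graphAt moves s) (mem s)) ∧
      (∀ j < S.N, TimeBound (k j) (τ j) (instMoves (S.inst j).f moves) (costs j) H tm) ∧
      ∀ s < H, cost s ≤ if (moves s).isSome then
        100 + ∑ j ∈ Finset.range S.N, (510 + 40 * costs j s) else 0 := by
  choose! mems costs hrun using hrun
  -- The simulation requires that the cells of a copy fit into its own words; call-free programs
  -- preserve this.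
  have hle : ∀ j < S.N, ∀ s ≤ H, ∀ y, mems j s y ≤ S.word j := by
    intro j hj s
    obtain ⟨⟨t, l, hx₀⟩, hstep, -⟩ := hrun j hj
    have hnp := hS.np_le j hj
    induction s with
    | zero =>
      exact fun _ => hx₀.le_word (hstart j hj).callFree (hstart j hj).one_le
        (InstStart.startMem_le ⟨⟨t, l, hx₀⟩, hstart j hj, hnp, hD j hj⟩)
    | succ s ih =>
      intro hs
      have h := hstep s (by omega)
      split at h
      · rw [h.1]; exact ih (by omega)
      · obtain ⟨l, h⟩ := h
        exact h.le_word (hupd j hj).callFree (hupd j hj).one_le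
          (updateMem_le (hupd j hj).one_le hnp (ih (by omega)))
  have hholds : ∀ j < S.N, ∀ s ≤ H, Holds A (S.word j) (noOracle (S.inst j).np ()) q α (γ j)
      (concat (graphAt moves s) (S.inst j).f) (mems j s) := fun j hj s hs => by
    rw [← graphAt_instMoves]; exact (hrun j hj).2.2.1 s hs
  have hZ4 : Z ≤ Z ^ 4 := Nat.le_self_pow (by omega) Z
  have hst : WP W g (r 0) (startCom c₁ A.start) (fun s' => WorldOK S s' ⊥ (fun j => mems j 0) ∧
      s'.reg 0 = 0) (startState n x) := by
    subst hSd
    refine startCom_wp (r₀ := fun j y => r 0 (phys (mkSetup g (c₁ * x) Z word).E (4 * j + 1) y)) hn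
      hb hc₁ hS.N_pos hS.N_le (fun j hj => ⟨(hrun j hj).1, hstart j hj, hS.np_le j hj, hD j hj⟩)
      (fun j hj => ?_) (fun _ _ _ => rfl) rfl rfl
      (regLe_startState (hb.n_le.trans hZ4) (hx.trans hZ4)) (fun _ => rfl) rfl
    obtain ⟨M, hM, -, h, -⟩ := (hrun j hj).2.2.1 0 (Nat.zero_le _)
    rw [h]; exact hM.card_bot
  obtain ⟨m₀, t₀, l₀, s₀, hx₀, hm₀, -, -, hw₀, h0₀⟩ := hst _ (rel_startState n x)
  have hz : ∀ j < S.N, mems j 0 0 = 0 := fun j hj => by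
    obtain ⟨M, hM, -, h, -⟩ := (hrun j hj).2.2.1 0 (Nat.zero_le _)
    rw [h]; exact hM.card_bot
  -- The memories of the copies are prescribed by their successful runs; round by round a memory of
  -- the machine is chosen that contains them.
  have hseq := exists_seq_of_step (β := Mem)
    (P := fun s m => ∃ σ, Rel m σ ∧ WorldOK S σ (graphAt moves s) (fun j => mems j s) ∧
      σ.reg 0 = mems (σ.reg 7) s 0)
    (R := fun s m m' c => (match moves s with
        | none => m' = m ∧ c = 0
        | some p => ∃ l, Exec W g (r (s + 1)) (boost c₁ A).update
            (updateMem (graphAt moves s) p m) m' c l) ∧ c ≤ if (moves s).isSome then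
        100 + ∑ j ∈ Finset.range S.N, (510 + 40 * costs j s) else 0) H (b := m₀)
    ⟨s₀, hm₀, hw₀, by rw [h0₀, hz _ hw₀.best_lt]⟩ ?_
  · obtain ⟨mem, cost, h₁, h₂, h₃⟩ := hseq
    refine ⟨mem, cost, costs, ⟨t₀, l₀, h₁ ▸ hx₀⟩, fun s hs => (h₃ s hs).1, fun s hs => ?_,
      fun j hj => (hrun j hj).2.2.2, fun s hs => (h₃ s hs).2⟩
    obtain ⟨σ, a₁, a₂, a₃⟩ := h₂ s hs
    exact holds_of_worldOK hα hS hmate a₂ a₁ a₃ (fun j hj => hholds j hj s hs) (hβ _) hq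
  · rintro s hs m ⟨σ, a₁, a₂, a₃⟩
    cases hp : moves s with
    | none =>
      refine ⟨m, 0, ⟨σ, a₁, ?_⟩, ⟨rfl, rfl⟩, by simp⟩
      have he : ∀ j < S.N, mems j (s + 1) = mems j s := fun j hj => by
        have := (hrun j hj).2.1 s hs
        rw [show instMoves (S.inst j).f moves s = none by simp [instMoves, hp]] at this
        exact this.1
      rw [graphAt_succ_none hp]
      refine ⟨⟨a₂.reg4, a₂.reg5, a₂.reg6, a₂.regLe, fun j hj => ?_, fun j hj => ?_, a₂.best_lt,
        fun j hj => ?_⟩, ?_⟩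
      · rw [he j hj]; exact a₂.inst j hj
      · rw [he j hj]; exact a₂.mem_le j hj
      · rw [he j hj, he _ a₂.best_lt]; exact a₂.best j hj
      · rw [he _ a₂.best_lt]; exact a₃
    | some p =>
      have key := updateCom_wp (g := g) (r := r (s + 1)) (ms' := fun j => mems j (s + 1))
        (r₀ := fun j y => r (s + 1) (phys S.E (4 * j + 1) y)) (cost := fun j => costs j s) (p := p)
        (g₀ := fun j => noOracle (S.inst j).np ()) hS hupd
        a₂ (fun j hj => hle j hj (s + 1) (by omega)) (fun _ _ _ => rfl) (fun j hj => ?_) rfl _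
        (((a₁.setReg _ (by omega)).setReg _ (by omega)).setReg _ (by omega))
      · obtain ⟨m', t', l', s', hx', hm', ht', -, b₁, b₂, -, b₃⟩ := key
        refine ⟨m', t', ⟨s', hm', ?_, b₂⟩, ⟨l', hx'⟩, ?_⟩
        · rw [graphAt_succ_some hp]; exact b₁
        · simp only [State.setReg_time] at ht'
          simp only [Option.isSome_some, if_true]
          omega
      · have := (hrun j hj).2.1 s hs
        rw [show instMoves (S.inst j).f moves s = stepMove (S.inst j).f (graphAt moves s) p by
          simp [instMoves, hp], graphAt_instMoves] at this
        exact this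

end Run

/-! ### Approximation -/

section Approximation

variable {n : ℕ} {g : Oracle n} {c : ℕ}

/-- All answers that are used are matching preserving. -/
def Preserving (g : Oracle n) (c : ℕ) (η : ℝ) : Prop :=
  ∀ t < numScales n c, ∀ G : SimpleGraph (Fin n),
    (g (scale c t)).MatchingPreserving G (scale c t) η

/-- The partition of an instance refines the original one: the identity refines everything, and
adding empty parts is undone by a left inverse. So merging gives the inequality. Without any parts
there is no left inverse, but then μ is 0. -/
theorem matchNum_concat_part_le (G : SimpleGraph (Fin n)) (F : Family n) (k addr : ℕ)
    (i : Fin F.num) :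
    matchNum (concat G (F.part i)) ≤ matchNum (concat G (mkInst F k c addr i).f) := by
  by_cases h : n < F.parts
  · rw [mkInst, if_pos h]
    exact matchNum_concat_comp_le G id (F.part i)
  · rw [mkInst, if_neg h]
    rcases Nat.eq_zero_or_pos F.parts with h0 | h0
    · refine le_trans (le_of_eq ?_) (Nat.zero_le _)
      have := two_mul_matchNum_le (concat G (F.part i))
      rw [Fintype.card_fin] at this
      omega
    · have : Nonempty (Fin F.parts) := ⟨⟨0, h0⟩⟩
      obtain ⟨h, hh⟩ := (Fin.castLE_injective (le_max_right 2 F.parts)).hasLeftInverse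
      have := matchNum_concat_comp_le G (fun v => (F.part i v).castLE (le_max_right 2 F.parts)) h
      rwa [show h ∘ (fun v => (F.part i v).castLE (le_max_right 2 F.parts)) = F.part i from
        funext fun v => hh _] at this

theorem two_le_instAt_np (hn : 2 ≤ n) {j : ℕ} (hj : j < (insts g c (numScales n c)).length) :
    2 ≤ (instAt g c j).np := by
  obtain ⟨t, ht, i, rfl⟩ := exists_instAt g c le_rfl hj
  rw [instAt_eq g c ht i, mkInst]
  split_ifs
  · exact hn
  · exact le_max_left _ _

theorem instAt_valid (hn : 2 ≤ n) {j : ℕ} (hj : j < (insts g c (numScales n c)).length) :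
    (instAt g c j).Valid (famAddr g c (numScales n c)) := by
  obtain ⟨t, ht, i, rfl⟩ := exists_instAt g c le_rfl hj
  rw [instAt_eq g c ht i]
  exact mkInst_valid g c hn ht i

theorem mkInst_D (F : Family n) (k addr : ℕ) (i : Fin F.num) :
    (mkInst F k c addr i).D = (mkInst F k c addr i).np * c / k + 1 := by
  by_cases h : n < F.parts
  · rw [mkInst, if_pos h]
  · rw [mkInst, if_neg h]

/-- The additive error of an instance. -/
theorem mkInst_error_le (F : Family n) {k : ℕ} (hk : 0 < k) (hc : 0 < c) (addr : ℕ)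
    (i : Fin F.num) :
    ((mkInst F k c addr i).np : ℝ) / (mkInst F k c addr i).D ≤ k / c := by
  rw [mkInst_D]
  set p := (mkInst F k c addr i).np
  have h := Nat.lt_div_mul_add (a := p * c) hk
  have h' : p * c ≤ k * (p * c / k + 1) := by rw [Nat.mul_add, Nat.mul_comm k]; omega
  rw [div_le_div_iff₀ (by positivity) (by positivity)]
  exact_mod_cast h'

theorem exists_scale_le {μ : ℕ} (hμ : 1 ≤ μ) :
    ∃ t, scale c t ≤ μ ∧ μ < scale c (t + 1) := by
  have h : ∃ t, μ < scale c t := ⟨μ, by have := succ_le_scale c μ; omega⟩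
  have h₁ := Nat.find_spec h
  obtain ⟨t, ht⟩ : ∃ t, Nat.find h = t + 1 := Nat.exists_eq_succ_of_ne_zero fun h0 => by
    rw [h0, scale] at h₁; omega
  refine ⟨t, not_lt.1 (Nat.find_min h (m := t) (by omega)), ?_⟩
  rwa [ht] at h₁

/-- Matching preservation for a single edge of the complete graph, at scale 1, already demands a
partition. -/
theorem insts_length_pos (hn : 2 ≤ n) {η : ℝ} (hg : Preserving g c η) :
    0 < (insts g c (numScales n c)).length := by
  have h0 : 0 < numScales n c := lt_numScales.2 (by simpa [scale] using hn)
  let M : Finset (Sym2 (Fin n)) := {s(⟨0, by omega⟩, ⟨1, by omega⟩)}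
  have hM : IsMatching (⊤ : SimpleGraph (Fin n)) M := by
    refine ⟨fun e he => ?_, fun e he f hf v _ _ => ?_⟩
    · rw [Finset.mem_singleton.1 he]
      simp
    · rw [Finset.mem_singleton.1 he, Finset.mem_singleton.1 hf]
  obtain ⟨i, -⟩ := hg 0 h0 ⊤ M hM (by simp [M, scale])
  refine lt_of_lt_of_le ?_ (length_insts_mono g c (Nat.succ_le_of_lt h0))
  simp only [Nat.succ_eq_add_one, length_insts_succ]
  have := i.2
  omega

/-- If all instances are solved up to the factor `α` and their additive error, so is the graph. -/
theorem matchNum_le_of_insts {α ε η : ℝ} {c₁ : ℕ} (hα : 1 ≤ α) (hε : 0 < ε) (hε1 : ε < 1)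
    (hc₁ : 5 * α ≤ c₁) (hc : (c₁ : ℝ) / ε ≤ c) (hη : η ≤ ε / c₁) (hg : Preserving g c η)
    (G : SimpleGraph (Fin n)) (b : ℕ)
    (h : ∀ j < (insts g c (numScales n c)).length,
      (matchNum (concat G (instAt g c j).f) : ℝ) ≤
        α * b + (instAt g c j).np / (instAt g c j).D) :
    (matchNum G : ℝ) ≤ (α + ε) * b := by
  have hc₁' : (0 : ℝ) < c₁ := by linarith
  have hc0 : (0 : ℝ) < c := lt_of_lt_of_le (by positivity) hc
  have hcn : 0 < c := by exact_mod_cast hc0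
  rcases Nat.eq_zero_or_pos (matchNum G) with h0 | h0
  · rw [h0]; push_cast; positivity
  -- This scale k has k ≤ μ(G) ≤ k + k/c, and the generator was called for it because 2k ≤ 2μ(G) ≤
  -- n.
  obtain ⟨t, ht, ht'⟩ := exists_scale_le (c := c) h0
  have hμ := two_mul_matchNum_le G
  rw [Fintype.card_fin] at hμ
  have htn : t < numScales n c := lt_numScales.2 (by omega)
  obtain ⟨M, hM, hMc⟩ := exists_isMatching_card_eq G ht
  obtain ⟨i, hi⟩ := hg t htn G M hM hMc
  have hk : 0 < scale c t := by have := succ_le_scale c t; omega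
  have hj : (insts g c t).length + i < (insts g c (numScales n c)).length := by
    refine lt_of_lt_of_le ?_ (length_insts_mono g c (Nat.succ_le_of_lt htn))
    simp only [Nat.succ_eq_add_one, length_insts_succ]
    have := i.2
    omega
  have h₁ := h _ hj
  rw [instAt_eq g c htn i] at h₁
  have h₂ := mkInst_error_le (g (scale c t)) hk hcn (famAddr g c t) i
  have h₃ : (matchNum (concat G ((g (scale c t)).part i)) : ℝ) ≤ _ :=
    Nat.cast_le.2 (matchNum_concat_part_le (c := c) G (g (scale c t)) (scale c t) (famAddr g c t) i)
  set k := scale c t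
  have h₄ : (matchNum G : ℝ) ≤ k + k / c := by
    have h₅ : matchNum G ≤ k + k / c := by
      have : scale c (t + 1) = k + 1 + k / c := rfl
      omega
    calc (matchNum G : ℝ) ≤ ((k + k / c : ℕ) : ℝ) := by exact_mod_cast h₅
      _ ≤ k + k / c := by push_cast; gcongr; exact Nat.cast_div_le
  have hδ : (1 : ℝ) / c ≤ ε / c₁ := by
    rw [div_le_div_iff₀ hc0 hc₁']
    rw [div_le_iff₀ hε] at hc
    linarith
  set δ := ε / c₁ with hδd
  have hk0 : (0 : ℝ) ≤ k := Nat.cast_nonneg _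
  have hkc : (k : ℝ) / c ≤ k * δ := by
    rw [div_eq_mul_one_div]; exact mul_le_mul_of_nonneg_left hδ hk0
  -- The chain is (1 - η)k ≤ μ(concatenation) ≤ αb + k/c, with η and 1/c both at most δ.
  have h₆ : (1 - 2 * δ) * k ≤ α * b := by nlinarith [mul_le_mul_of_nonneg_right hη hk0]
  have h₇ : (matchNum G : ℝ) ≤ (1 + δ) * k := by linarith
  have hδ0 : 0 < δ := by positivity
  have hδ5 : 5 * α * δ ≤ ε := by
    rw [hδd, ← mul_div_assoc, div_le_iff₀ hc₁']
    nlinarith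
  have h2 : 0 < 1 - 2 * δ := by nlinarith
  have hb0 : (0 : ℝ) ≤ b := Nat.cast_nonneg _
  -- The difference is ε - 3αδ - 2εδ ≥ ε - 5αδ ≥ 0, by ε < 1 ≤ α; this is where the factor 5 in the
  -- choice of `c₁` comes from.
  have h₈ : α * (1 + δ) ≤ (α + ε) * (1 - 2 * δ) := by nlinarith
  have h₉ : (1 - 2 * δ) * ((1 + δ) * k) ≤ (1 - 2 * δ) * ((α + ε) * b) := by
    nlinarith [mul_le_mul_of_nonneg_left h₆ (by linarith : (0 : ℝ) ≤ 1 + δ),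
      mul_le_mul_of_nonneg_right h₈ hb0]
  exact h₇.trans (le_of_mul_le_mul_left h₉ h2)

end Approximation

/-! ### Update times -/

section Time

variable {n np : ℕ} {moves : ℕ → Option (Pair n)}

theorem numUpdates_succ {a b : ℕ} (h : a ≤ b) :
    numUpdates moves a (b + 1) = numUpdates moves a b + if (moves b).isSome then 1 else 0 := by
  unfold numUpdates
  rw [← Finset.insert_Ico_right_eq_Ico_add_one h, Finset.filter_insert]
  split_ifs
  · rw [Finset.card_insert_of_notMem (by simp)]
  · rfl

theorem numUpdates_add {a m b : ℕ} (h : a ≤ m) (h' : m ≤ b) :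
    numUpdates moves a m + numUpdates moves m b = numUpdates moves a b := by
  unfold numUpdates
  rw [← Finset.Ico_union_Ico_eq_Ico h h', Finset.filter_union, Finset.card_union_of_disjoint]
  exact Finset.disjoint_filter_filter (Finset.Ico_disjoint_Ico_consecutive _ _ _)

/-- A discrete intermediate value argument: each round raises the count by at most one. -/
theorem exists_numUpdates_eq {a b : ℕ} (u : ℕ) (h : a ≤ b) (hu : u ≤ numUpdates moves a b) :
    ∃ m, a ≤ m ∧ m ≤ b ∧ numUpdates moves a m = u := by
  induction b, h using Nat.le_induction with
  | base => exact ⟨a, le_rfl, le_rfl, by simp [numUpdates] at hu ⊢; exact hu.symm⟩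
  | succ b h ih =>
    by_cases hb : u ≤ numUpdates moves a b
    · obtain ⟨m, h₁, h₂, h₃⟩ := ih hb
      exact ⟨m, h₁, by omega, h₃⟩
    · refine ⟨b + 1, by omega, le_rfl, ?_⟩
      rw [numUpdates_succ h] at hu ⊢
      split_ifs at hu ⊢ <;> omega

theorem numUpdates_instMoves_le (f : Fin n → Fin np) (a b : ℕ) :
    numUpdates (instMoves f moves) a b ≤ numUpdates moves a b :=
  Finset.card_le_card (Finset.monotone_filter_right _ fun _ _ => isSome_of_instMoves f)

/-- Amortization over `k` updates implies amortization over `d * k` updates. -/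
theorem TimeBound.amortized_mul {k H : ℕ} {τ : ℝ} {cost : ℕ → ℕ}
    (h : TimeBound k τ moves cost H .amortized) {d : ℕ} (hd : 1 ≤ d) :
    TimeBound (d * k) τ moves cost H .amortized := by
  induction d, hd using Nat.le_induction with
  | base => rwa [one_mul]
  | succ d hd ih =>
    intro a b hab hb hu
    have hle : ∀ m, a ≤ m → m ≤ b → numUpdates moves a m ≤ d * k → numUpdates moves m b ≤ k →
        ((∑ s ∈ Finset.Ico a b, cost s : ℕ) : ℝ) ≤ ((d + 1) * k : ℕ) * τ := by
      intro m h₁ h₂ h₃ h₄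
      rw [← Finset.sum_Ico_consecutive _ h₁ h₂]
      have h₅ := ih a m h₁ (h₂.trans hb) h₃
      have h₆ := h m b h₂ hb h₄
      push_cast at h₅ h₆ ⊢
      linarith
    by_cases hk : numUpdates moves a b ≤ d * k
    · exact hle b hab le_rfl hk (by simp [numUpdates])
    -- The interval is cut after exactly dk updates; at most k remain.
    · obtain ⟨m, h₁, h₂, h₃⟩ := exists_numUpdates_eq (d * k) hab (not_le.1 hk).le
      refine hle m h₁ h₂ h₃.le ?_
      have h₄ := numUpdates_add (moves := moves) h₁ h₂
      rw [Nat.add_mul, Nat.one_mul] at hu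
      omega

theorem sum_cost_le {N H : ℕ} {cost : ℕ → ℕ} {costs : ℕ → ℕ → ℕ}
    (hcost : ∀ s < H, cost s ≤ if (moves s).isSome then
      100 + ∑ j ∈ Finset.range N, (510 + 40 * costs j s) else 0) {a b : ℕ} (hb : b ≤ H) :
    ∑ s ∈ Finset.Ico a b, cost s ≤ numUpdates moves a b * (100 + 510 * N) +
      40 * ∑ j ∈ Finset.range N, ∑ s ∈ Finset.Ico a b, costs j s := by
  rw [Finset.sum_comm, Finset.mul_sum, numUpdates, Finset.card_filter, Finset.sum_mul,
    ← Finset.sum_add_distrib]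
  refine Finset.sum_le_sum fun s hs => (hcost s (by have := (Finset.mem_Ico.1 hs).2; omega)).trans
      ?_
  split_ifs
  · rw [Finset.sum_add_distrib, Finset.sum_const, Finset.card_range, ← Finset.mul_sum, smul_eq_mul]
    omega
  · exact Nat.zero_le _

/-- The update time of the boosted algorithm. -/
theorem timeBound_of_insts {N H K : ℕ} {cost : ℕ → ℕ} {costs : ℕ → ℕ → ℕ} {τ : ℝ} {tm : TimeMode}
    {k : ℕ → ℕ} {I : ℕ → Inst n} (hτ : 0 ≤ τ) (hK : 0 < K) (hk : ∀ j < N, k j ∣ K)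
    (hcost : ∀ s < H, cost s ≤ if (moves s).isSome then
      100 + ∑ j ∈ Finset.range N, (510 + 40 * costs j s) else 0)
    (h : ∀ j < N, TimeBound (k j) τ (instMoves (I j).f moves) (costs j) H tm) :
    TimeBound K (100 + N * (510 + 40 * τ)) moves cost H tm := by
  -- Common core of both amortized modes: `U` bounds the number of updates and `V` the time of a
  -- single copy. For windows U is the common multiple `K`, for the total it is the number of
  -- updates so far.
  have key : ∀ (a b U : ℕ) (V : ℝ), b ≤ H → numUpdates moves a b ≤ U →
      (∀ j < N, ((∑ s ∈ Finset.Ico a b, costs j s : ℕ) : ℝ) ≤ V) → V ≤ U * τ →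
      ((∑ s ∈ Finset.Ico a b, cost s : ℕ) : ℝ) ≤ U * (100 + N * (510 + 40 * τ)) := by
    intro a b U V hb hU hV hVU
    have h₁ : ((∑ s ∈ Finset.Ico a b, cost s : ℕ) : ℝ) ≤ _ := Nat.cast_le.2 (sum_cost_le hcost hb)
    have h₂ : ((∑ j ∈ Finset.range N, ∑ s ∈ Finset.Ico a b, costs j s : ℕ) : ℝ) ≤ N * V := by
      rw [Nat.cast_sum]
      refine (Finset.sum_le_card_nsmul _ _ V fun j hj => hV j (Finset.mem_range.1 hj)).trans ?_
      simp
    have h₃ : (numUpdates moves a b : ℝ) ≤ U := by exact_mod_cast hU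
    have hN : (0 : ℝ) ≤ N := Nat.cast_nonneg _
    rw [Nat.cast_add, Nat.cast_mul, Nat.cast_mul] at h₁
    push_cast at h₁ h₂ ⊢
    nlinarith [mul_le_mul_of_nonneg_right h₃ (by positivity : (0 : ℝ) ≤ 100 + 510 * N),
      mul_le_mul_of_nonneg_left hVU hN]
  cases tm with
  | worstCase =>
    intro s hs
    have h₁ := hcost s hs
    have h₂ : cost s ≤ 100 + ∑ j ∈ Finset.range N, (510 + 40 * costs j s) :=
      h₁.trans (by split_ifs <;> omega)
    have h₃ : (cost s : ℝ) ≤ _ := Nat.cast_le.2 h₂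
    refine h₃.trans ?_
    push_cast
    gcongr
    refine (Finset.sum_le_card_nsmul _ _ (510 + 40 * τ) fun j hj => ?_).trans
      (by rw [Finset.card_range, nsmul_eq_mul])
    have := h j (Finset.mem_range.1 hj) s hs
    linarith
  | amortized =>
    intro a b hab hb hu
    refine key a b K (K * τ) hb hu (fun j hj => ?_) le_rfl
    obtain ⟨d, hd⟩ := hk j hj
    have hd1 : 1 ≤ d := Nat.one_le_iff_ne_zero.2 fun h0 => by simp [h0] at hd; omega
    have := (h j hj).amortized_mul hd1
    rw [Nat.mul_comm, ← hd] at this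
    exact this a b hab hb ((numUpdates_instMoves_le _ _ _).trans hu)
  | total =>
    intro b hb
    refine key 0 b _ (numUpdates moves 0 b * τ) hb le_rfl (fun j hj => ?_) le_rfl
    refine (h j hj b hb).trans (mul_le_mul_of_nonneg_right ?_ hτ)
    exact_mod_cast numUpdates_instMoves_le _ _ _

theorem TimeBound.mono {k H : ℕ} {τ τ' : ℝ} {cost : ℕ → ℕ} {tm : TimeMode}
    (h : TimeBound k τ moves cost H tm) (hτ : τ ≤ τ') : TimeBound k τ' moves cost H tm := by
  cases tm with
  | worstCase => exact fun s hs => (h s hs).trans hτ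
  | amortized =>
    exact fun a b hab hb hu => (h a b hab hb hu).trans (by gcongr)
  | total => exact fun b hb => (h b hb).trans (by gcongr)

end Time

/-! ### Probabilities -/

section Prob

variable {A B : Type}

theorem prob_nonneg (E : A → Prop) : 0 ≤ prob A E := by unfold prob; positivity

theorem prob_mono [Finite A] {E F : A → Prop} (h : ∀ a, E a → F a) : prob A E ≤ prob A F := by
  unfold prob
  gcongr
  exact Nat.card_le_card_of_injective (fun a : {a // E a} => (⟨a.1, h _ a.2⟩ : {a // F a}))
    fun a b hab => Subtype.ext (by simpa using hab)

theorem prob_equiv (e : A ≃ B) (E : B → Prop) : prob A (fun a => E (e a)) = prob B E := by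
  unfold prob
  rw [Nat.card_congr e, Nat.card_congr (e.subtypeEquiv (p := fun a => E (e a)) (q := E)
    fun _ => Iff.rfl)]

theorem card_prod_subtype [Finite A] [Finite B] (E : A × B → Prop) :
    Nat.card {z // E z} = ∑ᶠ a, Nat.card {b // E (a, b)} := by
  have := Fintype.ofFinite A
  rw [finsum_eq_sum_of_fintype, Nat.card_congr (Equiv.subtypeProdEquivSigmaSubtype
    (fun a b => E (a, b))), Nat.card_sigma]

theorem prob_prod_le [Finite A] [Finite B] [Nonempty A] {E : A × B → Prop} {p : ℝ}
    (h : ∀ a, prob B (fun b => E (a, b)) ≤ p) : prob (A × B) E ≤ p := by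
  have := Fintype.ofFinite A
  have hp : 0 ≤ p := (prob_nonneg _).trans (h (Classical.arbitrary A))
  rcases isEmpty_or_nonempty B with hB | hB
  · unfold prob
    simpa using hp
  have hB' : (0 : ℝ) < Nat.card B := by exact_mod_cast Nat.card_pos
  have hA' : (0 : ℝ) < Nat.card A := by exact_mod_cast Nat.card_pos
  unfold prob
  rw [card_prod_subtype, finsum_eq_sum_of_fintype, Nat.card_prod, Nat.cast_mul,
    div_le_iff₀ (mul_pos hA' hB'), Nat.cast_sum]
  calc ∑ a, (Nat.card {b // E (a, b)} : ℝ) ≤ ∑ _a : A, p * Nat.card B :=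
        Finset.sum_le_sum fun a _ => (div_le_iff₀ hB').1 (h a)
    _ = p * (Nat.card A * Nat.card B) := by
        rw [Finset.sum_const, Finset.card_univ, ← Nat.card_eq_fintype_card, nsmul_eq_mul]
        ring

theorem prob_fst [Finite B] [Nonempty B] (E : A → Prop) :
    prob (A × B) (fun z => E z.1) = prob A E := by
  unfold prob
  have e : {z : A × B // E z.1} ≃ {a // E a} × B :=
    ⟨fun z => (⟨z.1.1, z.2⟩, z.1.2), fun z => ⟨(z.1.1, z.2), z.1.2⟩, fun _ => rfl, fun _ => rfl⟩
  rw [Nat.card_congr e, Nat.card_prod, Nat.card_prod]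
  have hB : (Nat.card B : ℝ) ≠ 0 := by exact_mod_cast Nat.card_pos.ne'
  push_cast
  exact mul_div_mul_right _ _ hB

theorem prob_or_le [Finite A] (E F : A → Prop) :
    prob A (fun a => E a ∨ F a) ≤ prob A E + prob A F := by
  classical
  have := Fintype.ofFinite A
  unfold prob
  rw [← add_div]
  gcongr
  simp only [Nat.card_eq_fintype_card, Fintype.card_subtype]
  rw [Finset.filter_or]
  exact_mod_cast Finset.card_union_le _ _

theorem prob_exists_lt_le [Finite A] (N : ℕ) (E : ℕ → A → Prop) {p : ℝ} (h : ∀ j < N, prob A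
    (E j) ≤ p) :
    prob A (fun a => ∃ j < N, E j a) ≤ N * p := by
  induction N with
  | zero => simp [prob]
  | succ N ih =>
    refine (prob_mono (F := fun a => (∃ j < N, E j a) ∨ E N a) ?_).trans ?_
    · rintro a ⟨j, hj, ha⟩
      rcases Nat.lt_succ_iff_lt_or_eq.1 hj with hj | rfl
      · exact Or.inl ⟨j, hj, ha⟩
      · exact Or.inr ha
    · refine (prob_or_le _ _).trans ?_
      have h₁ := ih fun j hj => h j (by omega)
      have h₂ := h N (by omega)
      push_cast
      linarith

/-- Conditioning on the first component, up to an exceptional event. -/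
theorem prob_prod_le_add [Finite A] [Finite B] [Nonempty A] [Nonempty B]
    {E : A × B → Prop} {bad : A → Prop} {p : ℝ}
    (hp : 0 ≤ p) (h : ∀ a, ¬ bad a → prob B (fun b => E (a, b)) ≤ p) :
    prob (A × B) E ≤ prob A bad + p := by
  refine (prob_mono (F := fun z => bad z.1 ∨ (¬ bad z.1 ∧ E z)) fun z hz => ?_).trans ?_
  · by_cases hb : bad z.1
    · exact Or.inl hb
    · exact Or.inr ⟨hb, hz⟩
  · refine (prob_or_le (fun z : A × B => bad z.1) fun z => ¬ bad z.1 ∧ E z).trans ?_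
    rw [prob_fst (B := B) bad]
    refine add_le_add le_rfl (prob_prod_le fun a => ?_)
    by_cases hb : bad a
    · simpa [prob, hb] using hp
    · simpa [hb] using h a hb

/-- A resampling principle: with independent coins in `B` added, an involution permutes the enlarged
sample space and keeps the probability of the event; the bound then holds conditionally on each
point of `A`. -/
theorem prob_le_of_involutive [Finite A] [Finite B] [Nonempty A] [Nonempty B]
    (Φ : A × B → A × B)
    (hΦ : Function.Involutive Φ) {E : A → Prop} {p : ℝ}
    (h : ∀ a, prob B (fun b => E (Φ (a, b)).1) ≤ p) : prob A E ≤ p := by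
  rw [← prob_fst (B := B) E, ← prob_equiv hΦ.toPerm (fun z => E z.1)]
  exact prob_prod_le h

theorem prob_pi_apply {ι : Type} [Finite ι] {X : ι → Type} [∀ i, Finite (X i)]
    [∀ i, Nonempty (X i)] (i : ι) (E : X i → Prop) :
    prob (∀ i, X i) (fun σ => E (σ i)) = prob (X i) E := by
  classical
  rw [← prob_fst (B := ∀ j : {j // j ≠ i}, X j) E, ← prob_equiv (Equiv.piSplitAt i X)]
  rfl

end Prob

/-! ### The random bits of one instance -/

section Seeds

variable {H R R' : ℕ}

open Classical in
/-- The seeds `ω` with the bits in the range of `e` replaced by `ω'`. -/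
noncomputable def Seeds.glue (e : Fin R' → Fin R) (ω : Seeds H R) (ω' : Seeds H R') : Seeds H R :=
  fun i x => if h : ∃ y, e y = x then ω' i h.choose else ω i x

theorem Seeds.glue_apply {e : Fin R' → Fin R} (he : Function.Injective e) (ω : Seeds H R)
    (ω' : Seeds H R') (i : Fin (H + 1)) (y : Fin R') : Seeds.glue e ω ω' i (e y) = ω' i y := by
  have h : ∃ y', e y' = e y := ⟨y, rfl⟩
  rw [Seeds.glue, dif_pos h, he h.choose_spec]

/-- Exchanging the bits at the positions `e` with fresh ones is an involution, so these bits may be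
resampled while all others are fixed. -/
theorem prob_seeds_le {e : Fin R' → Fin R} (he : Function.Injective e) {E : Seeds H R → Prop}
    {p : ℝ} (h : ∀ ω, prob (Seeds H R') (fun ω' => E (Seeds.glue e ω ω')) ≤ p) :
    prob (Seeds H R) E ≤ p := by
  refine prob_le_of_involutive (B := Seeds H R')
    (fun z => (Seeds.glue e z.1 z.2, fun i y => z.1 i (e y))) ?_ h
  rintro ⟨ω, ω'⟩
  refine Prod.ext (funext fun i => funext fun x => ?_)
    (funext fun i => funext fun y => Seeds.glue_apply he ω ω' i y)
  change Seeds.glue e (Seeds.glue e ω ω') _ i x = ω i x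
  by_cases hx : ∃ y, e y = x
  · obtain ⟨y, rfl⟩ := hx
    rw [Seeds.glue_apply he]
  · rw [Seeds.glue, dif_neg hx, Seeds.glue, dif_neg hx]

/-- Of R bits of the machine a copy sees an initial segment of its own bit sequence, so padding by
`false` means the same for both. -/
theorem exists_seeds_embedding {φ : ℕ → ℕ} (hφ : StrictMono φ) (R : ℕ) :
    ∃ R', (∀ y, y < R' ↔ φ y < R) := by
  have h : ∃ y, R ≤ φ y := ⟨R, hφ.le_apply⟩
  refine ⟨Nat.find h, fun y => ⟨fun hy => not_le.1 (Nat.find_min h hy), fun hy => ?_⟩⟩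
  by_contra hge
  have := hφ.monotone (not_lt.1 hge)
  have := Nat.find_spec h
  omega

/-- The failure probability of one instance inside a larger run. -/
theorem prob_instance_le {n np D W₀ q k R₀ : ℕ} {A : Algo} {α γ τ p : ℝ} {am : AdvMode}
    {tm : TimeMode} {φ : ℕ → ℕ} (hφ : StrictMono φ) (f : Fin n → Fin np)
    (hA : ∀ R ≥ R₀, ∀ adv : Unit → Seeds H R → ℕ → Option (Pair np), Allowed adv am →
      prob (Unit × Seeds H R) (fun z => ¬ RunSucceeds A D W₀ q α γ τ tm k (noOracle np z.1)
        (adv z.1 z.2) z.2.bit H) ≤ p)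
    (hR : φ R₀ ≤ R) {Coin : Type} {adv : Coin → Seeds H R → ℕ → Option (Pair n)}
    (hadv : Allowed adv am) (σ : Coin) :
    prob (Seeds H R) (fun ω => ¬ RunSucceeds A D W₀ q α γ τ tm k (noOracle np ())
      (instMoves f (adv σ ω)) (fun s y => ω.bit s (φ y)) H) ≤ p := by
  obtain ⟨R', hR'⟩ := exists_seeds_embedding hφ R
  let e : Fin R' → Fin R := fun y => ⟨φ y, (hR' y).1 y.2⟩
  have he : Function.Injective e := fun y y' h =>
    Fin.ext (hφ.injective (by simpa [e] using h))
  refine prob_seeds_le he fun ω => ?_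
  have hbit : ∀ ω' s y, (Seeds.glue e ω ω').bit s (φ y) = ω'.bit s y := by
    intro ω' s y
    unfold Seeds.bit
    by_cases h : s < H + 1 ∧ y < R'
    · rw [dif_pos h, dif_pos ⟨h.1, (hR' y).1 h.2⟩]
      exact Seeds.glue_apply he ω ω' ⟨s, h.1⟩ ⟨y, h.2⟩
    · rw [dif_neg h, dif_neg fun h' => h ⟨h'.1, (hR' y).2 h'.2⟩]
  have hR₀ : R₀ ≤ R' := by
    have h₁ : ¬ φ R' < R := fun h => lt_irrefl _ ((hR' R').2 h)
    exact hφ.le_iff_le.1 (hR.trans (not_lt.1 h₁))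
  -- The coins `σ` and the bits `ω` of the other copies are frozen and become part of the adversary
  -- that this copy faces.
  have key := hA R' hR₀
    (fun _ ω' => instMoves f (adv σ (Seeds.glue e ω ω'))) ?_
  · rw [← prob_equiv (Equiv.punitProd (Seeds H R')) _]
    refine le_trans (le_of_eq ?_) key
    congr 1
    funext z
    simp only [hbit]
    rfl
  · cases am with
    | oblivious =>
      intro _ _ ω₁ ω₂ s
      change instMoves f _ s = instMoves f _ s
      exact instMoves_congr f fun i _ => hadv σ σ _ _ i
    | adaptive =>
      -- Glued seeds agree up to index `s` if the bits of the copy do, so the induced adversary does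
      -- not look ahead either.
      intro _ ω₁ ω₂ s h
      refine instMoves_congr f fun i hi => hadv σ _ _ i fun i' hi' => funext fun x => ?_
      unfold Seeds.glue
      rw [h i' (by omega)]

end Seeds

/-! ### The guarantees of the boosted algorithm -/

theorem Maintains.mono {A : Algo} {n x W q : ℕ} {β γ τ τ' : ℝ} {p p' : ℕ → ℝ} {am : AdvMode}
    {tm : TimeMode} {Coin : Type} [Finite Coin] {g : Coin → Oracle n}
    (h : Maintains A n x W q β γ τ p am tm g) (hτ : τ ≤ τ') (hp : ∀ H, p H ≤ p' H) :
    Maintains A n x W q β γ τ' p' am tm g := by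
  obtain ⟨k, hk, h⟩ := h
  refine ⟨k, hk, fun H => ?_⟩
  obtain ⟨R₀, h⟩ := h H
  refine ⟨R₀, fun R hR adv hadv => le_trans ?_ ((h R hR adv hadv).trans (hp H))⟩
  refine prob_mono fun z hz hs => hz ?_
  obtain ⟨mem, cost, h₁, h₂, h₃, h₄⟩ := hs
  exact ⟨mem, cost, h₁, h₂, h₃, h₄.mono hτ⟩

/-- The part without probability: coins, bits and moves are fixed, the answers of the generator are
good, and all copies succeed. What remains is to combine `boost_run`, the approximation and the time
bound. -/
theorem boost_succeeds {n c₁ x b q q' H W Z K : ℕ} {A : Algo} {α ε η τ : ℝ} {T : ℕ → ℝ → ℝ}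
    {tm : TimeMode} {k : ℕ → ℕ → ℕ} {g : Oracle n} {moves : ℕ → Option (Pair n)}
    {r : ℕ → ℕ → Bool} {S : Setup n}
    (hn : 2 ≤ n) (hα : 1 ≤ α) (hε : 0 < ε) (hε1 : ε < 1) (hA : A.CallFree)
    (hAZ : A.start.cellBound ≤ Z ∧ A.update.cellBound ≤ Z ∧ A.mate.cellBound ≤ Z)
    (hb1 : 1 ≤ b) (hc₁ : 5 * α ≤ c₁) (hc : (c₁ : ℝ) / ε ≤ (c₁ * x : ℕ)) (hη : η ≤ ε / c₁)
    (hb : GenBounds g (c₁ * x) Z W) (hc₁Z : c₁ ≤ Z) (hxZ : x ≤ Z) (hg : Preserving g (c₁ * x) η)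
    (hS : S = mkSetup g (c₁ * x) Z
      fun j => ((instAt g (c₁ * x) j).np * (instAt g (c₁ * x) j).D + 2) ^ b)
    (hN : 4 * S.N + 4 ≤ Z) (hword : ∀ j < S.N, S.word j ≤ Z)
    (hq : 400 + 40 * q ≤ q') (hτ0 : 0 ≤ τ)
    (hτ : ∀ j < S.N, T (S.inst j).np (1 / (S.inst j).D) ≤ τ)
    (hK : 0 < K) (hk : ∀ j < S.N, k (S.inst j).np (S.inst j).D ∣ K)
    (hrun : ∀ j < S.N, RunSucceeds A (S.inst j).D (S.word j) q α
      ((S.inst j).np / (S.inst j).D) (T (S.inst j).np (1 / (S.inst j).D)) tm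
      (k (S.inst j).np (S.inst j).D) (noOracle (S.inst j).np ()) (instMoves (S.inst j).f moves)
      (fun s y => r s (phys S.E (4 * j + 1) y)) H) :
    RunSucceeds (boost c₁ A) x W q' (α + ε) 0 (100 + S.N * (510 + 40 * τ)) tm K g moves r H := by
  have hNe : S.N = (insts g (c₁ * x) (numScales n (c₁ * x))).length := by rw [hS]; rfl
  have hEe : S.E = famAddr g (c₁ * x) (numScales n (c₁ * x)) := by rw [hS]; rfl
  have hIe : S.inst = instAt g (c₁ * x) := by rw [hS]; rfl
  have hZe : S.Z = Z := by rw [hS]; rfl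
  have hwe : ∀ j, S.word j = ((S.inst j).np * (S.inst j).D + 2) ^ b := fun j => by rw [hS]; rfl
  have hD1 : ∀ j < S.N, 1 ≤ (S.inst j).D := fun j hj => by
    obtain ⟨t, ht, i, rfl⟩ := exists_instAt g (c₁ * x) le_rfl (hNe ▸ hj)
    rw [hIe, instAt_eq g _ ht i, mkInst_D]
    exact Nat.le_add_left 1 _
  have hnp2 : ∀ j < S.N, 2 ≤ (S.inst j).np := fun j hj => by
    rw [hIe]; exact two_le_instAt_np hn (hNe ▸ hj)
  have hbase : ∀ j, (S.inst j).np * (S.inst j).D + 2 ≤ S.word j := fun j => by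
    rw [hwe]; exact Nat.le_self_pow (by omega) _
  have hnpw : ∀ j < S.N, (S.inst j).np ≤ S.word j := fun j hj => by
    have h₁ := Nat.mul_le_mul_left (S.inst j).np (hD1 j hj)
    have h₂ := hbase j
    omega
  have hDw : ∀ j < S.N, (S.inst j).D ≤ S.word j := fun j hj => by
    have h₁ := Nat.mul_le_mul_right (S.inst j).D (hnp2 j hj)
    have h₂ := hbase j
    omega
  have hsim : ∀ u : Com, u.CallFree → u.cellBound ≤ Z → ∀ j < S.N, SimData u (S.word j) S.Z :=
    fun u hu huZ j hj =>
      ⟨hu, by rwa [hZe], by have := hbase j; omega, by rw [hZe]; exact hword j hj⟩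
  have hV : S.Valid W := by
    have h64 := hb.ten_le
    have hE := le_famAddr g (c₁ * x) (numScales n (c₁ * x))
    refine ⟨by omega, by rw [hZe]; exact hb.pow_le, by rw [hZe]; exact hb.n_le,
      by rw [hEe, hZe]; exact hb.addr_le, by omega, by rw [hNe]; exact insts_length_pos hn hg,
      by rwa [hZe], fun j hj => ?_, hnpw⟩
    rw [hIe, hEe]
    exact instAt_valid hn (hNe ▸ hj)
  have hboost := boost_run (c₁ := c₁) (q' := q') (β := α + ε) hn
    (by linarith) hb hc₁Z hxZ hS hV hDw (hsim _ hA.1 hAZ.1) (hsim _ hA.2.1 hAZ.2.1)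
    (hsim _ hA.2.2 hAZ.2.2) hrun ?_ hq
  · obtain ⟨mem, cost, costs, h₁, h₂, h₃, h₄, h₅⟩ := hboost
    refine ⟨mem, cost, h₁, h₂, h₃, timeBound_of_insts (I := S.inst) hτ0 hK hk h₅ fun j hj => ?_⟩
    exact (h₄ j hj).mono (hτ j hj)
  · rw [hNe, hIe]
    exact matchNum_le_of_insts hα hε hε1 hc₁ hc hη hg

/-- The bounds `p` are arbitrary real functions; the idle adversary, allowed in both modes, shows
that the relevant values are not negative. -/
theorem Algo.ApproxMaintains.nonneg {A : Algo} {α : ℝ} {T : ℕ → ℝ → ℝ} {b q : ℕ}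
    {p : ℕ → ℕ → ℕ → ℝ} {am : AdvMode} {tm : TimeMode} (h : A.ApproxMaintains α T b q p am tm)
    {n D : ℕ} (hn : 2 ≤ n) (hD : 1 ≤ D) (H : ℕ) : 0 ≤ p n D H := by
  obtain ⟨k, -, h⟩ := h n D hn hD
  obtain ⟨R₀, h⟩ := h H
  refine (prob_nonneg _).trans (h _ le_rfl (fun _ _ _ => none) ?_)
  cases am
  · exact fun _ _ _ _ _ => rfl
  · exact fun _ _ _ _ _ => rfl

/-- Conditionally on good coins of the generator, a failure is a failure of one of at most `Nmax`
copies, each handled by `prob_instance_le`. -/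
theorem boost_maintains {n c₁ x b q q' W Z Dmax Nmax : ℕ} {A : Algo} {α ε η τ : ℝ}
    {T : ℕ → ℝ → ℝ} {pM : ℕ → ℕ → ℕ → ℝ} {p' : ℕ → ℝ} {am : AdvMode} {tm : TimeMode}
    {Coin : Type} [Finite Coin] [Nonempty Coin] {g : Coin → Oracle n} {bad : Coin → Prop}
    (hn : 2 ≤ n) (hα : 1 ≤ α) (hε : 0 < ε) (hε1 : ε < 1) (hA : A.CallFree)
    (hAM : A.ApproxMaintains α T b q pM am tm)
    (hAZ : A.start.cellBound ≤ Z ∧ A.update.cellBound ≤ Z ∧ A.mate.cellBound ≤ Z)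
    (hb1 : 1 ≤ b) (hc₁ : 5 * α ≤ c₁) (hc : (c₁ : ℝ) / ε ≤ (c₁ * x : ℕ)) (hη : η ≤ ε / c₁)
    (hc₁Z : c₁ ≤ Z) (hxZ : x ≤ Z) (hN : 4 * Nmax + 4 ≤ Z) (hword : (n * Dmax + 2) ^ b ≤ Z)
    (hbounds : ∀ σ, ¬ bad σ → GenBounds (g σ) (c₁ * x) Z W)
    (hpres : ∀ σ, ¬ bad σ → Preserving (g σ) (c₁ * x) η)
    (hlen : ∀ σ, ¬ bad σ → (insts (g σ) (c₁ * x) (numScales n (c₁ * x))).length ≤ Nmax)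
    (hD : ∀ σ, ¬ bad σ → ∀ j < (insts (g σ) (c₁ * x) (numScales n (c₁ * x))).length,
      (instAt (g σ) (c₁ * x) j).D ≤ Dmax) (hDmax : 1 ≤ Dmax)
    (hq : 400 + 40 * q ≤ q') (hτ0 : 0 ≤ τ)
    (hτ : ∀ n' D : ℕ, 2 ≤ n' → n' ≤ n → 1 ≤ D → D ≤ Dmax → T n' (1 / D) ≤ τ)
    (hp : ∀ n' D H : ℕ, 2 ≤ n' → n' ≤ n → 1 ≤ D → D ≤ Dmax → pM n' D H ≤ p' H) :
    Maintains (boost c₁ A) n x W q' (α + ε) 0 (100 + Nmax * (510 + 40 * τ))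
      (fun H => prob Coin bad + Nmax * p' H) am tm g := by
  have hp0 : ∀ H, 0 ≤ p' H := fun H =>
    (hAM.nonneg hn le_rfl H).trans (hp n 1 H hn le_rfl le_rfl hDmax)
  choose! k hk using hAM
  have hk' := fun n' D (h₁ : 2 ≤ n') (h₂ : 1 ≤ D) => (hk n' D h₁ h₂).2
  choose! R₀ hR₀ using hk'
  set I := Finset.Icc 2 n ×ˢ Finset.Icc 1 Dmax with hI
  have hmem : ∀ n' D, 2 ≤ n' → n' ≤ n → 1 ≤ D → D ≤ Dmax → (n', D) ∈ I := fun n' D h₁ h₂ h₃ h₄ => by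
    simp [hI, h₁, h₂, h₃, h₄]
  have hKpos : 0 < ∏ z ∈ I, k z.1 z.2 := Finset.prod_pos fun z hz => by
    simp only [hI, Finset.mem_product, Finset.mem_Icc] at hz
    exact (hk z.1 z.2 hz.1.1 hz.2.1).1
  -- Window length and number of bits must be fixed before the coins determine the copies. So all
  -- pairs (n', D) that may occur are provided for: the product is a common multiple of their
  -- windows, and the address bound covers their bits in any array.
  refine ⟨∏ z ∈ I, k z.1 z.2, hKpos, fun H => ⟨phys Z Z (I.sup fun z => R₀ z.1 z.2 H),
    fun R hR adv hadv => prob_prod_le_add (mul_nonneg (Nat.cast_nonneg _) (hp0 H)) fun σ hσ => ?_⟩⟩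
  set S := mkSetup (g σ) (c₁ * x) Z
    fun j => ((instAt (g σ) (c₁ * x) j).np * (instAt (g σ) (c₁ * x) j).D + 2) ^ b with hS
  have hlt : ∀ j < S.N, (2 ≤ (S.inst j).np ∧ (S.inst j).np ≤ n) ∧
      (1 ≤ (S.inst j).D ∧ (S.inst j).D ≤ Dmax) := by
    intro j hj
    refine ⟨⟨two_le_instAt_np hn hj, (instAt_valid hn hj).1⟩, ?_, hD σ hσ j hj⟩
    obtain ⟨t, ht, i, rfl⟩ := exists_instAt (g σ) (c₁ * x) le_rfl hj
    change 1 ≤ (instAt (g σ) (c₁ * x) _).D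
    rw [instAt_eq _ _ ht i, mkInst_D]
    exact Nat.le_add_left 1 _
  have hNle : S.N ≤ Nmax := hlen σ hσ
  have hNle' : (S.N : ℝ) ≤ Nmax := by exact_mod_cast hNle
  refine (prob_mono (F := fun ω => ∃ j < S.N, ¬ RunSucceeds A (S.inst j).D (S.word j) q α
      ((S.inst j).np / (S.inst j).D) (T (S.inst j).np (1 / (S.inst j).D)) tm
      (k (S.inst j).np (S.inst j).D) (noOracle (S.inst j).np ()) (instMoves (S.inst j).f (adv σ ω))
      (fun s y => ω.bit s (phys S.E (4 * j + 1) y)) H) fun ω hω => ?_).trans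
    ((prob_exists_lt_le S.N _ (p := p' H) fun j hj => ?_).trans
      (mul_le_mul_of_nonneg_right hNle' (hp0 H)))
  · by_contra hall
    push Not at hall
    refine hω ?_
    have hrun := boost_succeeds (T := T) (k := k) (K := ∏ z ∈ I, k z.1 z.2) (q' := q') hn hα hε hε1
      hA hAZ hb1 hc₁ hc hη (hbounds σ hσ) hc₁Z hxZ (hpres σ hσ) hS (by omega)
          (fun j hj => ?_) hq hτ0
      (fun j hj => ?_) hKpos (fun j hj => ?_) hall
    · obtain ⟨mem, cost, h₁, h₂, h₃, h₄⟩ := hrun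
      refine ⟨mem, cost, h₁, h₂, h₃, h₄.mono ?_⟩
      gcongr
    · refine le_trans ?_ hword
      exact Nat.pow_le_pow_left (Nat.add_le_add_right
        (Nat.mul_le_mul (hlt j hj).1.2 (hlt j hj).2.2) 2) b
    · exact hτ _ _ (hlt j hj).1.1 (hlt j hj).1.2 (hlt j hj).2.1 (hlt j hj).2.2
    · exact Finset.dvd_prod_of_mem (fun z : ℕ × ℕ => k z.1 z.2)
        (hmem _ _ (hlt j hj).1.1 (hlt j hj).1.2 (hlt j hj).2.1 (hlt j hj).2.2)
  · obtain ⟨⟨h₁, h₂⟩, h₃, h₄⟩ := hlt j hj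
    refine le_trans ?_ (hp _ _ H h₁ h₂ h₃ h₄)
    refine prob_instance_le (R₀ := R₀ (S.inst j).np (S.inst j).D H) (φ := phys S.E (4 * j + 1))
      (fun y y' h => Nat.add_lt_add_left (pr_strictMono_right _ h) _) (S.inst j).f
      (hR₀ _ _ h₁ h₃ H) ?_ hadv σ
    refine (phys_mono (hbounds σ hσ).addr_le (by omega) ?_).trans hR
    exact Finset.le_sup (f := fun z : ℕ × ℕ => R₀ z.1 z.2 H) (hmem _ _ h₁ h₂ h₃ h₄)

/-! ### Sizes -/

section Sizes

variable {n : ℕ} {g : Oracle n} {c : ℕ}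

theorem numScales_le_self (n c : ℕ) : numScales n c ≤ n := by
  by_contra h
  have h₁ := lt_numScales.1 (not_le.1 h)
  have h₂ := succ_le_scale c n
  omega

theorem half_le_log (hn : 2 ≤ n) : 1 / 2 ≤ Real.log n := by
  have h₁ := Real.log_two_gt_d9
  have h₂ : Real.log 2 ≤ Real.log n := Real.log_le_log (by norm_num) (by exact_mod_cast hn)
  linarith

/-- The added 1 outweighs the rounding: k + 1 + ⌊k/c⌋ ≥ k(1 + 1/c). -/
theorem pow_le_scale (hc : 1 ≤ c) (t : ℕ) : (1 + 1 / (c : ℝ)) ^ t ≤ scale c t := by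
  induction t with
  | zero => simp [scale]
  | succ t ih =>
    have h : (scale c t : ℝ) / c ≤ 1 + (scale c t / c : ℕ) := by
      have := Nat.lt_floor_add_one ((scale c t : ℝ) / c)
      rw [Nat.floor_div_eq_div] at this
      linarith
    rw [pow_succ]
    calc (1 + 1 / (c : ℝ)) ^ t * (1 + 1 / c) ≤ scale c t * (1 + 1 / c) := by gcongr
      _ = scale c t + scale c t / c := by ring
      _ ≤ scale c t + (1 + (scale c t / c : ℕ)) := by gcongr
      _ = scale c (t + 1) := by rw [scale]; push_cast; ring

/-- The last scale has index m with (1 + 1/c)^m ≤ n, and log(1 + 1/c) ≥ 1/(c + 1) ≥ 1/(2c), so m ≤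
2c log n. The remaining scale is also absorbed by 2c log n, since log n ≥ 1/2. -/
theorem numScales_le_log (hn : 2 ≤ n) (hc : 1 ≤ c) : (numScales n c : ℝ) ≤ 4 * c * Real.log n := by
  have hl := half_le_log hn
  have hc' : (1 : ℝ) ≤ c := by exact_mod_cast hc
  rcases Nat.eq_zero_or_pos (numScales n c) with h0 | h0
  · rw [h0]; push_cast; positivity
  obtain ⟨m, hm⟩ := Nat.exists_eq_succ_of_ne_zero h0.ne'
  have h₁ : 2 * scale c m ≤ n := lt_numScales.1 (by omega)
  have h₂ : (1 + 1 / (c : ℝ)) ^ m ≤ n := (pow_le_scale hc m).trans (by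
    exact_mod_cast (by omega : scale c m ≤ n))
  have h₃ := Real.log_le_log (by positivity) h₂
  rw [Real.log_pow] at h₃
  have h₄ : 1 / (2 * (c : ℝ)) ≤ Real.log (1 + 1 / c) := by
    refine le_trans ?_ (Real.one_sub_inv_le_log_of_pos (by positivity))
    have : 1 - (1 + 1 / (c : ℝ))⁻¹ = 1 / (c + 1) := by field_simp; ring
    rw [this]
    exact one_div_le_one_div_of_le (by positivity) (by linarith)
  have h₅ : (m : ℝ) * (1 / (2 * c)) ≤ Real.log n :=
    (mul_le_mul_of_nonneg_left h₄ (Nat.cast_nonneg _)).trans h₃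
  rw [mul_one_div, div_le_iff₀ (by positivity)] at h₅
  rw [hm]
  push_cast
  nlinarith

theorem length_insts_le {ℓ T : ℕ} (h : ∀ t < T, (g (scale c t)).num ≤ ℓ) :
    (insts g c T).length ≤ T * ℓ := by
  induction T with
  | zero => simp [insts]
  | succ T ih =>
    have h₁ := ih fun t ht => h t (by omega)
    have h₂ := h T (by omega)
    rw [length_insts_succ, Nat.add_mul]
    omega

theorem famAddr_le {ℓ T : ℕ} (h : ∀ t < T, (g (scale c t)).num ≤ ℓ) :
    famAddr g c T ≤ 64 + n + T * (2 + ℓ * n) := by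
  induction T with
  | zero => simp [famAddr]
  | succ T ih =>
    have h₁ := ih fun t ht => h t (by omega)
    have h₂ := Nat.mul_le_mul_right n (h T (by omega))
    rw [famAddr, Nat.add_mul T]
    omega

/-- The number of parts is at most (2 + a)kC, so k cancels: one bound for the accuracy parameters
holds at all scales. -/
theorem mkInst_D_le {F : Family n} {k addr : ℕ} {a C : ℝ} (ha : 0 < a) (hC : 1 ≤ C) (hk : 1 ≤ k)
    (hF : (F.parts : ℝ) ≤ a * (k * C)) (i : Fin F.num) :
    ((mkInst F k c addr i).D : ℝ) ≤ (2 + a) * C * c + 1 := by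
  have hk' : (1 : ℝ) ≤ k := by exact_mod_cast hk
  have hkC : 1 ≤ k * C := one_le_mul_of_one_le_of_one_le hk' hC
  have hnp : ((mkInst F k c addr i).np : ℝ) ≤ (2 + a) * (k * C) := by
    by_cases h : n < F.parts
    · rw [mkInst, if_pos h]
      have : (n : ℝ) ≤ F.parts := by exact_mod_cast h.le
      nlinarith
    · rw [mkInst, if_neg h]
      change ((max 2 F.parts : ℕ) : ℝ) ≤ _
      rw [Nat.cast_max, max_le_iff]
      constructor
      · push_cast; nlinarith
      · nlinarith
  rw [mkInst_D]
  push_cast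
  have h₁ : (((mkInst F k c addr i).np * c / k : ℕ) : ℝ) ≤ (mkInst F k c addr i).np * c / k := by
    refine Nat.cast_div_le.trans ?_
    push_cast
    exact le_rfl
  have h₂ : ((mkInst F k c addr i).np : ℝ) * c / k ≤ (2 + a) * C * c := by
    rw [div_le_iff₀ (by linarith)]
    calc ((mkInst F k c addr i).np : ℝ) * c ≤ (2 + a) * (k * C) * c := by gcongr
      _ = (2 + a) * C * c * k := by ring
  linarith

theorem instAt_D_le {a C : ℝ} (ha : 0 < a) (hC : 1 ≤ C)
    (hF : ∀ t < numScales n c, ((g (scale c t)).parts : ℝ) ≤ a * (scale c t * C)) {j : ℕ}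
    (hj : j < (insts g c (numScales n c)).length) :
    ((instAt g c j).D : ℝ) ≤ (2 + a) * C * c + 1 := by
  obtain ⟨t, ht, i, rfl⟩ := exists_instAt g c le_rfl hj
  rw [instAt_eq g c ht i]
  exact mkInst_D_le ha hC (by have := succ_le_scale c t; omega) (hF t ht) i

/-- The generator fails at one of the scales. -/
theorem prob_bad_le {S : Generator} {a : ℝ} {L C pS : ℕ → ℝ → ℝ} (hS : S.Generates a L C pS)
    {η : ℝ} (hη : 0 < η) (hη1 : η < 1) :
    prob (S.Coins n η) (fun σ => ∃ t < numScales n c,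
      ¬ (S.oracle n η σ (scale c t)).Good (scale c t) η (L n η) (a * (scale c t * C n η))) ≤
      numScales n c * pS n η := by
  refine prob_exists_lt_le _ _ fun t ht => ?_
  have h₁ := lt_numScales.1 ht
  have h₂ := succ_le_scale c t
  have hlt : scale c t < n + 1 := by omega
  refine le_trans (le_of_eq ?_) (hS n (scale c t) (by omega) h₁ η hη hη1)
  -- Each size has its own coins, so the event concerns one coordinate only.
  rw [← prob_pi_apply (X := fun k : Fin (n + 1) => Fin (S.bits n k η) → Bool) ⟨scale c t, hlt⟩
    (fun σ => ¬ (S.out n (scale c t) η σ).Good (scale c t) η (L n η) (a * (scale c t * C n η)))]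
  congr 1
  funext σ
  rw [Generator.oracle, dif_pos hlt]

theorem size_bounds {n L C e : ℝ} (hn : 1 ≤ n) (hL : 1 ≤ L) (hC : 1 ≤ C) (he : 1 ≤ e) :
    n ≤ n * L * C * e ∧ e ≤ n * L * C * e ∧ n * L ≤ n * L * C * e ∧ n * C ≤ n * L * C * e ∧
      n * C * e ≤ n * L * C * e := by
  refine ⟨?_, ?_, ?_, ?_, ?_⟩
  · calc n = n * 1 * 1 * 1 := by ring
      _ ≤ _ := by gcongr
  · calc e = 1 * 1 * 1 * e := by ring
      _ ≤ _ := by gcongr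
  · calc n * L = n * L * 1 * 1 := by ring
      _ ≤ _ := by gcongr
  · calc n * C = n * 1 * C * 1 := by ring
      _ ≤ _ := by gcongr
  · calc n * C * e = n * 1 * C * e := by ring
      _ ≤ _ := by gcongr

/-- A number that is polynomial in `Y` fits into a word. -/
theorem pow_le_floor_pow {Y : ℝ} (hY : 4 ≤ Y) {κ b c : ℕ} (hc : 20 * (κ + 2 * b + 4) ≤ c) :
    (κ * ⌈Y⌉₊ ^ (b + 2)) ^ 20 ≤ ⌊Y ^ c⌋₊ := by
  refine Nat.le_floor ?_
  -- The ceiling and the constant κ ≤ 2^κ are both turned into powers of Y, so that the word size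
  -- needs only a large exponent.
  have h₁ : (⌈Y⌉₊ : ℝ) ≤ Y ^ 2 := by
    have := Nat.ceil_lt_add_one (by linarith : 0 ≤ Y)
    nlinarith
  have h₂ : (κ : ℝ) ≤ Y ^ κ := by
    have h₃ : (κ : ℝ) ≤ 2 ^ κ := by exact_mod_cast (Nat.lt_two_pow_self (n := κ)).le
    exact h₃.trans (pow_le_pow_left₀ (by norm_num) (by linarith) κ)
  push_cast
  calc ((κ : ℝ) * (⌈Y⌉₊ : ℝ) ^ (b + 2)) ^ 20 ≤ (Y ^ κ * (Y ^ 2) ^ (b + 2)) ^ 20 := by gcongr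
    _ = Y ^ (20 * (κ + 2 * b + 4)) := by rw [← pow_mul, ← pow_add, ← pow_mul]; congr 1; ring
    _ ≤ Y ^ c := pow_le_pow_right₀ (by linarith) hc

/-- At most n ≤ y scales with answers of at most 2 + y cells need O(y²) addresses, and part numbers
are O(y). The further power b in Z leaves room for the words of the copies in `boost_guarantee`. -/
theorem genBounds_of_good {y κ b W a' k₁ : ℕ} {a C ℓ η : ℝ} (hy : 4 ≤ y) (ha : a ≤ a') (hC : 0 ≤ C)
    (hκ : 200 + k₁ + a' ≤ κ) (hW : (κ * y ^ (b + 2)) ^ 20 ≤ W) (hny : n ≤ y)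
    (hnℓ : n * ⌊ℓ⌋₊ ≤ y) (hnC : n * C ≤ y) (hc : c ≤ k₁ * y)
    (hg : ∀ t < numScales n c, (g (scale c t)).Good (scale c t) η ℓ (a * (scale c t * C))) :
    GenBounds g c (κ * y ^ (b + 2)) W := by
  have hyZ : ∀ k i : ℕ, k ≤ κ → i ≤ b + 2 → k * y ^ i ≤ κ * y ^ (b + 2) := fun k i hk hi =>
    Nat.mul_le_mul hk (Nat.pow_le_pow_right (by omega) hi)
  have h₀ := hyZ 200 0 (by omega) (by omega)
  rw [pow_zero] at h₀
  have h₁ := hyZ 1 1 (by omega) (by omega)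
  have h₂ := hyZ k₁ 1 (by omega) (by omega)
  have h₃ := hyZ a' 1 (by omega) (by omega)
  have h₄ := hyZ 200 2 (by omega) (by omega)
  rw [pow_one] at h₁ h₂ h₃
  refine ⟨by omega, hW, by omega, by omega, ?_, fun t ht => le_trans ?_ h₃⟩
  · refine (famAddr_le fun t ht => Nat.le_floor (hg t ht).1).trans (le_trans ?_ h₄)
    have h₅ : numScales n c * (2 + ⌊ℓ⌋₊ * n) ≤ y * (2 + y) :=
      Nat.mul_le_mul ((numScales_le_self n c).trans hny) (by rw [Nat.mul_comm]; omega)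
    nlinarith
  · have h₅ := (hg t ht).2.1
    have h₆ := lt_numScales.1 ht
    have h₇ : (scale c t : ℝ) ≤ n := by exact_mod_cast (by omega : scale c t ≤ n)
    have h₈ : a * (scale c t * C) ≤ a' * y := by
      gcongr
      exact (mul_le_mul_of_nonneg_right h₇ hC).trans hnC
    exact_mod_cast h₅.trans h₈

/-- The actual time is O(τu) for u = ℓ l e. As u ≥ 1/2, u ≤ 2u² ≤ 2u²e², which is the weaker bound
claimed, and additive constants are absorbed as well. -/
theorem time_le {c₁ N k : ℕ} {ℓ l e τ : ℝ} (hℓ : 1 ≤ ℓ) (hl : 1 / 2 ≤ l) (he : 1 ≤ e) (hτ : 1 ≤ τ)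
    (hc₁ : 5 ≤ c₁) (hk : 10400 * c₁ ≤ k) (hN : (N : ℝ) ≤ 8 * c₁ * (l * e) * ℓ) :
    100 + N * (510 + 40 * τ) ≤ k * (τ * (ℓ ^ 2 * l ^ 2 * e ^ 4)) := by
  set u := l * e * ℓ with hu
  have hc₁' : (5 : ℝ) ≤ c₁ := by exact_mod_cast hc₁
  have hk' : (10400 : ℝ) * c₁ ≤ k := by exact_mod_cast hk
  have hle : 1 / 2 ≤ l * e := by nlinarith
  have hu2 : 1 / 2 ≤ u := by nlinarith
  have h₁ : u ≤ 2 * (ℓ ^ 2 * l ^ 2 * e ^ 4) := by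
    have he4 : 1 ≤ e ^ 2 := one_le_pow₀ he
    have : 2 * (ℓ ^ 2 * l ^ 2 * e ^ 4) = 2 * u * u * e ^ 2 := by rw [hu]; ring
    rw [this]
    nlinarith [mul_nonneg (by linarith : 0 ≤ u) (by linarith : 0 ≤ u)]
  have hN' : (N : ℝ) ≤ 8 * c₁ * u := by rw [hu]; linarith
  have h₂ : (N : ℝ) * (510 + 40 * τ) ≤ 8 * c₁ * u * (550 * τ) :=
    mul_le_mul hN' (by linarith) (by positivity) (by positivity)
  have h₃ : 100 ≤ 40 * c₁ * u * τ := by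
    have : 100 ≤ 40 * c₁ * u := by nlinarith
    nlinarith
  have h₄ : 0 ≤ c₁ * τ := by positivity
  calc 100 + (N : ℝ) * (510 + 40 * τ) ≤ 4440 * (c₁ * τ) * u := by nlinarith
    _ ≤ 4440 * (c₁ * τ) * (2 * (ℓ ^ 2 * l ^ 2 * e ^ 4)) := by gcongr
    _ = 8880 * c₁ * (τ * (ℓ ^ 2 * l ^ 2 * e ^ 4)) := by ring
    _ ≤ k * (τ * (ℓ ^ 2 * l ^ 2 * e ^ 4)) := by
        gcongr
        linarith

end Sizes

set_option maxHeartbeats 600000 in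
/-- The guarantees of the boosted algorithm, for sufficiently large constants. -/
theorem boost_guarantee {α a ε η ℓ C e τ : ℝ} {b q n c₁ d a' κ c : ℕ} {A : Algo} {S : Generator}
    {T L C' : ℕ → ℝ → ℝ} {pM : ℕ → ℕ → ℕ → ℝ} {pS : ℕ → ℝ → ℝ} {pM' : ℕ → ℝ} {am : AdvMode}
    {tm : TimeMode} (hα : 1 ≤ α) (ha : 0 < a) (hb : 1 ≤ b) (hA : A.CallFree)
    (hc₁ : 5 * α ≤ c₁) (hd : (2 + a) * (2 * c₁) + 1 ≤ d) (ha' : a ≤ a')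
    (hκ : 200 + (A.start.cellBound + A.update.cellBound + A.mate.cellBound) + 2 * c₁ + a' + d ^ b
      ≤ κ)
    (hc : 20 * (κ + 2 * b + 4) + d + 400 + 40 * q + 10400 * c₁ ≤ c)
    (hAM : A.ApproxMaintains α T b q pM am tm) (hS : S.Generates a L C' pS) (hn : 2 ≤ n)
    (hε : 0 < ε) (hε1 : ε < 1) (hη0 : 0 < η) (hη1 : η < 1) (hηc₁ : η ≤ ε / c₁)
    (hℓ : ℓ = L n η) (hC : C = C' n η) (hℓ1 : 1 ≤ ℓ) (hC1 : 1 ≤ C) (hedef : e = 1 / ε) (hτ1 : 1 ≤ τ)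
    (hτ : ∀ n' D : ℕ, 2 ≤ n' → n' ≤ n → 1 ≤ D → (D : ℝ) ≤ c * C * e → T n' (1 / D) ≤ τ)
    (hp : ∀ n' D H : ℕ, 2 ≤ n' → n' ≤ n → 1 ≤ D → (D : ℝ) ≤ c * C * e → pM n' D H ≤ pM' H) :
    Maintains (boost c₁ A) n ⌈e⌉₊ ⌊(n * ℓ * C * e + 2) ^ c⌋₊ c (α + ε) 0
      (c * (τ * (ℓ ^ 2 * Real.log n ^ 2 * e ^ 4)))
      (fun H => c * (Real.log n * e) * (ℓ * pM' H + pS n η)) am tm (S.oracle n η) := by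
  have hc₁5 : (5 : ℝ) ≤ c₁ := by linarith
  have hc₁5' : 5 ≤ c₁ := by exact_mod_cast hc₁5
  have hcd : (d : ℝ) ≤ c := by exact_mod_cast (by omega : d ≤ c)
  have hn1 : (1 : ℝ) ≤ n := by exact_mod_cast (by omega : 1 ≤ n)
  have hn2 : (2 : ℝ) ≤ n := by exact_mod_cast hn
  have he : 1 ≤ e := by rw [hedef, le_div_iff₀ hε]; linarith
  obtain ⟨b₁, b₂, b₃, b₄, b₅⟩ := size_bounds hn1 hℓ1 hC1 he
  have hY4 : 4 ≤ n * ℓ * C * e + 2 := by linarith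
  have hfit := pow_le_floor_pow hY4 (κ := κ) (b := b) (c := c) (by omega)
  generalize ⌊(n * ℓ * C * e + 2) ^ c⌋₊ = W at hfit ⊢
  generalize n * ℓ * C * e = P at *
  obtain ⟨y, hy⟩ : ∃ y, y = ⌈P + 2⌉₊ := ⟨_, rfl⟩
  have hyP : P + 2 ≤ y := hy ▸ Nat.le_ceil _
  rw [← hy] at hfit
  obtain ⟨x, hx⟩ : ∃ x, x = ⌈e⌉₊ := ⟨_, rfl⟩
  have hxe : e ≤ x := hx ▸ Nat.le_ceil _
  have hxe' : (x : ℝ) ≤ 2 * e := by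
    have := Nat.ceil_lt_add_one (by linarith : 0 ≤ e)
    rw [← hx] at this
    linarith
  rw [← hx]
  have hx1 : 1 ≤ x := by exact_mod_cast he.trans hxe
  have hcx : ((c₁ * x : ℕ) : ℝ) ≤ 2 * c₁ * e := by
    rw [Nat.cast_mul]
    nlinarith
  have hcx' : (c₁ : ℝ) / ε ≤ (c₁ * x : ℕ) := by
    rw [Nat.cast_mul, div_eq_mul_one_div, ← hedef]
    gcongr
  have hl := half_le_log hn
  have hns : (numScales n (c₁ * x) : ℝ) ≤ 8 * c₁ * (Real.log n * e) := by
    refine (numScales_le_log hn (Nat.mul_pos (by omega) hx1)).trans ?_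
    nlinarith
  have hns' := numScales_le_self n (c₁ * x)
  have hy4 : 4 ≤ y := by exact_mod_cast hY4.trans hyP
  have hyZ : ∀ k i : ℕ, k ≤ κ → i ≤ b + 2 → k * y ^ i ≤ κ * y ^ (b + 2) := fun k i hk hi =>
    Nat.mul_le_mul hk (Nat.pow_le_pow_right (by omega) hi)
  have hκZ : κ ≤ κ * y ^ (b + 2) := Nat.le_mul_of_pos_right _ (Nat.pow_pos (by omega))
  have h8 := hyZ 8 1 (by omega) (by omega)
  rw [pow_one] at h8
  have hfl : (⌊ℓ⌋₊ : ℝ) ≤ ℓ := Nat.floor_le (by linarith)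
  have hnℓ : n * ⌊ℓ⌋₊ ≤ y := by
    have : (n : ℝ) * ⌊ℓ⌋₊ ≤ y := (mul_le_mul_of_nonneg_left hfl (by linarith)).trans (by linarith)
    exact_mod_cast this
  have hNy : numScales n (c₁ * x) * ⌊ℓ⌋₊ ≤ y := (Nat.mul_le_mul_right _ hns').trans hnℓ
  have hd1 : (1 : ℝ) ≤ d := by nlinarith
  have hdC : 1 ≤ d * C * e :=
    one_le_mul_of_one_le_of_one_le (one_le_mul_of_one_le_of_one_le hd1 hC1) he
  have hDle : (⌊d * C * e⌋₊ : ℝ) ≤ d * C * e := Nat.floor_le (by linarith)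
  -- The largest word of a copy: nD + 2 ≤ dy for all D that occur, and d^b ≤ κ.
  have hword : (n * ⌊d * C * e⌋₊ + 2) ^ b ≤ κ * y ^ (b + 2) := by
    have h₁ : n * ⌊d * C * e⌋₊ + 2 ≤ d * y := by
      have : (n : ℝ) * ⌊d * C * e⌋₊ + 2 ≤ d * y :=
        calc (n : ℝ) * ⌊d * C * e⌋₊ + 2 ≤ n * (d * C * e) + 2 := by gcongr
          _ = d * (n * C * e) + 1 * 2 := by ring
          _ ≤ d * P + d * 2 := by gcongr
          _ = d * (P + 2) := by ring
          _ ≤ d * y := by gcongr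
      exact_mod_cast this
    refine (Nat.pow_le_pow_left h₁ b).trans ?_
    rw [mul_pow]
    exact hyZ _ _ (by omega) (by omega)
  have hDC : ∀ D : ℕ, D ≤ ⌊d * C * e⌋₊ → (D : ℝ) ≤ c * C * e := fun D hD => by
    have h₁ : (D : ℝ) ≤ ⌊d * C * e⌋₊ := by exact_mod_cast hD
    exact (h₁.trans hDle).trans (by gcongr)
  have hgood : ∀ σ, ¬ (∃ t < numScales n (c₁ * x), ¬ (S.oracle n η σ (scale (c₁ * x) t)).Good
      (scale (c₁ * x) t) η ℓ (a * (scale (c₁ * x) t * C))) → ∀ t < numScales n (c₁ * x),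
      (S.oracle n η σ (scale (c₁ * x) t)).Good (scale (c₁ * x) t) η ℓ
        (a * (scale (c₁ * x) t * C)) := fun σ hσ t ht => by
    by_contra h
    exact hσ ⟨t, ht, h⟩
  have hmain := boost_maintains (q' := c) (W := W) (Z := κ * y ^ (b + 2)) (Dmax := ⌊d * C * e⌋₊)
    (Nmax := numScales n (c₁ * x) * ⌊ℓ⌋₊) (p' := pM') hn hα hε hε1 hA hAM
    ⟨by omega, by omega, by omega⟩ hb hc₁ hcx' hηc₁ (by omega) ?_ (by omega) hword
    (fun σ hσ => genBounds_of_good (k₁ := 2 * c₁) hy4 ha' (by linarith) (by omega) hfit ?_ hnℓ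
      (by linarith) ?_ (hgood σ hσ))
    (fun σ hσ t ht => (hgood σ hσ t ht).2.2)
    (fun σ hσ => length_insts_le fun t ht => Nat.le_floor (hgood σ hσ t ht).1)
    (fun σ hσ j hj => ?_) (Nat.le_floor (by simpa using hdC)) (by omega) (by linarith)
    (fun n' D h₁ h₂ h₃ h₄ => hτ n' D h₁ h₂ h₃ (hDC D h₄))
    (fun n' D H h₁ h₂ h₃ h₄ => hp n' D H h₁ h₂ h₃ (hDC D h₄))
  · refine hmain.mono (time_le hℓ1 hl he hτ1 hc₁5' (by omega) ?_) fun H => ?_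
    · push_cast
      gcongr
    · have hp0 : 0 ≤ pM' H := (hAM.nonneg hn le_rfl H).trans
        (hp n 1 H hn le_rfl le_rfl (hDC 1 (Nat.le_floor (by simpa using hdC))))
      have hpS0 : 0 ≤ pS n η := (prob_nonneg _).trans (hS n 1 le_rfl (by omega) η hη0 hη1)
      have hbad := prob_bad_le (n := n) (c := c₁ * x) hS hη0 hη1
      rw [← hℓ, ← hC] at hbad
      have hcc₁ : (8 : ℝ) * c₁ ≤ c := by exact_mod_cast (by omega : 8 * c₁ ≤ c)
      have hN : ((numScales n (c₁ * x) * ⌊ℓ⌋₊ : ℕ) : ℝ) * pM' H ≤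
          numScales n (c₁ * x) * (ℓ * pM' H) := by
        push_cast
        rw [mul_assoc]
        gcongr
      calc _ ≤ numScales n (c₁ * x) * pS n η + numScales n (c₁ * x) * (ℓ * pM' H) :=
            add_le_add hbad hN
        _ = numScales n (c₁ * x) * (ℓ * pM' H + pS n η) := by ring
        _ ≤ c * (Real.log n * e) * (ℓ * pM' H + pS n η) := by
            gcongr
            refine hns.trans ?_
            gcongr
  · have h₁ : x ≤ 2 * y := by exact_mod_cast (by linarith : (x : ℝ) ≤ 2 * y)
    omega
  · exact_mod_cast (by linarith : (n : ℝ) ≤ y)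
  · have : ((c₁ * x : ℕ) : ℝ) ≤ 2 * c₁ * y := hcx.trans (by gcongr; linarith)
    exact_mod_cast this
  · refine Nat.le_floor ((instAt_D_le ha hC1 (fun t ht => (hgood σ hσ t ht).2.1) hj).trans ?_)
    have h₁ : (2 + a) * C * (c₁ * x : ℕ) ≤ (2 + a) * C * (2 * c₁ * e) := by gcongr
    have h₂ : 1 ≤ C * e := one_le_mul_of_one_le_of_one_le hC1 he
    have h₃ := mul_le_mul_of_nonneg_right hd (by linarith : 0 ≤ C * e)
    linarith

end DynMatching

/-! ### The main theorem: choice of the constants -/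

open DynMatching in
theorem mainTheorem5 (α a : ℝ) (hα : 1 ≤ α) (ha : 0 < a) (b q : ℕ) (hb : 1 ≤ b)
    (AlgM : Algo) (hM : AlgM.CallFree) :
    ∃ (Alg : Algo) (c : ℕ), 1 ≤ c ∧
      Alg.CallsOnlyAtStart ∧ Alg.SingleCalls ∧
      (AlgM.Deterministic → Alg.Deterministic) ∧
      ∀ (T L C : ℕ → ℝ → ℝ) (AlgS : Generator)
        (pM : ℕ → ℕ → ℕ → ℝ) (pS : ℕ → ℝ → ℝ) (am : AdvMode) (tm : TimeMode),
        (∀ n δ, 0 < δ → 1 ≤ T n δ) →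
        (∀ n n' δ, 0 < δ → n ≤ n' → T n δ ≤ T n' δ) →
        (∀ n δ δ', 0 < δ → δ ≤ δ' → T n δ' ≤ T n δ) →
        (∀ n η, 0 < η → 1 ≤ L n η) →
        (∀ n η, 0 < η → 1 ≤ C n η) →
        AlgM.ApproxMaintains α T b q pM am tm →
        AlgS.Generates a L C pS →
        ∀ (n : ℕ) (ε : ℝ) (pM' : ℕ → ℝ), 2 ≤ n → 0 < ε → ε < 1 →
          (∀ n' D H : ℕ, 2 ≤ n' → n' ≤ n → 1 ≤ D → (D : ℝ) ≤ c * C n (ε / c) / ε →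
            pM n' D H ≤ pM' H) →
          Maintains Alg n ⌈1 / ε⌉₊
            ⌊((n : ℝ) * L n (ε / c) * C n (ε / c) / ε + 2) ^ c⌋₊ c
            (α + ε) 0
            (c * (T n (ε / (c * C n (ε / c))) * (L n (ε / c) ^ 2 * Real.log n ^ 2 / ε ^ 4)))
            (fun H => c * (Real.log n / ε) * (L n (ε / c) * pM' H + pS n (ε / c)))
            am tm (AlgS.oracle n (ε / c)) := by
  -- `c₁` governs the approximation, `d` the accuracy parameters D ≤ dC/ε, `κ` the size of Z, and
  -- `c` exceeds all requirements. They depend only on α, a, b, q and `AlgM`, so they are fixed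
  -- before n, ε, T, L and C.
  obtain ⟨c₁, hc₁⟩ : ∃ c₁ : ℕ, 5 * α ≤ c₁ := ⟨_, Nat.le_ceil _⟩
  obtain ⟨d, hd⟩ : ∃ d : ℕ, (2 + a) * (2 * c₁) + 1 ≤ d := ⟨_, Nat.le_ceil _⟩
  obtain ⟨a', ha'⟩ : ∃ a' : ℕ, a ≤ a' := ⟨_, Nat.le_ceil _⟩
  obtain ⟨κ, hκ⟩ : ∃ κ, 200 + (AlgM.start.cellBound + AlgM.update.cellBound +
    AlgM.mate.cellBound) + 2 * c₁ + a' + d ^ b ≤ κ := ⟨_, le_rfl⟩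
  obtain ⟨c, hc⟩ : ∃ c, 20 * (κ + 2 * b + 4) + d + 400 + 40 * q + 10400 * c₁ ≤ c := ⟨_, le_rfl⟩
  refine ⟨boost c₁ AlgM, c, by omega, boost_callsOnlyAtStart _ _, boost_singleCalls _ _,
    boost_deterministic _, ?_⟩
  intro T L C AlgS pM pS am tm hT1 hTn hTδ hL hC hAM hAS n ε pM' hn hε hε1 hpM'
  have hc₁0 : (0 : ℝ) < c₁ := by linarith
  have hcc₁ : (c₁ : ℝ) ≤ c := by exact_mod_cast (by omega : c₁ ≤ c)
  have hc1 : (1 : ℝ) ≤ c := by exact_mod_cast (by omega : 1 ≤ c)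
  have hc0 : (0 : ℝ) < c := by linarith
  have hη0 : 0 < ε / c := div_pos hε hc0
  have hC1 := hC n _ hη0
  have hcC : 0 < ε / (c * C n (ε / c)) := by positivity
  have key := boost_guarantee (τ := T n (ε / (c * C n (ε / c)))) (pM' := pM') hα ha hb hM hc₁ hd ha'
    hκ hc hAM hAS hn hε hε1 hη0 (by rw [div_lt_one hc0]; linarith) (by gcongr) rfl rfl
    (hL n _ hη0) hC1 rfl (hT1 _ _ hcC) (fun n' D h₁ h₂ h₃ h₄ => ?_)
    fun n' D H h₁ h₂ h₃ h₄ => hpM' n' D H h₁ h₂ h₃ (by rwa [div_eq_mul_one_div])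
  · convert key using 2
    · ring_nf
    · ring
    · rw [mul_one_div]
  -- D ≤ cC/ε means 1/D ≥ ε/(cC), so monotonicity of T in both arguments applies.
  · have hD0 : (0 : ℝ) < D := by exact_mod_cast h₃
    refine (hTn n' n _ (by positivity) h₂).trans (hTδ n _ _ hcC ?_)
    rw [div_le_div_iff₀ (by positivity) hD0]
    rw [mul_one_div, le_div_iff₀ hε] at h₄
    linarith
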